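/- Let $s\in(0,1)$, $c_s = 4^s s\,\frac{\Gamma(s+\frac12)}{\Gamma(1-s)}\pi^{-1/2}$, and let $L$ be the regional operator on $(0,\infty)$ that encodes $(-\Delta)^s$ on $(0,\infty)$ with the nonlocal Neumann condition on $(-\infty,0)$, that is, $$L\varphi(x)=\mathrm{p.v.}\int_0^\infty(\varphi(x)-\varphi(y))K(x,y)\,dy,\qquad K(x,y)=\frac{c_s}{|x-y|^{1+2s}}+2s\,c_s\int_0^\infty\frac{z^{2s}}{|x+z|^{1+2s}|y+z|^{1+2s}}\,dz .$$ Let $C^2_{2,1+2s}(0,\infty)$ be the space of $C^2$ functions $\varphi:(0,\infty)\to\mathbb C$ for which there is a constant $C'$ with $|\varphi^{(k)}(x)|\le C'x^2$ on $(0,1]$ and $|\varphi^{(k)}(x)|\le C'x^{-1-2s}$ on $(1,\infty)$ for $k=0,1,2$. Let $f$ be the meromorphic function $$f(\beta)=\frac{\Gamma(\beta+1)\sin(\pi s)}{\Gamma(\beta-2s+1)\sin(\pi(\beta-2s))}\left(\frac{\sin(\pi(\beta-s))}{\sin(\pi s)}+\frac{\Gamma(2s-\beta)\Gamma(\beta+1)}{\Gamma(2s)}\right).$$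 Let $0<\varepsilon<2s$ and $C\in\mathbb R$, and let $u:(0,\infty)\to\mathbb C$ be a measurable function with $|u(x)|\le C(1+x^{2s-\varepsilon})$ for all $x>0$ which is a distributional solution of $Lu=0$ in $(0,\infty)$, i.e. $\int_0^\infty u(x)\,L\varphi(x)\,dx=0$ for every $\varphi\in C^2_{2,1+2s}(0,\infty)$. Then $u$ is a constant plus a linear combination of functions $x^{\beta}(\log x)^l$, where $\beta$ is a complex zero of $f$ in the strip $\{0<\operatorname{Re}\beta<2s\}$ and $0\le l<k(\beta)$, with $k(\beta)$ the multiplicity of the zero: there are $A\in\mathbb C$, a finite set $Z$ of zeros of $f$ in this strip, and coefficients $a_{\beta,l}\in\mathbb C$ such that, for almost every $x>0$, $$u(x)=A+\sum_{\beta\in Z}\sum_{l=0}^{k(\beta)-1}a_{\beta,l}\,x^{\beta}(\log x)^l .$$ -/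

import Mathlib

open MeasureTheory Set Filter Topology

noncomputable section

/-- The normalizing constant `c_s = 4^s s Γ(s + 1/2) / (Γ(1 - s) √π)` of the one-dimensional
fractional Laplacian. -/
def fracConst (s : ℝ) : ℝ :=
  (4 : ℝ) ^ s * s * (Real.Gamma (s + 1 / 2) / Real.Gamma (1 - s)) * Real.pi ^ (-(1 / 2) : ℝ)

/-- The part of the kernel that comes from eliminating the values of the function on the negative
half-line by means of the nonlocal Neumann condition. It is used for `x, y > 0` only. -/
def neumannCorrection (s x y : ℝ) : ℝ :=
  2 * s * fracConst s *
    ∫ z in Ioi (0 : ℝ), z ^ (2 * s) / (|x + z| ^ (1 + 2 * s) * |y + z| ^ (1 + 2 * s))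

/-- The full kernel of the regional operator on `(0, ∞)`. -/
def neumannKernel (s x y : ℝ) : ℝ :=
  fracConst s / |x - y| ^ (1 + 2 * s) + neumannCorrection s x y

/-- The regional operator `L φ (x) = p.v. ∫_0^∞ (φ(x) - φ(y)) K(x, y) dy`: the limit, as `δ ↓ 0`, of
the integrals over `{y > 0 : |y - x| ≥ δ}`. Only the values of `φ` on `(0, ∞)` matter for `x > 0`. -/
def neumannOp (s : ℝ) (φ : ℝ → ℂ) (x : ℝ) : ℂ :=
  limUnder (𝓝[>] (0 : ℝ)) fun δ : ℝ =>
    ∫ y in Ioi (0 : ℝ) \ Metric.ball x δ, (φ x - φ y) * (neumannKernel s x y : ℂ)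

/-- The space `C^d_{a,b}(0, ∞)`: functions of class `C^d` on the open half-line whose derivatives up
to order `d` are `O(x^a)` on `(0, 1]` and `O(x^{-b})` on `(1, ∞)`. -/
def MemWeightedC (d : ℕ) (a b : ℝ) (φ : ℝ → ℂ) : Prop :=
  ContDiffOn ℝ d φ (Ioi 0) ∧
    ∃ C : ℝ, ∀ k ≤ d,
      (∀ x ∈ Ioc (0 : ℝ) 1, ‖iteratedDeriv k φ x‖ ≤ C * x ^ a) ∧
      (∀ x ∈ Ioi (1 : ℝ), ‖iteratedDeriv k φ x‖ ≤ C * x ^ (-b))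

/-- `u` is a (measurable) distributional solution of `L u = 0` in `(0, ∞)`, with the test function
space `C^2_{2,1+2s}(0, ∞)`. For `u` of growth `O(1 + x^{2s-ε})` the integrals converge absolutely. -/
def IsDistributionalSolution (s : ℝ) (u : ℝ → ℂ) : Prop :=
  AEStronglyMeasurable u (volume.restrict (Ioi (0 : ℝ))) ∧
    ∀ φ : ℝ → ℂ, MemWeightedC 2 2 (1 + 2 * s) φ →
      ∫ x in Ioi (0 : ℝ), u x * neumannOp s φ x = 0

/-- The explicit symbol `f(β)`. It is read as a meromorphic function: at the isolated points where a
denominator vanishes or a Gamma factor has a pole, the value of this expression is not used. -/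
def neumannSymbol (s : ℝ) (β : ℂ) : ℂ :=
  Complex.Gamma (β + 1) * Complex.sin (Real.pi * s) /
      (Complex.Gamma (β - 2 * s + 1) * Complex.sin (Real.pi * (β - 2 * s))) *
    (Complex.sin (Real.pi * (β - s)) / Complex.sin (Real.pi * s) +
      Complex.Gamma (2 * s - β) * Complex.Gamma (β + 1) / Complex.Gamma (2 * s))

/-- `β` is a zero of the meromorphic function `f`. -/
def IsSymbolZero (s : ℝ) (β : ℂ) : Prop :=
  0 < meromorphicOrderAt (neumannSymbol s) β

/-- The multiplicity of `β` as a zero of `f` (and `0` if `β` is not a zero). -/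
def symbolMult (s : ℝ) (β : ℂ) : ℕ :=
  (meromorphicOrderAt (neumannSymbol s) β).untop₀.toNat

end

/-! The kernel is homogeneous of degree -1-2s, so L commutes with dilations up to a power, and in
the variable t = log x the equation is of convolution type. It is tested only on the dilates of one
function φ₀(x) = x⁴(1-x)₊³. With U(t) = u(eᵗ) and G(t) = eᵗ Lφ₀(eᵗ) this says ∫ U(t) G(t-r) dt = 0
for all r (`integral_mul_imageKernel_eq_zero`).

The transform F(β) = ∫ G(t) e^{βt} dt is explicit for -1 < Re β < 2s (`laplace_imageKernel`). It is
M(β) times the Mellin transform of φ₀, which is 6 divided by four linear factors that do not vanish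
there. The multiplier is M(β) = ∫₀¹ (1-r^{2s-1-β})(1-r^β) K(1,r) dr, where the half r > 1 has been
folded onto r < 1 (`integral_neumannKernel_symbol`). Its singular part follows from the recursion of
the Beta integral (`integral_regionalSymbol`); the Neumann part is, by Fubini, the square of a Beta
value up to constants (`integral_cpow_mul_neumannCorrection`). Off isolated points f is a nonzero
constant times M, so zeros and multiplicities of f and F agree in the strip
(`meromorphicOrderAt_neumannSymbol`).

Let a < 0 and 2s-ε < b < 2s, and let ψ be a test function whose transform vanishes, with
multiplicity, at the finitely many zeros of F in a ≤ Re β ≤ b. Then m = ψ̂/F is analytic there and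
decays quadratically, since |F| ≥ c|β|⁻⁴ far from the real axis and ψ̂ decays rapidly. Its inverse
transform k can be computed on either edge of the strip, hence is O(e^{-at}) and O(e^{-bt}). Now k *
G = ψ, and Fubini gives ∫ Uψ = 0 (`integral_mul_eq_zero_of_convolution_eq_zero`). So U vanishes on
the common kernel of the finitely many functionals ψ ↦ ∫ tˡ e^{βt} ψ, and is therefore a combination
of the functions tˡ e^{βt} (`ae_eq_sum_of_integral_eq_zero`).

It remains to locate the zeros. M is bounded below far from the real axis
(`exists_le_norm_mellinMultiplier`), which gives finiteness. On the imaginary axis only β = 0 is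
possible (`mellinMultiplier_ne_zero_of_re_eq_zero`), so a can be chosen such that every zero is 0 or
has positive real part. The zero 0 contributes a polynomial in log x; the other terms tend to 0 as x
→ 0, where u is bounded, so the polynomial is constant. -/

/-! ### Substitutions x = eᵗ and r ↦ 1/r -/

section ChangeOfVariables

variable {E : Type*} [NormedAddCommGroup E] [NormedSpace ℝ E]

theorem integrableOn_Ioi_zero_iff_integrable_exp (h : ℝ → E) :
    IntegrableOn h (Ioi 0) ↔ Integrable fun t : ℝ => Real.exp t • h (Real.exp t) := by
  have := integrableOn_image_iff_integrableOn_abs_deriv_smul (f := Real.exp) (f' := Real.exp)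
    (s := univ) MeasurableSet.univ (fun x _ => (Real.hasDerivAt_exp x).hasDerivWithinAt)
    Real.exp_injective.injOn h
  simpa [image_univ, Real.range_exp, abs_of_pos, Real.exp_pos] using this

theorem integral_Ioi_zero_eq_integral_exp (h : ℝ → E) :
    ∫ x in Ioi 0, h x = ∫ t : ℝ, Real.exp t • h (Real.exp t) := by
  have := integral_image_eq_integral_abs_deriv_smul (f := Real.exp) (f' := Real.exp)
    (s := univ) MeasurableSet.univ (fun x _ => (Real.hasDerivAt_exp x).hasDerivWithinAt)
    Real.exp_injective.injOn h
  simpa [image_univ, Real.range_exp, abs_of_pos, Real.exp_pos] using this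

theorem image_inv_Ioo_zero {c : ℝ} (hc : 0 < c) : (fun r : ℝ => r⁻¹) '' Ioo 0 c = Ioi c⁻¹ := by
  rw [Set.image_inv_eq_inv, Set.inv_Ioo_0_left hc]

theorem integrableOn_Ioi_inv_iff {c : ℝ} (hc : 0 < c) (h : ℝ → E) :
    IntegrableOn h (Ioi c⁻¹) ↔ IntegrableOn (fun r : ℝ => (r ^ 2)⁻¹ • h r⁻¹) (Ioo 0 c) := by
  have := integrableOn_image_iff_integrableOn_abs_deriv_smul (f := fun r : ℝ => r⁻¹)
    (f' := fun r => -(r ^ 2)⁻¹) (s := Ioo 0 c) measurableSet_Ioo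
    (fun x hx => (hasDerivAt_inv hx.1.ne').hasDerivWithinAt) inv_injective.injOn h
  simpa [image_inv_Ioo_zero hc, abs_neg] using this

theorem integral_Ioi_inv {c : ℝ} (hc : 0 < c) (h : ℝ → E) :
    ∫ r in Ioi c⁻¹, h r = ∫ r in Ioo 0 c, (r ^ 2)⁻¹ • h r⁻¹ := by
  have := integral_image_eq_integral_abs_deriv_smul (f := fun r : ℝ => r⁻¹)
    (f' := fun r => -(r ^ 2)⁻¹) (s := Ioo 0 c) measurableSet_Ioo
    (fun x hx => (hasDerivAt_inv hx.1.ne').hasDerivWithinAt) inv_injective.injOn h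
  simpa [image_inv_Ioo_zero hc, abs_neg] using this

end ChangeOfVariables

/-! ### Beta integrals -/

section Beta

theorem image_mobius_Ioi : (fun r : ℝ => 1 - (1 + r)⁻¹) '' Ioi 0 = Ioo 0 1 := by
  ext y
  simp only [mem_image, mem_Ioi, mem_Ioo]
  constructor
  · rintro ⟨r, hr, rfl⟩
    have h1 : (1 + r)⁻¹ < 1 := inv_lt_one_of_one_lt₀ (by linarith)
    have h2 : 0 < (1 + r)⁻¹ := by positivity
    constructor <;> linarith
  · rintro ⟨h0, h1⟩
    refine ⟨(1 - y)⁻¹ - 1, ?_, ?_⟩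
    · have := one_lt_inv_iff₀.2 ⟨(by linarith : 0 < 1 - y), by linarith⟩
      linarith
    · simp

theorem hasDerivAt_mobius {r : ℝ} (hr : 0 < r) :
    HasDerivAt (fun r : ℝ => 1 - (1 + r)⁻¹) (((1 + r) ^ 2)⁻¹) r := by
  have h : HasDerivAt (fun r : ℝ => 1 + r) 1 r := (hasDerivAt_id r).const_add 1
  have := (h.inv (by positivity)).const_sub 1
  refine this.congr_deriv ?_
  rw [neg_div, neg_neg, one_div]

theorem injOn_mobius : InjOn (fun r : ℝ => 1 - (1 + r)⁻¹) (Ioi 0) := by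
  intro x _ y _ h
  simp only [sub_right_inj, inv_inj, add_right_inj] at h
  exact h

/-- The substitution x = r/(1+r) carries Euler's integral over (0,1) to the half-line. The Jacobian
(1+r)⁻² supplies the missing part of the exponent -(p+q). -/
theorem beta_mobius_integrand (p q : ℂ) {r : ℝ} (hr : r ∈ Ioi (0 : ℝ)) :
    |((1 + r) ^ 2)⁻¹| • (((1 - (1 + r)⁻¹ : ℝ) : ℂ) ^ (p - 1) *
      (1 - ((1 - (1 + r)⁻¹ : ℝ) : ℂ)) ^ (q - 1)) = (r : ℂ) ^ (p - 1) * ((1 + r : ℝ) : ℂ) ^ (-(p + q)) := by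
  have hr : 0 < r := hr
  have h1 : 0 < 1 + r := by linarith
  have e1 : (1 - (1 + r)⁻¹ : ℝ) = r * (1 + r)⁻¹ := by field_simp; ring
  have e2 : (1 - ((1 - (1 + r)⁻¹ : ℝ) : ℂ)) = ((1 + r : ℝ) : ℂ)⁻¹ := by push_cast; ring
  have hne : ((1 + r : ℝ) : ℂ) ≠ 0 := by exact_mod_cast h1.ne'
  have hinv : ∀ w : ℂ, (((1 + r : ℝ) : ℂ)⁻¹) ^ w = ((1 + r : ℝ) : ℂ) ^ (-w) := by
    intro w
    rw [Complex.cpow_neg, Complex.inv_cpow]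
    rw [Complex.arg_ofReal_of_nonneg h1.le]
    exact Real.pi_pos.ne
  rw [e2, e1, Complex.ofReal_mul, Complex.mul_cpow_ofReal_nonneg hr.le (by positivity),
    Complex.ofReal_inv, hinv, hinv, abs_of_pos (by positivity), Complex.real_smul]
  have e3 : (((((1 + r) ^ 2)⁻¹ : ℝ)) : ℂ) = ((1 + r : ℝ) : ℂ) ^ (-2 : ℂ) := by
    rw [Complex.cpow_neg]; norm_cast
  rw [e3, show -(p + q) = -2 + -(p - 1) + -(q - 1) by ring, Complex.cpow_add _ _ hne,
    Complex.cpow_add _ _ hne]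
  ring

theorem integrableOn_betaIntegrand_Ioo {p q : ℂ} (hp : 0 < p.re) (hq : 0 < q.re) :
    IntegrableOn (fun x : ℝ => (x : ℂ) ^ (p - 1) * (1 - (x : ℂ)) ^ (q - 1)) (Ioo 0 1) := by
  have := Complex.betaIntegral_convergent hp hq
  rwa [intervalIntegrable_iff_integrableOn_Ioo_of_le zero_le_one] at this

theorem betaIntegral_eq_integral_Ioo (p q : ℂ) :
    Complex.betaIntegral p q = ∫ x in Ioo (0 : ℝ) 1, (x : ℂ) ^ (p - 1) * (1 - (x : ℂ)) ^ (q - 1) := by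
  rw [Complex.betaIntegral, intervalIntegral.integral_of_le zero_le_one, integral_Ioc_eq_integral_Ioo]

theorem integrableOn_betaPrime {p q : ℂ} (hp : 0 < p.re) (hq : 0 < q.re) :
    IntegrableOn (fun r : ℝ => (r : ℂ) ^ (p - 1) * ((1 + r : ℝ) : ℂ) ^ (-(p + q))) (Ioi 0) := by
  have := integrableOn_betaIntegrand_Ioo hp hq
  rw [← image_mobius_Ioi, integrableOn_image_iff_integrableOn_abs_deriv_smul measurableSet_Ioi
    (fun x hx => (hasDerivAt_mobius hx).hasDerivWithinAt) injOn_mobius] at this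
  exact this.congr_fun (fun r hr => beta_mobius_integrand p q hr) measurableSet_Ioi

theorem integral_betaPrime (p q : ℂ) :
    ∫ r in Ioi (0 : ℝ), (r : ℂ) ^ (p - 1) * ((1 + r : ℝ) : ℂ) ^ (-(p + q)) =
      Complex.betaIntegral p q := by
  rw [betaIntegral_eq_integral_Ioo, ← image_mobius_Ioi,
    integral_image_eq_integral_abs_deriv_smul measurableSet_Ioi
    (fun x hx => (hasDerivAt_mobius hx).hasDerivWithinAt) injOn_mobius]
  exact (setIntegral_congr_fun measurableSet_Ioi fun r hr => beta_mobius_integrand p q hr).symm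

theorem integrableOn_betaPrime_real {p q : ℝ} (hp : 0 < p) (hq : 0 < q) :
    IntegrableOn (fun r : ℝ => r ^ (p - 1) * (1 + r) ^ (-(p + q))) (Ioi 0) := by
  refine IntegrableOn.congr_fun (integrableOn_betaPrime (p := p) (q := q) (by simpa) (by simpa)).norm
    (fun r hr => ?_) measurableSet_Ioi
  have hr : 0 < r := hr
  simp only [norm_mul]
  rw [Complex.norm_cpow_eq_rpow_re_of_pos hr, Complex.norm_cpow_eq_rpow_re_of_pos (by linarith)]
  simp

theorem integrableOn_betaIntegrand_real {p q : ℝ} (hp : 0 < p) (hq : 0 < q) :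
    IntegrableOn (fun r : ℝ => r ^ (p - 1) * (1 - r) ^ (q - 1)) (Ioo 0 1) := by
  refine IntegrableOn.congr_fun
    (integrableOn_betaIntegrand_Ioo (p := p) (q := q) (by simpa) (by simpa)).norm
    (fun r hr => ?_) measurableSet_Ioo
  have e : (1 - (r : ℂ)) = ((1 - r : ℝ) : ℂ) := by push_cast; rfl
  simp only [norm_mul]
  rw [Complex.norm_cpow_eq_rpow_re_of_pos hr.1, e,
    Complex.norm_cpow_eq_rpow_re_of_pos (by linarith [hr.2])]
  simp

/-- A bound for `1 - r ^ p` with the exact first order of vanishing at `1`. -/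
theorem norm_one_sub_cpow_le {p : ℂ} {κ : ℝ} (hκ : 0 ≤ κ) (hp : -κ ≤ p.re) {r : ℝ}
    (hr : r ∈ Ioo (0 : ℝ) 1) :
    ‖1 - (r : ℂ) ^ p‖ ≤ (4 + ‖p‖ * 2 ^ (κ + 1)) * ((1 - r) * r ^ (-κ)) := by
  obtain ⟨h0, h1⟩ := hr
  have hrk : 1 ≤ r ^ (-κ) := Real.one_le_rpow_of_pos_of_le_one_of_nonpos h0 h1.le (by linarith)
  rcases le_total r (1 / 2) with h | h
  · have hn : ‖(r : ℂ) ^ p‖ ≤ r ^ (-κ) := by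
      rw [Complex.norm_cpow_eq_rpow_re_of_pos h0]
      exact Real.rpow_le_rpow_of_exponent_ge h0 h1.le hp
    have : ‖1 - (r : ℂ) ^ p‖ ≤ 2 * r ^ (-κ) := by
      refine (norm_sub_le _ _).trans ?_
      simp only [norm_one]; linarith
    refine this.trans ?_
    have h3 : 0 ≤ ‖p‖ * 2 ^ (κ + 1) * ((1 - r) * r ^ (-κ)) := by
      have : 0 < 1 - r := by linarith
      positivity
    nlinarith
  · have hd : ∀ x ∈ Icc r 1, HasDerivWithinAt (fun x : ℝ => (x : ℂ) ^ p) (p * (x : ℂ) ^ (p - 1))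
        (Icc r 1) x := by
      intro x hx
      have hx0 : 0 < x := h0.trans_le hx.1
      have := ((hasDerivAt_id (x : ℂ)).cpow_const (c := p) (by simp [hx0])).comp_ofReal
      simpa using this.hasDerivWithinAt
    have hb : ∀ x ∈ Ico r 1, ‖p * (x : ℂ) ^ (p - 1)‖ ≤ ‖p‖ * 2 ^ (κ + 1) := by
      intro x hx
      have hx0 : 0 < x := h0.trans_le hx.1
      rw [norm_mul, Complex.norm_cpow_eq_rpow_re_of_pos hx0]
      gcongr
      calc x ^ (p - 1).re ≤ x ^ (-(κ + 1)) :=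
            Real.rpow_le_rpow_of_exponent_ge hx0 hx.2.le (by simp; linarith)
        _ = (x⁻¹) ^ (κ + 1) := by rw [Real.rpow_neg hx0.le, Real.inv_rpow hx0.le]
        _ ≤ 2 ^ (κ + 1) := by
            apply Real.rpow_le_rpow (by positivity) _ (by linarith)
            rw [inv_le_comm₀ hx0 (by norm_num)]
            linarith [hx.1]
    have := norm_image_sub_le_of_norm_deriv_le_segment' hd hb 1 (right_mem_Icc.2 h1.le)
    simp only [Complex.ofReal_one, Complex.one_cpow] at this
    refine this.trans ?_
    have h3 : 0 < 1 - r := by linarith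
    have h4 : 0 ≤ ‖p‖ * 2 ^ (κ + 1) := by positivity
    have h5 : (1 - r) ≤ (1 - r) * r ^ (-κ) := by nlinarith
    nlinarith

end Beta

/-! ### The singular part of the multiplier: reduction to Beta integrals -/

section RegionalSymbol

/-- This is the reflection formula. It persists at natural z, where `Complex.Gamma (-z)` is 0 by
convention: its inverse is then 0, the value of the entire function 1/Γ, and the sine vanishes too.
-/
theorem Gamma_neg_inv {z : ℂ} (hz : -1 < z.re) :
    (Complex.Gamma (-z))⁻¹ = -(Complex.Gamma (1 + z) * Complex.sin (Real.pi * z) / Real.pi) := by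
  have hpi : (Real.pi : ℂ) ≠ 0 := by exact_mod_cast Real.pi_ne_zero
  have hrefl := Complex.Gamma_mul_Gamma_one_sub (-z)
  rw [show (1 : ℂ) - -z = 1 + z by ring, show (Real.pi : ℂ) * -z = -(Real.pi * z) by ring,
    Complex.sin_neg] at hrefl
  by_cases hs : Complex.sin (Real.pi * z) = 0
  · rw [Complex.sin_eq_zero_iff] at hs
    obtain ⟨k, hk⟩ := hs
    have hzk : z = k := by
      rw [mul_comm] at hk; exact mul_right_cancel₀ hpi hk
    have hk0 : 0 ≤ k := by
      rw [hzk] at hz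
      simp only [Complex.intCast_re] at hz
      have : (-1 : ℤ) < k := by exact_mod_cast hz
      omega
    obtain ⟨n, rfl⟩ := Int.eq_ofNat_of_zero_le hk0
    have h0 : Complex.Gamma (-z) = 0 := by
      rw [hzk]; push_cast; exact Complex.Gamma_neg_nat_eq_zero n
    have hs : Complex.sin (Real.pi * z) = 0 := by
      rw [Complex.sin_eq_zero_iff]; exact ⟨n, hk⟩
    rw [h0, hs]; simp
  · have hG : Complex.Gamma (-z) ≠ 0 := by
      intro h
      rw [h, zero_mul] at hrefl
      have := hrefl.symm
      rw [div_eq_zero_iff] at this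
      rcases this with h | h
      · exact hpi h
      · exact hs (neg_eq_zero.1 h)
    rw [div_neg, eq_neg_iff_add_eq_zero, ← sub_neg_eq_add, sub_eq_zero, eq_neg_iff_add_eq_zero]
      at hrefl
    have h2 : Complex.Gamma (-z) * Complex.Gamma (1 + z) * Complex.sin (Real.pi * z) = -Real.pi := by
      have := congrArg (· * Complex.sin (Real.pi * z)) hrefl
      simp only [add_mul, zero_mul, div_mul_cancel₀ _ hs] at this
      linear_combination this
    refine (eq_inv_of_mul_eq_one_left ?_).symm
    rw [neg_mul, div_mul_eq_mul_div, ← neg_div, div_eq_one_iff_eq hpi]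
    linear_combination -h2

theorem integral_cpow_mul_one_sub_rpow {p : ℂ} {q : ℝ} (hp : -1 < p.re) (hq : -1 < q) :
    IntegrableOn (fun r : ℝ => (r : ℂ) ^ p * ((1 - r) ^ q : ℝ)) (Ioo 0 1) ∧
    ∫ r in Ioo (0 : ℝ) 1, (r : ℂ) ^ p * ((1 - r) ^ q : ℝ) =
      Complex.Gamma (p + 1) * Complex.Gamma (q + 1) / Complex.Gamma (p + q + 2) := by
  have h1 : 0 < (p + 1).re := by simp; linarith
  have h2 : 0 < ((q : ℂ) + 1).re := by simp; linarith
  have hc : EqOn (fun x : ℝ => (x : ℂ) ^ (p + 1 - 1) * (1 - (x : ℂ)) ^ ((q : ℂ) + 1 - 1))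
      (fun r : ℝ => (r : ℂ) ^ p * ((1 - r) ^ q : ℝ)) (Ioo 0 1) := by
    intro r hr
    simp only [add_sub_cancel_right]
    rw [Complex.ofReal_cpow (by linarith [hr.2])]
    push_cast; rfl
  refine ⟨(integrableOn_betaIntegrand_Ioo h1 h2).congr_fun hc measurableSet_Ioo, ?_⟩
  rw [← setIntegral_congr_fun measurableSet_Ioo hc, ← betaIntegral_eq_integral_Ioo,
    Complex.betaIntegral_eq_Gamma_mul_div _ _ h1 h2]
  ring_nf

theorem norm_one_sub_mul_one_sub_le {a b : ℂ} {κ μ : ℝ} (hκ : 0 ≤ κ) (ha : -κ ≤ a.re)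
    (hμ : 0 ≤ μ) (hb : -μ ≤ b.re) {r : ℝ} (hr : r ∈ Ioo (0 : ℝ) 1) :
    ‖(1 - (r : ℂ) ^ a) * (1 - (r : ℂ) ^ b)‖ ≤
      ((4 + ‖a‖ * 2 ^ (κ + 1)) * (4 + ‖b‖ * 2 ^ (μ + 1))) * ((1 - r) ^ (2 : ℝ) * r ^ (-(κ + μ))) := by
  rw [norm_mul]
  have h := mul_le_mul (norm_one_sub_cpow_le hκ ha hr) (norm_one_sub_cpow_le hμ hb hr)
    (norm_nonneg _) (by have : 0 < 1 - r := by linarith [hr.2]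
                        have := hr.1
                        positivity)
  refine h.trans (le_of_eq ?_)
  rw [show -(κ + μ) = -κ + -μ by ring, Real.rpow_add hr.1, Real.rpow_two]
  ring

/-- The negative parts of the real parts measure the singularities of 1 - r^a and 1 - r^b at 0. The
condition on the sum matters only when both are negative. -/
theorem exists_decay_exponents {a b : ℂ} (ha : -1 < a.re) (hb : -1 < b.re)
    (hab : -1 < a.re + b.re) :
    ∃ κ μ : ℝ, 0 ≤ κ ∧ -κ ≤ a.re ∧ 0 ≤ μ ∧ -μ ≤ b.re ∧ κ + μ < 1 := by
  refine ⟨max 0 (-a.re), max 0 (-b.re), le_max_left _ _, ?_, le_max_left _ _, ?_, ?_⟩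
  · linarith [le_max_right 0 (-a.re)]
  · linarith [le_max_right 0 (-b.re)]
  · rcases max_choice 0 (-a.re) with h | h <;> rcases max_choice 0 (-b.re) with h' | h' <;>
      rw [h, h'] <;> linarith

theorem integrableOn_regionalSymbol {a b : ℂ} {q : ℝ} (ha : -1 < a.re) (hb : -1 < b.re)
    (hab : -1 < a.re + b.re) (hq : -3 < q) :
    IntegrableOn (fun r : ℝ => (1 - (r : ℂ) ^ a) * (1 - (r : ℂ) ^ b) * ((1 - r) ^ q : ℝ))
      (Ioo 0 1) := by
  obtain ⟨κ, μ, hκ, ha', hμ, hb', hlt⟩ := exists_decay_exponents ha hb hab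
  have hint := (integrableOn_betaIntegrand_real (p := 1 - (κ + μ)) (q := q + 3) (by linarith)
    (by linarith)).const_mul ((4 + ‖a‖ * 2 ^ (κ + 1)) * (4 + ‖b‖ * 2 ^ (μ + 1)))
  refine Integrable.mono' hint ?_ ?_
  · apply Measurable.aestronglyMeasurable
    fun_prop
  · refine (ae_restrict_iff' measurableSet_Ioo).2 (Eventually.of_forall fun r hr => ?_)
    have h1r : 0 < 1 - r := by linarith [hr.2]
    rw [norm_mul, Complex.norm_real, Real.norm_of_nonneg (by positivity)]
    refine (mul_le_mul_of_nonneg_right (norm_one_sub_mul_one_sub_le hκ ha' hμ hb' hr)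
      (by positivity)).trans (le_of_eq ?_)
    rw [show q + 3 - 1 = 2 + q by ring, Real.rpow_add h1r, show 1 - (κ + μ) - 1 = -(κ + μ) by ring]
    ring

theorem hasDerivAt_ofReal_cpow (p : ℂ) {r : ℝ} (hr : 0 < r) :
    HasDerivAt (fun x : ℝ => (x : ℂ) ^ p) (p * (r : ℂ) ^ (p - 1)) r := by
  have := ((hasDerivAt_id (r : ℂ)).cpow_const (c := p) (by simp [hr])).comp_ofReal
  simpa using this

/-- The recursion of the Beta integral in differential form: up to a boundary term, the exponent of
1-r rises by one. -/
theorem hasDerivAt_mul_cpow_mul_one_sub_rpow (p : ℂ) (q : ℝ) {r : ℝ} (hr : r ∈ Ioo (0 : ℝ) 1) :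
    HasDerivAt (fun x : ℝ => (x : ℂ) * (x : ℂ) ^ p * ((1 - x) ^ (q + 1) : ℝ))
      ((p + q + 2) * (r : ℂ) ^ p * ((1 - r) ^ (q + 1) : ℝ) - (q + 1) * (r : ℂ) ^ p * ((1 - r) ^ q : ℝ))
      r := by
  have h1r : 0 < 1 - r := by linarith [hr.2]
  have hd1 : HasDerivAt (fun x : ℝ => (x : ℂ)) 1 r := Complex.ofRealCLM.hasDerivAt
  have hd2 := hasDerivAt_ofReal_cpow p hr.1
  have hd3 : HasDerivAt (fun x : ℝ => (1 - x) ^ (q + 1)) (-1 * (q + 1) * (1 - r) ^ (q + 1 - 1)) r :=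
    ((hasDerivAt_id r).const_sub 1).rpow_const (Or.inl h1r.ne')
  have := (hd1.mul hd2).mul hd3.ofReal_comp
  refine this.congr_deriv ?_
  have hr0 : (r : ℂ) ≠ 0 := by exact_mod_cast hr.1.ne'
  rw [Pi.mul_apply, add_sub_cancel_right, Complex.cpow_sub _ _ hr0, Complex.cpow_one, Real.rpow_add h1r,
    Real.rpow_one]
  push_cast
  field_simp
  ring

theorem tendsto_rpow_mul_one_sub_rpow {c d : ℝ} (hc : 0 < c) (hd : 0 < d) (M : ℝ) :
    Tendsto (fun x : ℝ => M * (x ^ c * (1 - x) ^ d)) (𝓝[>] 0) (𝓝 0) ∧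
    Tendsto (fun x : ℝ => M * (x ^ c * (1 - x) ^ d)) (𝓝[<] 1) (𝓝 0) := by
  have h : Continuous fun x : ℝ => M * (x ^ c * (1 - x) ^ d) := by
    apply Continuous.mul continuous_const
    exact (Real.continuous_rpow_const hc.le).mul
      ((Real.continuous_rpow_const hd.le).comp (continuous_const.sub continuous_id))
  constructor
  · have := (h.tendsto 0).mono_left (nhdsWithin_le_nhds (s := Ioi 0))
    simpa [Real.zero_rpow hc.ne'] using this
  · have := (h.tendsto 1).mono_left (nhdsWithin_le_nhds (s := Iio 1))
    simpa [Real.zero_rpow hd.ne'] using this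

/-- The integrand on the left converges only because of its double zero at r = 1, so its four powers
cannot be integrated separately. Two applications of the recursion raise the exponent of 1-r to
1-2s, after which they can. Since a + b = 2s-1, the first application loses the power r^{a+b}, and
what it leaves at exponent -2s is cancelled by the second. -/
theorem integral_regionalSymbol_by_parts {s : ℝ} (hs0 : 0 < s) (hs1 : s < 1) {a b : ℂ}
    (ha : -1 < a.re) (hb : -1 < b.re) (hab : a + b = 2 * s - 1) :
    2 * s * (2 * s - 1) * ∫ r in Ioo (0 : ℝ) 1,
        (1 - (r : ℂ) ^ a) * (1 - (r : ℂ) ^ b) * ((1 - r) ^ (-1 - 2 * s) : ℝ) =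
      ∫ r in Ioo (0 : ℝ) 1, (-(a + b) * (2 - 2 * s) * ((r : ℂ) ^ (0 : ℂ) * ((1 - r) ^ (1 - 2 * s) : ℝ))
        + b * (1 - b) * ((r : ℂ) ^ a * ((1 - r) ^ (1 - 2 * s) : ℝ))
        + a * (1 - a) * ((r : ℂ) ^ b * ((1 - r) ^ (1 - 2 * s) : ℝ))) := by
  have habre : a.re + b.re = 2 * s - 1 := by
    have := congrArg Complex.re hab
    simpa using this
  have hF := integrableOn_regionalSymbol (q := -1 - 2 * s) ha hb (by linarith) (by linarith)
  have hB : ∀ p : ℂ, -1 < p.re → IntegrableOn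
      (fun r : ℝ => (r : ℂ) ^ p * ((1 - r) ^ (1 - 2 * s) : ℝ)) (Ioo 0 1) :=
    fun p hp => (integral_cpow_mul_one_sub_rpow hp (by linarith)).1
  have hH : Integrable (fun r : ℝ =>
      -(a + b) * (2 - 2 * s) * ((r : ℂ) ^ (0 : ℂ) * ((1 - r) ^ (1 - 2 * s) : ℝ))
        + b * (1 - b) * ((r : ℂ) ^ a * ((1 - r) ^ (1 - 2 * s) : ℝ))
        + a * (1 - a) * ((r : ℂ) ^ b * ((1 - r) ^ (1 - 2 * s) : ℝ))) (volume.restrict (Ioo 0 1)) :=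
    ((((hB 0 (by simp)).const_mul (-(a + b) * (2 - 2 * s))).add
    ((hB a ha).const_mul (b * (1 - b)))).add ((hB b hb).const_mul (a * (1 - a))))
  rw [← sub_eq_zero, ← integral_const_mul, ← integral_sub (hF.const_mul _) hH]
  -- All boundary terms collected into one primitive, grouped so that the zeros at x = 1 stay
  -- visible.
  set W : ℝ → ℂ := fun x => (2 * s - 1) * (x * ((1 - (x : ℂ) ^ a) * (1 - (x : ℂ) ^ b)) *
      ((1 - x) ^ (-1 - 2 * s + 1) : ℝ)) +
      x * (b * (1 - (x : ℂ) ^ a) + a * (1 - (x : ℂ) ^ b)) * ((1 - x) ^ (- 2 * s + 1) : ℝ) with hW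
  have hderiv : ∀ x ∈ Ioo (0 : ℝ) 1, HasDerivAt W
      (2 * s * (2 * s - 1) * ((1 - (x : ℂ) ^ a) * (1 - (x : ℂ) ^ b) * ((1 - x) ^ (-1 - 2 * s) : ℝ))
      - (-(a + b) * (2 - 2 * s) * ((x : ℂ) ^ (0 : ℂ) * ((1 - x) ^ (1 - 2 * s) : ℝ))
        + b * (1 - b) * ((x : ℂ) ^ a * ((1 - x) ^ (1 - 2 * s) : ℝ))
        + a * (1 - a) * ((x : ℂ) ^ b * ((1 - x) ^ (1 - 2 * s) : ℝ)))) x := by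
    intro x hx
    have hT := fun p q => hasDerivAt_mul_cpow_mul_one_sub_rpow p q hx
    have h := ((((hT 0 (-1 - 2 * s)).sub (hT a (-1 - 2 * s))).sub (hT b (-1 - 2 * s))).add
      (hT (a + b) (-1 - 2 * s))).const_mul (2 * s - 1 : ℂ)
    have h' := (((hT 0 (-2 * s)).const_mul (a + b)).sub ((hT a (-2 * s)).const_mul b)).sub
      ((hT b (-2 * s)).const_mul a)
    have h2 := h.add h'
    have hx0 : (x : ℂ) ≠ 0 := by exact_mod_cast hx.1.ne'
    refine (h2.congr_of_eventuallyEq ?_).congr_deriv ?_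
    · filter_upwards [Ioi_mem_nhds hx.1] with y hy
      have hy0 : (y : ℂ) ≠ 0 := by exact_mod_cast (ne_of_gt hy)
      simp only [hW, Pi.add_apply, Pi.sub_apply, Complex.cpow_zero, Complex.cpow_add _ _ hy0]
      ring
    · simp only [Complex.cpow_zero, Complex.cpow_add _ _ hx0]
      have e1 : -1 - 2 * s + 1 = -2 * s := by ring
      have e2 : -2 * s + 1 = 1 - 2 * s := by ring
      rw [e1, e2]
      push_cast
      have ha' : a = 2 * s - 1 - b := by linear_combination hab
      generalize (((1 - x) ^ (-1 - 2 * s) : ℝ) : ℂ) = A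
      generalize (((1 - x) ^ (-2 * s) : ℝ) : ℂ) = B
      generalize (((1 - x) ^ (1 - 2 * s) : ℝ) : ℂ) = D
      generalize (x : ℂ) ^ a = X
      generalize (x : ℂ) ^ b = Y
      subst ha'
      ring
  obtain ⟨κ, μ, hκ, ha', hμ, hb', hlt⟩ := exists_decay_exponents ha hb (by linarith)
  set Ma := 4 + ‖a‖ * 2 ^ (κ + 1) with hMa
  set Mb := 4 + ‖b‖ * 2 ^ (μ + 1) with hMb
  set M := ‖(2 * s - 1 : ℂ)‖ * (Ma * Mb) + (‖b‖ * Ma + ‖a‖ * Mb) with hM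
  -- A double zero against the exponent -2s and a simple zero against 1-2s both leave (1-x)^{2-2s};
  -- the factor x outweighs the singularity x^{-(κ+μ)} at 0.
  have hbound : ∀ x ∈ Ioo (0 : ℝ) 1, ‖W x‖ ≤ M * (x ^ (1 - (κ + μ)) * (1 - x) ^ (2 - 2 * s)) := by
    intro x hx
    have h1x : 0 < 1 - x := by linarith [hx.2]
    have hx0 := hx.1
    have k1 : ‖1 - (x : ℂ) ^ a‖ ≤ Ma * ((1 - x) * x ^ (-(κ + μ))) := by
      refine (norm_one_sub_cpow_le hκ ha' hx).trans ?_
      have : x ^ (-κ) ≤ x ^ (-(κ + μ)) :=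
        Real.rpow_le_rpow_of_exponent_ge hx.1 hx.2.le (by linarith)
      gcongr
    have k2 : ‖1 - (x : ℂ) ^ b‖ ≤ Mb * ((1 - x) * x ^ (-(κ + μ))) := by
      refine (norm_one_sub_cpow_le hμ hb' hx).trans ?_
      have : x ^ (-μ) ≤ x ^ (-(κ + μ)) :=
        Real.rpow_le_rpow_of_exponent_ge hx.1 hx.2.le (by linarith)
      gcongr
    have k3 := norm_one_sub_mul_one_sub_le hκ ha' hμ hb' hx
    rw [← hMa, ← hMb] at k3
    have p1 : (1 - x) ^ (2 : ℝ) * (1 - x) ^ (-1 - 2 * s + 1) = (1 - x) ^ (2 - 2 * s) := by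
      rw [← Real.rpow_add h1x]; ring_nf
    have p2 : (1 - x) * (1 - x) ^ (-2 * s + 1) = (1 - x) ^ (2 - 2 * s) := by
      rw [← Real.rpow_one_add' h1x.le (by linarith)]; ring_nf
    have p3 : x * x ^ (-(κ + μ)) = x ^ (1 - (κ + μ)) := by
      rw [← Real.rpow_one_add' hx0.le (by linarith)]; ring_nf
    rw [hW]
    refine (norm_add_le _ _).trans ?_
    simp only [norm_mul, Complex.norm_real, Real.norm_of_nonneg hx0.le] at k3 ⊢
    rw [Real.norm_of_nonneg (Real.rpow_nonneg h1x.le _), Real.norm_of_nonneg (Real.rpow_nonneg h1x.le _)]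
    have k4 : ‖b * (1 - (x : ℂ) ^ a) + a * (1 - (x : ℂ) ^ b)‖ ≤
        (‖b‖ * Ma + ‖a‖ * Mb) * ((1 - x) * x ^ (-(κ + μ))) := by
      refine (norm_add_le _ _).trans ?_
      rw [norm_mul, norm_mul]
      have := mul_le_mul_of_nonneg_left k1 (norm_nonneg b)
      have := mul_le_mul_of_nonneg_left k2 (norm_nonneg a)
      linarith
    calc _ ≤ ‖(2 * s - 1 : ℂ)‖ * (x * (Ma * Mb * ((1 - x) ^ (2 : ℝ) * x ^ (-(κ + μ)))) *
            (1 - x) ^ (-1 - 2 * s + 1)) + x * ((‖b‖ * Ma + ‖a‖ * Mb) * ((1 - x) * x ^ (-(κ + μ)))) *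
            (1 - x) ^ (-2 * s + 1) := by gcongr
      _ = ‖(2 * s - 1 : ℂ)‖ * (Ma * Mb) * ((x * x ^ (-(κ + μ))) * ((1 - x) ^ (2 : ℝ) *
            (1 - x) ^ (-1 - 2 * s + 1))) + (‖b‖ * Ma + ‖a‖ * Mb) * ((x * x ^ (-(κ + μ))) *
            ((1 - x) * (1 - x) ^ (-2 * s + 1))) := by ring
      _ = _ := by rw [p1, p2, p3, hM]; ring
  obtain ⟨t0, t1⟩ := tendsto_rpow_mul_one_sub_rpow (c := 1 - (κ + μ)) (d := 2 - 2 * s)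
    (by linarith) (by linarith) M
  have hW0 : Tendsto W (𝓝[>] 0) (𝓝 0) := by
    refine squeeze_zero_norm' ?_ t0
    filter_upwards [Ioo_mem_nhdsGT zero_lt_one] with x hx using hbound x hx
  have hW1 : Tendsto W (𝓝[<] 1) (𝓝 0) := by
    refine squeeze_zero_norm' ?_ t1
    filter_upwards [Ioo_mem_nhdsLT zero_lt_one] with x hx using hbound x hx
  have hint := (hF.const_mul (2 * s * (2 * s - 1) : ℂ)).sub hH
  have := intervalIntegral.integral_eq_sub_of_hasDerivAt_of_tendsto zero_lt_one hderiv
    ((intervalIntegrable_iff_integrableOn_Ioo_of_le zero_le_one).2 hint) hW0 hW1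
  rw [intervalIntegral.integral_of_le zero_le_one, integral_Ioc_eq_integral_Ioo, sub_zero] at this
  exact this

end RegionalSymbol

/-! ### Closed form of the singular part -/

section RegionalSymbolValue

theorem inv_Gamma_eq_mul (z : ℂ) :
    (Complex.Gamma z)⁻¹ = z * (Complex.Gamma (z + 1))⁻¹ := by
  simpa using Complex.one_div_Gamma_eq_self_mul_one_div_Gamma_add_one z

theorem integral_regionalSymbol_eq_Gamma {s : ℝ} (hs0 : 0 < s) (hs1 : s < 1) {a b : ℂ}
    (ha : -1 < a.re) (hb : -1 < b.re) (hab : a + b = 2 * s - 1) :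
    2 * s * (2 * s - 1) * ∫ r in Ioo (0 : ℝ) 1,
        (1 - (r : ℂ) ^ a) * (1 - (r : ℂ) ^ b) * ((1 - r) ^ (-1 - 2 * s) : ℝ) =
      -(2 * s - 1) - Complex.Gamma (2 - 2 * s) *
        (Complex.Gamma (a + 1) * (Complex.Gamma (-b))⁻¹ +
          Complex.Gamma (b + 1) * (Complex.Gamma (-a))⁻¹) := by
  rw [integral_regionalSymbol_by_parts hs0 hs1 ha hb hab]
  have hB := fun (p : ℂ) (hp : -1 < p.re) =>
    integral_cpow_mul_one_sub_rpow (p := p) (q := 1 - 2 * s) hp (by linarith)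
  obtain ⟨i0, e0⟩ := hB 0 (by simp)
  obtain ⟨ia, ea⟩ := hB a ha
  obtain ⟨ib, eb⟩ := hB b hb
  rw [integral_add ((i0.const_mul _).fun_add (ia.const_mul _)) (ib.const_mul _),
    integral_add (i0.const_mul _) (ia.const_mul _), integral_const_mul, integral_const_mul,
    integral_const_mul, e0, ea, eb]
  have hne : (2 - 2 * s : ℂ) ≠ 0 := by
    have : (2 - 2 * s : ℝ) ≠ 0 := by linarith
    exact_mod_cast this
  have hG : Complex.Gamma (2 - 2 * s) ≠ 0 := by
    apply Complex.Gamma_ne_zero_of_re_pos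
    simp; linarith
  have g0 : Complex.Gamma (0 + ((1 - 2 * s : ℝ) : ℂ) + 2) = (2 - 2 * s) * Complex.Gamma (2 - 2 * s) := by
    rw [← Complex.Gamma_add_one _ hne]; congr 1; push_cast; ring
  have g1 : ((1 - 2 * s : ℝ) : ℂ) + 1 = 2 - 2 * s := by push_cast; ring
  -- Two uses of 1/Γ(z) = z/Γ(z+1). With the convention 0⁻¹ = 0 this holds at the poles of Γ as
  -- well.
  have key : ∀ x y : ℂ, x + y = 2 * s - 1 → y * (1 - y) * (Complex.Gamma (x + ((1 - 2 * s : ℝ) : ℂ) + 2))⁻¹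
      = -(Complex.Gamma (-y))⁻¹ := by
    intro x y hxy
    rw [inv_Gamma_eq_mul (-y), inv_Gamma_eq_mul (-y + 1)]
    have : -y + 1 + 1 = x + ((1 - 2 * s : ℝ) : ℂ) + 2 := by push_cast; linear_combination -hxy
    rw [this]; ring
  have ka := key a b hab
  have kb := key b a (by rw [add_comm, hab])
  rw [g0, g1, hab, zero_add, Complex.Gamma_one]
  simp only [div_eq_mul_inv]
  rw [show -(2 * (s : ℂ) - 1) * (2 - 2 * s) * (1 * Complex.Gamma (2 - 2 * s) *
    ((2 - 2 * s) * Complex.Gamma (2 - 2 * s))⁻¹) = -(2 * s - 1) by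
      rw [one_mul, mul_inv, mul_left_comm (Complex.Gamma _), mul_inv_cancel₀ hG, mul_one, mul_assoc,
        mul_inv_cancel₀ hne, mul_one]]
  linear_combination (Complex.Gamma (a + 1) * Complex.Gamma (2 - 2 * s)) * ka +
    (Complex.Gamma (b + 1) * Complex.Gamma (2 - 2 * s)) * kb

/-- The closed form of the symbol of the regional fractional Laplacian on the half-line. -/
noncomputable def regionalSymbolValue (s : ℝ) (β : ℂ) : ℂ :=
  -1 / (2 * s) + Complex.Gamma (1 + β) * Complex.Gamma (2 * s - β) / Complex.Gamma (1 + 2 * s) *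
    (Complex.sin (Real.pi * (s - β)) / Complex.sin (Real.pi * s))

theorem sin_pi_mul_ofReal_ne_zero {s : ℝ} (hs0 : 0 < s) (hs1 : s < 1) :
    Complex.sin (Real.pi * s) ≠ 0 := by
  have : Real.sin (Real.pi * s) ≠ 0 := by
    apply (Real.sin_pos_of_pos_of_lt_pi (by positivity) _).ne'
    nlinarith [Real.pi_pos]
  exact_mod_cast this

theorem Gamma_one_add_two_mul_ne_zero {s : ℝ} (hs0 : 0 < s) : Complex.Gamma (1 + 2 * s) ≠ 0 := by
  apply Complex.Gamma_ne_zero_of_re_pos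
  simp; linarith

theorem Gamma_one_add_two_mul {s : ℝ} (hs0 : 0 < s) :
    Complex.Gamma (1 + 2 * s) = 2 * s * Complex.Gamma (2 * s) := by
  rw [add_comm, Complex.Gamma_add_one]
  have : (2 * s : ℝ) ≠ 0 := by positivity
  exact_mod_cast this

/-- Reflection turns the two reciprocal Gamma factors into sines whose sum is a product containing
cos(πs). This factor cancels against the one from Γ(2-2s)Γ(1+2s), so the final formula is regular at
s = 1/2, although the factor 2s-1 of the recursion has to be divided out here. -/
theorem integral_regionalSymbol_of_ne_half {s : ℝ} (hs0 : 0 < s) (hs1 : s < 1) (hs : s ≠ 1 / 2)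
    {β : ℂ} (hβ : -1 < β.re) (hβ' : β.re < 2 * s) :
    ∫ r in Ioo (0 : ℝ) 1, (1 - (r : ℂ) ^ (2 * s - 1 - β)) * (1 - (r : ℂ) ^ β) *
      ((1 - r) ^ (-1 - 2 * s) : ℝ) = regionalSymbolValue s β := by
  have h := integral_regionalSymbol_eq_Gamma hs0 hs1 (a := 2 * s - 1 - β) (b := β)
    (by simp; linarith) hβ (by ring)
  set J := ∫ r in Ioo (0 : ℝ) 1, (1 - (r : ℂ) ^ (2 * s - 1 - β)) * (1 - (r : ℂ) ^ β) *
      ((1 - r) ^ (-1 - 2 * s) : ℝ)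
  have hsC : (s : ℂ) ≠ 0 := by exact_mod_cast hs0.ne'
  have hs' : (2 * s - 1 : ℂ) ≠ 0 := by
    have : (2 * s - 1 : ℝ) ≠ 0 := fun h => hs (by linarith)
    exact_mod_cast this
  have hsin := sin_pi_mul_ofReal_ne_zero hs0 hs1
  have hcos : Complex.cos (Real.pi * s) ≠ 0 := by
    intro h
    have h : Real.cos (Real.pi * s) = 0 := by exact_mod_cast h
    rw [Real.cos_eq_zero_iff] at h
    obtain ⟨k, hk⟩ := h
    have hk : s = k + 1 / 2 := by
      have := Real.pi_pos.ne'
      field_simp at hk ⊢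
      linarith
    have : (-1 : ℝ) < k := by linarith
    have : (k : ℝ) < 1 := by linarith
    have h1 : (-1 : ℤ) < k := by exact_mod_cast ‹(-1 : ℝ) < k›
    have h2 : k < (1 : ℤ) := by exact_mod_cast ‹(k : ℝ) < 1›
    have : k = 0 := by omega
    subst this
    exact hs (by simpa using hk)
  have hpi : (Real.pi : ℂ) ≠ 0 := by exact_mod_cast Real.pi_ne_zero
  have hG1 := Gamma_one_add_two_mul_ne_zero hs0
  have hrefl : Complex.Gamma (2 - 2 * s) * Complex.Gamma (1 + 2 * s) *
      (2 * Complex.sin (Real.pi * s) * Complex.cos (Real.pi * s)) =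
      -(Real.pi * (2 * s - 1) * (2 * s)) := by
    have h1 := Complex.Gamma_mul_Gamma_one_sub (2 * s - 1)
    rw [show (1 - (2 * s - 1) : ℂ) = 2 - 2 * s by ring,
      show (Real.pi : ℂ) * (2 * s - 1) = 2 * (Real.pi * s) - Real.pi by ring, Complex.sin_sub_pi,
      Complex.sin_two_mul] at h1
    have h2 := Complex.Gamma_add_one _ hs'
    rw [show (2 * s - 1 + 1 : ℂ) = 2 * s by ring] at h2
    rw [Gamma_one_add_two_mul hs0, h2]
    have hne : -(2 * Complex.sin (Real.pi * s) * Complex.cos (Real.pi * s)) ≠ 0 :=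
      neg_ne_zero.2 (mul_ne_zero (mul_ne_zero two_ne_zero hsin) hcos)
    rw [eq_div_iff hne] at h1
    linear_combination -(2 * s * (2 * s - 1) : ℂ) * h1
  have htrig : Complex.sin (Real.pi * β) + Complex.sin (Real.pi * (2 * s - 1 - β)) =
      -2 * Complex.cos (Real.pi * s) * Complex.sin (Real.pi * (s - β)) := by
    rw [show (Real.pi : ℂ) * β = Real.pi * s - Real.pi * (s - β) by ring,
      show (Real.pi : ℂ) * (2 * s - 1 - (β)) = (Real.pi * s + Real.pi * (s - β)) - Real.pi by ring,
      Complex.sin_sub_pi, Complex.sin_sub, Complex.sin_add]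
    ring
  rw [Gamma_neg_inv hβ, Gamma_neg_inv (z := 2 * s - 1 - β) (by simp; linarith)] at h
  rw [show (2 * s - 1 - β + 1 : ℂ) = 2 * s - β by ring,
    show (1 + (2 * s - 1 - β) : ℂ) = 2 * s - β by ring, add_comm β 1] at h
  have h3 : 2 * s * (2 * s - 1) * J = -(2 * s - 1) + Complex.Gamma (2 - 2 * s) *
      (Complex.Gamma (1 + β) * Complex.Gamma (2 * s - β)) / Real.pi *
      (-2 * Complex.cos (Real.pi * s) * Complex.sin (Real.pi * (s - β))) := by
    rw [h, ← htrig]; ring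
  have hG2 : Complex.Gamma (2 - 2 * s) = -(Real.pi * (2 * s - 1) * (2 * s)) /
      (Complex.Gamma (1 + 2 * s) * (2 * Complex.sin (Real.pi * s) * Complex.cos (Real.pi * s))) := by
    rw [eq_div_iff (mul_ne_zero hG1 (mul_ne_zero (mul_ne_zero two_ne_zero hsin) hcos)), ← hrefl]
    ring
  have hne2 : (2 * s * (2 * s - 1) : ℂ) ≠ 0 := mul_ne_zero (mul_ne_zero two_ne_zero hsC) hs'
  refine mul_left_cancel₀ hne2 ?_
  rw [h3, hG2, regionalSymbolValue]
  generalize Complex.Gamma (1 + 2 * s) = A at *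
  generalize Complex.sin (Real.pi * s) = B at *
  generalize Complex.cos (Real.pi * s) = D at *
  generalize Complex.Gamma (1 + β) = X
  generalize Complex.Gamma (2 * s - β) = Y
  field_simp

theorem continuousAt_integral_regionalSymbol {β : ℂ} (hβ : -1 < β.re) (hβ' : β.re < 1) :
    ContinuousAt (fun s : ℝ => ∫ r in Ioo (0 : ℝ) 1,
      (1 - (r : ℂ) ^ (2 * s - 1 - β)) * (1 - (r : ℂ) ^ β) * ((1 - r) ^ (-1 - 2 * s) : ℝ)) (1 / 2) := by
  -- For s near 1/2 one has |2s-1| ≤ η. This margin is spent once in the exponent at r = 0, through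
  -- κ, and once in the exponent at r = 1.
  obtain ⟨η, hη0, hη⟩ : ∃ η : ℝ, 0 < η ∧ |β.re| + η < 1 ∧ η < 1 := by
    have : |β.re| < 1 := abs_lt.2 ⟨hβ, hβ'⟩
    exact ⟨(1 - |β.re|) / 2, by linarith, by linarith, by linarith [abs_nonneg β.re]⟩
  set κ := max 0 β.re + η
  set μ := max 0 (-β.re)
  have hκμ : κ + μ = |β.re| + η := by
    rcases le_total 0 β.re with h | h
    · simp [κ, μ, h, abs_of_nonneg]
    · simp [κ, μ, h, abs_of_nonpos]; ring
  have hκ0 : 0 ≤ κ := by have := le_max_left 0 β.re; simp only [κ]; linarith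
  refine continuousAt_of_dominated (bound := fun r => ((4 + (‖β‖ + 1) * 2 ^ (κ + 1)) *
    (4 + ‖β‖ * 2 ^ (μ + 1))) * (r ^ (1 - (κ + μ) - 1) * (1 - r) ^ ((1 - η) - 1))) ?_ ?_ ?_ ?_
  · refine Eventually.of_forall fun s => Measurable.aestronglyMeasurable ?_
    fun_prop
  · have hnh : Ioo (1 / 2 - η / 2) (1 / 2 + η / 2) ∈ 𝓝 (1 / 2 : ℝ) :=
      Ioo_mem_nhds (by linarith) (by linarith)
    filter_upwards [hnh] with s hs
    refine (ae_restrict_iff' measurableSet_Ioo).2 (Eventually.of_forall fun r hr => ?_)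
    have h1r : 0 < 1 - r := by linarith [hr.2]
    have hr0 := hr.1
    have h2s : |2 * s - 1| ≤ η := abs_le.2 ⟨by linarith [hs.1], by linarith [hs.2]⟩
    rw [norm_mul, Complex.norm_real, Real.norm_of_nonneg (by positivity)]
    have h1 := norm_one_sub_mul_one_sub_le (a := 2 * s - 1 - β) (b := β) (κ := κ) (μ := μ) hκ0
      (by simp only [κ, Complex.sub_re, Complex.mul_re, Complex.re_ofNat, Complex.ofReal_re,
            Complex.im_ofNat, Complex.ofReal_im, mul_zero, sub_zero, Complex.one_re]
          have := le_max_right 0 β.re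
          linarith [(abs_le.1 h2s).1]) (le_max_left _ _)
      (by linarith [le_max_right 0 (-β.re)]) hr
    have h2 : ‖(2 * s - 1 - β : ℂ)‖ ≤ ‖β‖ + 1 := by
      refine (norm_sub_le _ _).trans ?_
      have : ‖(2 * s - 1 : ℂ)‖ = |2 * s - 1| := by
        rw [← Real.norm_eq_abs, ← Complex.norm_real]; push_cast; rfl
      linarith
    have h3 : (1 - r) ^ (2 : ℝ) * (1 - r) ^ (-1 - 2 * s) ≤ (1 - r) ^ ((1 - η) - 1) := by
      rw [← Real.rpow_add h1r]
      exact Real.rpow_le_rpow_of_exponent_ge h1r (by linarith) (by linarith [(abs_le.1 h2s).2])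
    calc _ ≤ ((4 + ‖(2 * s - 1 - β : ℂ)‖ * 2 ^ (κ + 1)) * (4 + ‖β‖ * 2 ^ (μ + 1))) *
          ((1 - r) ^ (2 : ℝ) * r ^ (-(κ + μ))) * (1 - r) ^ (-1 - 2 * s) := by gcongr
      _ = ((4 + ‖(2 * s - 1 - β : ℂ)‖ * 2 ^ (κ + 1)) * (4 + ‖β‖ * 2 ^ (μ + 1))) *
          (r ^ (1 - (κ + μ) - 1) * ((1 - r) ^ (2 : ℝ) * (1 - r) ^ (-1 - 2 * s))) := by
            rw [show 1 - (κ + μ) - 1 = -(κ + μ) by ring]; ring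
      _ ≤ _ := by gcongr
  · exact (integrableOn_betaIntegrand_real (by linarith) (by linarith)).const_mul _
  · refine (ae_restrict_iff' measurableSet_Ioo).2 (Eventually.of_forall fun r hr => ?_)
    have hr0 : (r : ℂ) ≠ 0 := by exact_mod_cast hr.1.ne'
    have h1r : 1 - r ≠ 0 := by linarith [hr.2]
    have c1 : Continuous fun s : ℝ => (r : ℂ) ^ (2 * s - 1 - β : ℂ) :=
      Continuous.const_cpow (by fun_prop) (Or.inl hr0)
    have c2 : Continuous fun s : ℝ => (1 - r) ^ (-1 - 2 * s) :=
      Continuous.rpow continuous_const (by fun_prop) (fun _ => Or.inl h1r)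
    exact (((continuous_const.sub c1).mul continuous_const).mul
      (Complex.continuous_ofReal.comp c2)).continuousAt

theorem continuousAt_regionalSymbolValue_param {β : ℂ} (hβ' : β.re < 1) :
    ContinuousAt (fun s : ℝ => regionalSymbolValue s β) (1 / 2) := by
  unfold regionalSymbolValue
  have g : ∀ z : ℂ, 0 < z.re → ContinuousAt Complex.Gamma z := fun z hz =>
    (Complex.differentiableAt_Gamma z (fun m h => by
      rw [h] at hz; simp at hz; linarith [(Nat.cast_nonneg m : (0 : ℝ) ≤ m)])).continuousAt
  have h1 : ContinuousAt (fun s : ℝ => Complex.Gamma (2 * s - β)) (1 / 2) := by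
    refine ContinuousAt.comp (f := fun s : ℝ => (2 * s - β : ℂ)) (g _ ?_) (by fun_prop)
    simp; linarith
  have h2 : ContinuousAt (fun s : ℝ => Complex.Gamma (1 + 2 * s)) (1 / 2) := by
    refine ContinuousAt.comp (f := fun s : ℝ => (1 + 2 * s : ℂ)) (g _ ?_) (by fun_prop)
    simp
  refine ContinuousAt.add (ContinuousAt.div continuousAt_const (by fun_prop) (by simp)) ?_
  refine ContinuousAt.mul (ContinuousAt.div (continuousAt_const.mul h1) h2 ?_)
    (ContinuousAt.div (by fun_prop) (by fun_prop) ?_)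
  · exact Gamma_one_add_two_mul_ne_zero (by norm_num)
  · exact sin_pi_mul_ofReal_ne_zero (by norm_num) (by norm_num)

/-- At s = 1/2 the recursion identity carries the factor 0 and says nothing. Both sides are
continuous in s, so the value is recovered as a limit. -/
theorem integral_regionalSymbol {s : ℝ} (hs0 : 0 < s) (hs1 : s < 1)
    {β : ℂ} (hβ : -1 < β.re) (hβ' : β.re < 2 * s) :
    ∫ r in Ioo (0 : ℝ) 1, (1 - (r : ℂ) ^ (2 * s - 1 - β)) * (1 - (r : ℂ) ^ β) *
      ((1 - r) ^ (-1 - 2 * s) : ℝ) = regionalSymbolValue s β := by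
  by_cases hs : s = 1 / 2
  · subst hs
    have hβ1 : β.re < 1 := by linarith
    have h1 := (continuousAt_integral_regionalSymbol hβ hβ1).tendsto.mono_left
      (nhdsWithin_le_nhds (s := {(1 / 2 : ℝ)}ᶜ))
    have h2 := (continuousAt_regionalSymbolValue_param hβ1).tendsto.mono_left
      (nhdsWithin_le_nhds (s := {(1 / 2 : ℝ)}ᶜ))
    refine tendsto_nhds_unique h1 (h2.congr' ?_)
    have hnh : Ioo (max 0 (β.re / 2)) 1 ∈ 𝓝 (1 / 2 : ℝ) :=
      Ioo_mem_nhds (max_lt (by norm_num) (by linarith)) (by norm_num)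
    filter_upwards [self_mem_nhdsWithin, nhdsWithin_le_nhds hnh] with s hs hs'
    have := le_max_left 0 (β.re / 2)
    have := le_max_right 0 (β.re / 2)
    exact (integral_regionalSymbol_of_ne_half (by linarith [hs'.1]) hs'.2 hs hβ
      (by linarith [hs'.1])).symm
  · exact integral_regionalSymbol_of_ne_half hs0 hs1 hs hβ hβ'

end RegionalSymbolValue

/-! ### Mellin transform of the Neumann correction -/

section Correction

theorem integral_cpow_mul_one_add_rpow {s : ℝ} {a : ℂ} (ha : -1 < a.re) (ha' : a.re < 2 * s) :
    IntegrableOn (fun r : ℝ => (r : ℂ) ^ a * ((1 + r) ^ (-(1 + 2 * s)) : ℝ)) (Ioi 0) ∧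
    ∫ r in Ioi (0 : ℝ), (r : ℂ) ^ a * ((1 + r) ^ (-(1 + 2 * s)) : ℝ) =
      Complex.Gamma (a + 1) * Complex.Gamma (2 * s - a) / Complex.Gamma (1 + 2 * s) := by
  have h1 : 0 < (a + 1).re := by simp; linarith
  have h2 : 0 < (2 * s - a).re := by simp; linarith
  have hc : EqOn (fun r : ℝ => (r : ℂ) ^ (a + 1 - 1) * ((1 + r : ℝ) : ℂ) ^ (-((a + 1) + (2 * s - a))))
      (fun r : ℝ => (r : ℂ) ^ a * ((1 + r) ^ (-(1 + 2 * s)) : ℝ)) (Ioi 0) := by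
    intro r hr
    have hr : 0 < r := hr
    simp only [add_sub_cancel_right]
    rw [Complex.ofReal_cpow (by linarith)]
    push_cast
    ring_nf
  refine ⟨(integrableOn_betaPrime h1 h2).congr_fun hc measurableSet_Ioi, ?_⟩
  rw [← setIntegral_congr_fun measurableSet_Ioi hc, integral_betaPrime,
    Complex.betaIntegral_eq_Gamma_mul_div _ _ h1 h2]
  ring_nf

theorem integral_cpow_mul_add_rpow {s z : ℝ} (hz : 0 < z) {a : ℂ} (ha : -1 < a.re)
    (ha' : a.re < 2 * s) :
    IntegrableOn (fun r : ℝ => (r : ℂ) ^ a * ((r + z) ^ (-(1 + 2 * s)) : ℝ)) (Ioi 0) ∧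
    ∫ r in Ioi (0 : ℝ), (r : ℂ) ^ a * ((r + z) ^ (-(1 + 2 * s)) : ℝ) =
      (z : ℂ) ^ (a - 2 * s) *
        (Complex.Gamma (a + 1) * Complex.Gamma (2 * s - a) / Complex.Gamma (1 + 2 * s)) := by
  obtain ⟨h1, h2⟩ := integral_cpow_mul_one_add_rpow ha ha'
  have hz' : (z : ℂ) ≠ 0 := by exact_mod_cast hz.ne'
  have hc : EqOn (fun r : ℝ => ((z * r : ℝ) : ℂ) ^ a * ((z * r + z) ^ (-(1 + 2 * s)) : ℝ))
      (fun r : ℝ => (z : ℂ) ^ (a - 2 * s - 1) * ((r : ℂ) ^ a * ((1 + r) ^ (-(1 + 2 * s)) : ℝ)))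
      (Ioi 0) := by
    intro r hr
    have hr : 0 < r := hr
    simp only
    rw [show z * r + z = z * (1 + r) by ring, Real.mul_rpow hz.le (by linarith), Complex.ofReal_mul,
      Complex.mul_cpow_ofReal_nonneg hz.le hr.le, show (a - 2 * s - 1 : ℂ) = a + -(1 + 2 * s) by ring,
      Complex.cpow_add _ _ hz', Complex.ofReal_mul, Complex.ofReal_cpow hz.le]
    push_cast
    ring
  constructor
  · rw [← mul_zero z, ← integrableOn_Ioi_comp_mul_left_iff _ _ hz]
    exact (IntegrableOn.congr_fun (h1.const_mul _) (fun r hr => (hc hr).symm) measurableSet_Ioi)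
  · have := integral_comp_mul_left_Ioi
      (fun r : ℝ => (r : ℂ) ^ a * ((r + z) ^ (-(1 + 2 * s)) : ℝ)) 0 hz
    rw [mul_zero, setIntegral_congr_fun measurableSet_Ioi hc, integral_const_mul, h2,
      eq_inv_smul_iff₀ hz.ne', Complex.real_smul] at this
    rw [← this, Complex.cpow_sub _ _ hz', Complex.cpow_one]
    field_simp

/-- The integrand of the Neumann correction, as a function of `r` and the eliminated variable `z`. -/
noncomputable def correctionIntegrand (s r z : ℝ) : ℝ :=
  z ^ (2 * s) / (|1 + z| ^ (1 + 2 * s) * |r + z| ^ (1 + 2 * s))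

theorem measurable_correctionIntegrand (s : ℝ) :
    Measurable fun p : ℝ × ℝ => correctionIntegrand s p.1 p.2 := by
  unfold correctionIntegrand
  fun_prop

theorem correctionIntegrand_eq {s r z : ℝ} (hr : 0 < r) (hz : 0 < z) :
    correctionIntegrand s r z =
      z ^ (2 * s) * (1 + z) ^ (-(1 + 2 * s)) * (r + z) ^ (-(1 + 2 * s)) := by
  unfold correctionIntegrand
  rw [abs_of_pos (by linarith), abs_of_pos (by linarith), Real.rpow_neg (by linarith),
    Real.rpow_neg (by linarith), div_eq_mul_inv, mul_inv, mul_assoc]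

theorem correctionIntegrand_nonneg {s r z : ℝ} (hz : 0 < z) :
    0 ≤ correctionIntegrand s r z := by
  unfold correctionIntegrand
  positivity

theorem neumannCorrection_one (s r : ℝ) : neumannCorrection s 1 r =
    2 * s * fracConst s * ∫ z in Ioi (0 : ℝ), correctionIntegrand s r z := rfl

/-- By scaling, the integral in r produces z^{a-2s}. The weight z^{2s} of the correction cancels the
shift, and the remaining function of z is again a Beta integrand with the same a. -/
theorem integral_cpow_mul_correctionIntegrand_left {s z : ℝ} (hz : 0 < z) {a : ℂ}
    (ha : -1 < a.re) (ha' : a.re < 2 * s) :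
    IntegrableOn (fun r : ℝ => (r : ℂ) ^ a * (correctionIntegrand s r z : ℂ)) (Ioi 0) ∧
    ∫ r in Ioi (0 : ℝ), (r : ℂ) ^ a * (correctionIntegrand s r z : ℂ) =
      (z : ℂ) ^ a * ((1 + z) ^ (-(1 + 2 * s)) : ℝ) *
        (Complex.Gamma (a + 1) * Complex.Gamma (2 * s - a) / Complex.Gamma (1 + 2 * s)) := by
  obtain ⟨h1, h2⟩ := integral_cpow_mul_add_rpow hz ha ha'
  have hz' : (z : ℂ) ≠ 0 := by exact_mod_cast hz.ne'
  have hc : EqOn (fun r : ℝ => (r : ℂ) ^ a * (correctionIntegrand s r z : ℂ))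
      (fun r : ℝ => ((z ^ (2 * s) * (1 + z) ^ (-(1 + 2 * s)) : ℝ) : ℂ) *
        ((r : ℂ) ^ a * ((r + z) ^ (-(1 + 2 * s)) : ℝ))) (Ioi 0) := by
    intro r hr
    simp only
    rw [correctionIntegrand_eq hr hz]
    push_cast; ring
  refine ⟨IntegrableOn.congr_fun (h1.const_mul _) (fun r hr => (hc hr).symm) measurableSet_Ioi, ?_⟩
  rw [setIntegral_congr_fun measurableSet_Ioi hc, integral_const_mul, h2, Complex.cpow_sub _ _ hz']
  rw [Complex.ofReal_mul, Complex.ofReal_cpow hz.le]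
  push_cast
  have : (z : ℂ) ^ (2 * s : ℂ) ≠ 0 := by simp [Complex.cpow_eq_zero_iff, hz']
  field_simp

theorem integrable_cpow_mul_correctionIntegrand {s : ℝ} {a : ℂ} (ha : -1 < a.re)
    (ha' : a.re < 2 * s) :
    Integrable (fun p : ℝ × ℝ => (p.1 : ℂ) ^ a * (correctionIntegrand s p.1 p.2 : ℂ))
      ((volume.restrict (Ioi 0)).prod (volume.restrict (Ioi 0))) := by
  have hm : Measurable (fun p : ℝ × ℝ => (p.1 : ℂ) ^ a * (correctionIntegrand s p.1 p.2 : ℂ)) := by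
    have := measurable_correctionIntegrand s
    fun_prop
  rw [integrable_prod_iff' hm.aestronglyMeasurable]
  constructor
  · refine (ae_restrict_iff' measurableSet_Ioi).2 (Eventually.of_forall fun z hz => ?_)
    exact (integral_cpow_mul_correctionIntegrand_left hz ha ha').1
  -- The integral of the norm is the same integral with a replaced by its real part, so the closed
  -- form just obtained also proves integrability in z.
  · have hre : -1 < (a.re : ℂ).re ∧ (a.re : ℂ).re < 2 * s := ⟨by simpa, by simpa⟩
    have h1 := (integral_cpow_mul_one_add_rpow hre.1 hre.2).1
    refine IntegrableOn.congr_fun (h1.mul_const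
      (Complex.Gamma (a.re + 1) * Complex.Gamma (2 * s - a.re) / Complex.Gamma (1 + 2 * s))).norm
      (fun z hz => ?_) measurableSet_Ioi
    simp only
    rw [← (integral_cpow_mul_correctionIntegrand_left hz hre.1 hre.2).2]
    have hn : 0 ≤ ∫ r in Ioi (0 : ℝ), ‖(r : ℂ) ^ a * (correctionIntegrand s r z : ℂ)‖ :=
      integral_nonneg fun r => norm_nonneg _
    rw [← Real.norm_of_nonneg hn, ← Complex.norm_real, ← integral_complex_ofReal]
    congr 1
    refine setIntegral_congr_fun measurableSet_Ioi fun r hr => ?_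
    have hr : 0 < r := hr
    simp only [norm_mul]
    rw [Complex.norm_cpow_eq_rpow_re_of_pos hr, Complex.norm_real,
      Real.norm_of_nonneg (correctionIntegrand_nonneg hz), Complex.ofReal_mul,
      Complex.ofReal_cpow hr.le]

/-- After Fubini the inner and the outer integral are the same Beta integral, hence the square. -/
theorem integral_cpow_mul_neumannCorrection {s : ℝ} {a : ℂ} (ha : -1 < a.re) (ha' : a.re < 2 * s) :
    IntegrableOn (fun r : ℝ => (r : ℂ) ^ a * (neumannCorrection s 1 r : ℂ)) (Ioi 0) ∧
    ∫ r in Ioi (0 : ℝ), (r : ℂ) ^ a * (neumannCorrection s 1 r : ℂ) = 2 * s * fracConst s *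
      (Complex.Gamma (a + 1) * Complex.Gamma (2 * s - a) / Complex.Gamma (1 + 2 * s)) ^ 2 := by
  have h := integrable_cpow_mul_correctionIntegrand ha ha'
  have e : (fun r : ℝ => (r : ℂ) ^ a * (neumannCorrection s 1 r : ℂ)) = fun r : ℝ =>
      (2 * s * fracConst s : ℂ) *
        ∫ z in Ioi (0 : ℝ), (r : ℂ) ^ a * (correctionIntegrand s r z : ℂ) := by
    ext r
    rw [neumannCorrection_one, integral_const_mul, integral_complex_ofReal]
    push_cast; ring
  rw [e]
  refine ⟨h.integral_prod_left.const_mul _, ?_⟩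
  rw [integral_const_mul, integral_integral_swap h,
    setIntegral_congr_fun measurableSet_Ioi
      (fun z hz => (integral_cpow_mul_correctionIntegrand_left hz ha ha').2),
    integral_mul_const, (integral_cpow_mul_one_add_rpow ha ha').2]
  ring

theorem measurable_neumannCorrection (s : ℝ) : Measurable (neumannCorrection s 1) := by
  have h : StronglyMeasurable fun r : ℝ => ∫ z in Ioi (0 : ℝ), correctionIntegrand s r z :=
    StronglyMeasurable.integral_prod_right (f := fun r z => correctionIntegrand s r z)
      (measurable_correctionIntegrand s).stronglyMeasurable
  have : neumannCorrection s 1 = fun r => 2 * s * fracConst s *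
      ∫ z in Ioi (0 : ℝ), correctionIntegrand s r z := funext fun r => neumannCorrection_one s r
  rw [this]
  exact h.measurable.const_mul _

theorem fracConst_pos {s : ℝ} (hs0 : 0 < s) (hs1 : s < 1) : 0 < fracConst s := by
  unfold fracConst
  have := Real.Gamma_pos_of_pos (show 0 < s + 1 / 2 by linarith)
  have := Real.Gamma_pos_of_pos (show 0 < 1 - s by linarith)
  have := Real.pi_pos
  positivity

theorem neumannCorrection_nonneg {s : ℝ} (hs0 : 0 < s) (hs1 : s < 1) (r : ℝ) :
    0 ≤ neumannCorrection s 1 r := by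
  rw [neumannCorrection_one]
  have := fracConst_pos hs0 hs1
  have : 0 ≤ ∫ z in Ioi (0 : ℝ), correctionIntegrand s r z :=
    setIntegral_nonneg measurableSet_Ioi fun z hz => correctionIntegrand_nonneg hz
  positivity

/-- Interpolation: the exponent 1+2s of r+z is split into θ, charged to r, and 1+2s-θ, charged to z.
The remaining z-integral converges exactly in the stated range of θ. -/
theorem exists_neumannCorrection_le {s : ℝ} (hs0 : 0 < s) (hs1 : s < 1) {θ : ℝ} (hθ : 0 < θ)
    (hθ1 : θ < 1 + 2 * s) :
    ∃ C, 0 ≤ C ∧ ∀ r, 0 < r → neumannCorrection s 1 r ≤ C * r ^ (-θ) := by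
  have hc := fracConst_pos hs0 hs1
  have hi := integrableOn_betaPrime_real (p := θ) (q := 1 + 2 * s - θ) hθ (by linarith)
  refine ⟨2 * s * fracConst s * ∫ z in Ioi (0 : ℝ), z ^ (θ - 1) * (1 + z) ^ (-(θ + (1 + 2 * s - θ))),
    mul_nonneg (by positivity) (setIntegral_nonneg measurableSet_Ioi fun z hz => ?_), fun r hr => ?_⟩
  · have hz : 0 < z := hz
    positivity
  rw [neumannCorrection_one, mul_assoc _ (∫ z in Ioi (0 : ℝ), _), ← integral_mul_const]
  refine mul_le_mul_of_nonneg_left ?_ (by positivity)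
  refine integral_mono_of_nonneg ?_ (hi.mul_const _) ?_
  · exact (ae_restrict_iff' measurableSet_Ioi).2
      (Eventually.of_forall fun z hz => correctionIntegrand_nonneg hz)
  · refine (ae_restrict_iff' measurableSet_Ioi).2 (Eventually.of_forall fun z hz => ?_)
    have hz : 0 < z := hz
    simp only
    rw [correctionIntegrand_eq hr hz]
    have h1 : (r + z) ^ (-(1 + 2 * s)) ≤ r ^ (-θ) * z ^ (θ - (1 + 2 * s)) := by
      rw [show -(1 + 2 * s) = -θ + (θ - (1 + 2 * s)) by ring, Real.rpow_add (by linarith)]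
      exact mul_le_mul (Real.rpow_le_rpow_of_nonpos hr (by linarith) (by linarith))
        (Real.rpow_le_rpow_of_nonpos hz (by linarith) (by linarith)) (by positivity) (by positivity)
    calc _ ≤ z ^ (2 * s) * (1 + z) ^ (-(1 + 2 * s)) * (r ^ (-θ) * z ^ (θ - (1 + 2 * s))) := by
          gcongr
      _ = (z ^ (2 * s) * z ^ (θ - (1 + 2 * s))) * (1 + z) ^ (-(1 + 2 * s)) * r ^ (-θ) := by ring
      _ = _ := by
          rw [← Real.rpow_add hz]; ring_nf

end Correction

/-! ### Homogeneity and bounds of the kernel -/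

section Kernel

theorem neumannCorrection_symm (s x y : ℝ) : neumannCorrection s x y = neumannCorrection s y x := by
  unfold neumannCorrection
  congr 2
  ext z
  rw [mul_comm (|x + z| ^ _)]

theorem neumannKernel_symm (s x y : ℝ) : neumannKernel s x y = neumannKernel s y x := by
  unfold neumannKernel
  rw [neumannCorrection_symm, abs_sub_comm]

theorem neumannCorrection_mul {s x : ℝ} (hx : 0 < x) {y w : ℝ} (hy : 0 < y) (hw : 0 < w) :
    neumannCorrection s (x * y) (x * w) = x ^ (-(1 + 2 * s)) * neumannCorrection s y w := by
  unfold neumannCorrection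
  have h := integral_comp_mul_left_Ioi (fun z : ℝ =>
    z ^ (2 * s) / (|x * y + z| ^ (1 + 2 * s) * |x * w + z| ^ (1 + 2 * s))) 0 hx
  rw [mul_zero, eq_inv_smul_iff₀ hx.ne', smul_eq_mul] at h
  rw [← h, ← integral_const_mul, ← integral_const_mul, ← integral_const_mul, ← integral_const_mul]
  refine setIntegral_congr_fun measurableSet_Ioi fun z hz => ?_
  have hz : 0 < z := hz
  have e : ∀ y : ℝ, 0 < y → |x * y + x * z| ^ (1 + 2 * s) = x ^ (1 + 2 * s) * |y + z| ^ (1 + 2 * s) := by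
    intro y hy
    rw [← mul_add, abs_mul, abs_of_pos hx, Real.mul_rpow hx.le (abs_nonneg _)]
  rw [e y hy, e w hw, Real.mul_rpow hx.le hz.le, Real.rpow_neg hx.le]
  have e3 : x ^ (1 + 2 * s) = x * x ^ (2 * s) := by rw [Real.rpow_add hx, Real.rpow_one]
  rw [e3]
  have : |y + z| ^ (1 + 2 * s) ≠ 0 := by positivity
  have : |w + z| ^ (1 + 2 * s) ≠ 0 := by positivity
  have : x ^ (2 * s) ≠ 0 := by positivity
  field_simp

theorem neumannKernel_mul {s x : ℝ} (hx : 0 < x) {y w : ℝ} (hy : 0 < y) (hw : 0 < w) :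
    neumannKernel s (x * y) (x * w) = x ^ (-(1 + 2 * s)) * neumannKernel s y w := by
  unfold neumannKernel
  rw [neumannCorrection_mul hx hy hw, ← mul_sub, abs_mul, abs_of_pos hx,
    Real.mul_rpow hx.le (abs_nonneg _), Real.rpow_neg hx.le, mul_add, div_mul_eq_div_div_swap]
  ring

/-- Homogeneity combined with symmetry; this relation between the halves r < 1 and r > 1 is what
permits folding. -/
theorem neumannKernel_one_inv {s r : ℝ} (hr : 0 < r) :
    neumannKernel s 1 r⁻¹ = r ^ (1 + 2 * s) * neumannKernel s 1 r := by
  have h := neumannKernel_mul (s := s) (inv_pos.2 hr) one_pos hr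
  rw [mul_one, inv_mul_cancel₀ hr.ne', Real.inv_rpow hr.le, Real.rpow_neg hr.le, inv_inv] at h
  rw [neumannKernel_symm, h]

theorem neumannCorrection_one_inv {s r : ℝ} (hr : 0 < r) :
    neumannCorrection s 1 r⁻¹ = r ^ (1 + 2 * s) * neumannCorrection s 1 r := by
  have h := neumannCorrection_mul (s := s) (inv_pos.2 hr) one_pos hr
  rw [mul_one, inv_mul_cancel₀ hr.ne', Real.inv_rpow hr.le, Real.rpow_neg hr.le, inv_inv] at h
  rw [neumannCorrection_symm, h]

theorem measurable_neumannKernel (s : ℝ) : Measurable (neumannKernel s 1) := by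
  have := measurable_neumannCorrection s
  unfold neumannKernel
  fun_prop

theorem neumannKernel_nonneg {s : ℝ} (hs0 : 0 < s) (hs1 : s < 1) (r : ℝ) :
    0 ≤ neumannKernel s 1 r := by
  have := fracConst_pos hs0 hs1
  have := neumannCorrection_nonneg hs0 hs1 r
  unfold neumannKernel
  positivity

theorem neumannKernel_one_eq {s r : ℝ} (hr : r ∈ Ioo (0 : ℝ) 1) :
    neumannKernel s 1 r = fracConst s * (1 - r) ^ (-1 - 2 * s) + neumannCorrection s 1 r := by
  unfold neumannKernel
  have h : 0 < 1 - r := by linarith [hr.2]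
  rw [abs_of_pos h, show -1 - 2 * s = -(1 + 2 * s) by ring, Real.rpow_neg h.le, div_eq_mul_inv]

/-- A bound for the kernel on `(0, 1)`, with an arbitrarily weak singularity at `0`. -/
theorem exists_neumannKernel_le {s : ℝ} (hs0 : 0 < s) (hs1 : s < 1) {θ : ℝ} (hθ : 0 < θ)
    (hθ1 : θ < 1 + 2 * s) :
    ∃ C, 0 ≤ C ∧ ∀ r ∈ Ioo (0 : ℝ) 1,
      neumannKernel s 1 r ≤ C * (r ^ (-θ) * (1 - r) ^ (-1 - 2 * s)) := by
  obtain ⟨C, hC, h⟩ := exists_neumannCorrection_le hs0 hs1 hθ hθ1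
  have hc := fracConst_pos hs0 hs1
  refine ⟨fracConst s + C, by positivity, fun r hr => ?_⟩
  rw [neumannKernel_one_eq hr]
  have h1r : 0 < 1 - r := by linarith [hr.2]
  have h1 : 1 ≤ r ^ (-θ) := Real.one_le_rpow_of_pos_of_le_one_of_nonpos hr.1 hr.2.le (by linarith)
  have h2 : 1 ≤ (1 - r) ^ (-1 - 2 * s) :=
    Real.one_le_rpow_of_pos_of_le_one_of_nonpos h1r (by linarith [hr.1]) (by linarith)
  have h3 := h r hr.1
  have h4 : fracConst s * (1 - r) ^ (-1 - 2 * s) ≤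
      fracConst s * (r ^ (-θ) * (1 - r) ^ (-1 - 2 * s)) := by
    refine mul_le_mul_of_nonneg_left ?_ hc.le
    nlinarith
  have h5 : C * r ^ (-θ) ≤ C * (r ^ (-θ) * (1 - r) ^ (-1 - 2 * s)) := by
    refine mul_le_mul_of_nonneg_left ?_ hC
    nlinarith
  linarith

end Kernel

/-! ### Folding the half-line onto (0,1) -/

section Folding

variable {s : ℝ} {k : ℝ → ℝ}

/-- The Jacobian r⁻² and the kernel factor r^{1+2s} combine to r^{2s-1}. -/
theorem fold_integrand (hk : ∀ r, 0 < r → k r⁻¹ = r ^ (1 + 2 * s) * k r) (h : ℝ → ℂ) {r : ℝ}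
    (hr : 0 < r) :
    (r ^ 2)⁻¹ • (h r⁻¹ * (k r⁻¹ : ℂ)) = ((r ^ (2 * s - 1) : ℝ) : ℂ) * h r⁻¹ * (k r : ℂ) := by
  have e : r ^ (1 + 2 * s) = r ^ 2 * r ^ (2 * s - 1) := by
    rw [← Real.rpow_natCast, ← Real.rpow_add hr]; congr 1; push_cast; ring
  have hr2 : (r : ℂ) ≠ 0 := by exact_mod_cast hr.ne'
  rw [hk r hr, e, Complex.real_smul]
  push_cast
  generalize h r⁻¹ = H
  field_simp

theorem integrableOn_fold_iff (hk : ∀ r, 0 < r → k r⁻¹ = r ^ (1 + 2 * s) * k r) (h : ℝ → ℂ)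
    {c : ℝ} (hc : 0 < c) :
    IntegrableOn (fun r => h r * (k r : ℂ)) (Ioi c⁻¹) ↔
    IntegrableOn (fun r => ((r ^ (2 * s - 1) : ℝ) : ℂ) * h r⁻¹ * (k r : ℂ)) (Ioo 0 c) := by
  rw [integrableOn_Ioi_inv_iff hc]
  exact integrableOn_congr_fun (fun r hr => fold_integrand hk h hr.1) measurableSet_Ioo

theorem integral_fold (hk : ∀ r, 0 < r → k r⁻¹ = r ^ (1 + 2 * s) * k r) (h : ℝ → ℂ)
    {c : ℝ} (hc : 0 < c) :
    ∫ r in Ioi c⁻¹, h r * (k r : ℂ) =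
      ∫ r in Ioo 0 c, ((r ^ (2 * s - 1) : ℝ) : ℂ) * h r⁻¹ * (k r : ℂ) := by
  rw [integral_Ioi_inv hc]
  exact setIntegral_congr_fun measurableSet_Ioo (fun r hr => fold_integrand hk h hr.1)

theorem integral_Ioi_eq_folded (hk : ∀ r, 0 < r → k r⁻¹ = r ^ (1 + 2 * s) * k r) (h : ℝ → ℂ)
    (hi : IntegrableOn (fun r => h r * (k r : ℂ)) (Ioi 0)) :
    IntegrableOn (fun r => (h r + ((r ^ (2 * s - 1) : ℝ) : ℂ) * h r⁻¹) * (k r : ℂ)) (Ioo 0 1) ∧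
    ∫ r in Ioi (0 : ℝ), h r * (k r : ℂ) =
      ∫ r in Ioo (0 : ℝ) 1, (h r + ((r ^ (2 * s - 1) : ℝ) : ℂ) * h r⁻¹) * (k r : ℂ) := by
  have i1 : IntegrableOn (fun r => h r * (k r : ℂ)) (Ioo 0 1) := hi.mono_set Ioo_subset_Ioi_self
  have i2 : IntegrableOn (fun r => h r * (k r : ℂ)) (Ioi 1⁻¹) :=
    hi.mono_set (Ioi_subset_Ioi (by norm_num))
  have i3 := (integrableOn_fold_iff hk h one_pos).1 i2
  have e : ∀ r, (h r + ((r ^ (2 * s - 1) : ℝ) : ℂ) * h r⁻¹) * (k r : ℂ) =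
      h r * (k r : ℂ) + ((r ^ (2 * s - 1) : ℝ) : ℂ) * h r⁻¹ * (k r : ℂ) := fun r => by ring
  simp_rw [e]
  refine ⟨i1.fun_add i3, ?_⟩
  rw [integral_add i1 i3, ← integral_fold hk h one_pos, inv_one,
    ← Ioc_union_Ioi_eq_Ioi (zero_le_one' ℝ), setIntegral_union Ioc_disjoint_Ioi_same measurableSet_Ioi
      (hi.mono_set Ioc_subset_Ioi_self) (hi.mono_set (Ioi_subset_Ioi zero_le_one)),
    integral_Ioc_eq_integral_Ioo]

end Folding

/-! ### The Mellin multiplier and its relation to f -/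

section Multiplier

/-- The Mellin multiplier of the regional Neumann operator, in closed form. -/
noncomputable def mellinMultiplier (s : ℝ) (β : ℂ) : ℂ :=
  fracConst s * (Complex.Gamma (1 + β) * Complex.Gamma (2 * s - β) / Complex.Gamma (1 + 2 * s)) *
    (Complex.sin (Real.pi * (s - β)) / Complex.sin (Real.pi * s) -
      Complex.Gamma (2 * s - β) * Complex.Gamma (1 + β) / Complex.Gamma (2 * s))

/-- The right-hand side is the fold of 1 - r^{2s-1-β}. The factorization shows a double zero at r =
1, strong enough to replace the principal value by an absolutely convergent integral. -/
theorem one_sub_cpow_mul_eq {s r : ℝ} (hr : 0 < r) (β : ℂ) :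
    (1 - (r : ℂ) ^ (2 * s - 1 - β)) * (1 - (r : ℂ) ^ β) = (1 - (r : ℂ) ^ (2 * s - 1 - β)) +
      ((r ^ (2 * s - 1) : ℝ) : ℂ) * (1 - ((r⁻¹ : ℝ) : ℂ) ^ (2 * s - 1 - β)) := by
  have hr0 : (r : ℂ) ≠ 0 := by exact_mod_cast hr.ne'
  have e1 : ((r⁻¹ : ℝ) : ℂ) ^ (2 * s - 1 - β) = ((r : ℂ) ^ (2 * s - 1 - β))⁻¹ := by
    rw [Complex.ofReal_inv, Complex.inv_cpow]
    rw [Complex.arg_ofReal_of_nonneg hr.le]; exact Real.pi_pos.ne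
  have e2 : ((r ^ (2 * s - 1) : ℝ) : ℂ) = (r : ℂ) ^ (2 * s - 1 - β) * (r : ℂ) ^ β := by
    rw [← Complex.cpow_add _ _ hr0, Complex.ofReal_cpow hr.le]; push_cast; ring_nf
  have h0 : (r : ℂ) ^ (2 * s - 1 - β) ≠ 0 := by simp [Complex.cpow_eq_zero_iff, hr0]
  rw [e1, e2]
  field_simp
  ring

/-- The correction has no singularity at r = 1, so the fold can be undone and the moments with
exponents 0 and 2s-1-β taken separately. The substitution a = 2s-1-β only interchanges the two Gamma
factors. -/
theorem integral_correction_symbol {s : ℝ} (hs0 : 0 < s) {β : ℂ} (hβ : -1 < β.re)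
    (hβ' : β.re < 2 * s) :
    IntegrableOn (fun r : ℝ => (1 - (r : ℂ) ^ (2 * s - 1 - β)) * (1 - (r : ℂ) ^ β) *
      (neumannCorrection s 1 r : ℂ)) (Ioo 0 1) ∧
    ∫ r in Ioo (0 : ℝ) 1, (1 - (r : ℂ) ^ (2 * s - 1 - β)) * (1 - (r : ℂ) ^ β) *
      (neumannCorrection s 1 r : ℂ) = fracConst s * (1 / (2 * s) - 2 * s *
        (Complex.Gamma (1 + β) * Complex.Gamma (2 * s - β) / Complex.Gamma (1 + 2 * s)) ^ 2) := by
  obtain ⟨i0, e0⟩ := integral_cpow_mul_neumannCorrection (s := s) (a := 0) (by simp) (by simpa)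
  obtain ⟨ia, ea⟩ := integral_cpow_mul_neumannCorrection (s := s) (a := 2 * s - 1 - β)
    (by simp; linarith) (by simp; linarith)
  have e : ∀ r : ℝ, (1 - (r : ℂ) ^ (2 * s - 1 - β)) * (neumannCorrection s 1 r : ℂ) =
      (r : ℂ) ^ (0 : ℂ) * (neumannCorrection s 1 r : ℂ) -
        (r : ℂ) ^ (2 * s - 1 - β) * (neumannCorrection s 1 r : ℂ) := by
    intro r; rw [Complex.cpow_zero]; ring
  have hi : IntegrableOn (fun r : ℝ => (1 - (r : ℂ) ^ (2 * s - 1 - β)) *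
      (neumannCorrection s 1 r : ℂ)) (Ioi 0) := by
    simp_rw [e]; exact i0.sub ia
  obtain ⟨h1, h2⟩ := integral_Ioi_eq_folded (s := s) (fun r hr => neumannCorrection_one_inv hr)
    (fun r : ℝ => 1 - (r : ℂ) ^ (2 * s - 1 - β)) hi
  have hc : EqOn (fun r : ℝ => (1 - (r : ℂ) ^ (2 * s - 1 - β) +
      ((r ^ (2 * s - 1) : ℝ) : ℂ) * (1 - ((r⁻¹ : ℝ) : ℂ) ^ (2 * s - 1 - β))) *
        (neumannCorrection s 1 r : ℂ)) (fun r : ℝ => (1 - (r : ℂ) ^ (2 * s - 1 - β)) *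
          (1 - (r : ℂ) ^ β) * (neumannCorrection s 1 r : ℂ)) (Ioo 0 1) := fun r hr => by
    simp only [one_sub_cpow_mul_eq hr.1]
  refine ⟨h1.congr_fun hc measurableSet_Ioo, ?_⟩
  rw [← setIntegral_congr_fun measurableSet_Ioo hc, ← h2]
  simp_rw [e]
  rw [integral_sub i0 ia, e0, ea, Gamma_one_add_two_mul hs0, zero_add, sub_zero, Complex.Gamma_one,
    show (2 * s - 1 - β + 1 : ℂ) = 2 * s - β by ring,
    show (2 * s - (2 * s - 1 - β) : ℂ) = 1 + β by ring]
  have hG : Complex.Gamma (2 * s) ≠ 0 := Complex.Gamma_ne_zero_of_re_pos (by simpa)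
  have hs : (s : ℂ) ≠ 0 := by exact_mod_cast hs0.ne'
  generalize Complex.Gamma (1 + β) = X
  generalize Complex.Gamma (2 * s - β) = Y
  generalize Complex.Gamma (2 * s) = A at *
  field_simp

/-- The constant 1/(2s) from the correction cancels the -1/(2s) of the singular part. The result
vanishes at β = 0, in accordance with L annihilating constants. -/
theorem integral_neumannKernel_symbol {s : ℝ} (hs0 : 0 < s) (hs1 : s < 1) {β : ℂ}
    (hβ : -1 < β.re) (hβ' : β.re < 2 * s) :
    ∫ r in Ioo (0 : ℝ) 1, (1 - (r : ℂ) ^ (2 * s - 1 - β)) * (1 - (r : ℂ) ^ β) *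
      (neumannKernel s 1 r : ℂ) = mellinMultiplier s β := by
  obtain ⟨i1, e1⟩ := integral_correction_symbol hs0 hβ hβ'
  have i2 := integrableOn_regionalSymbol (a := 2 * s - 1 - β) (b := β) (q := -1 - 2 * s)
    (by simp; linarith) hβ (by simp; linarith) (by linarith)
  have hc : EqOn (fun r : ℝ => (1 - (r : ℂ) ^ (2 * s - 1 - β)) * (1 - (r : ℂ) ^ β) *
      (neumannKernel s 1 r : ℂ)) (fun r : ℝ => fracConst s *
      ((1 - (r : ℂ) ^ (2 * s - 1 - β)) * (1 - (r : ℂ) ^ β) * ((1 - r) ^ (-1 - 2 * s) : ℝ)) +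
      (1 - (r : ℂ) ^ (2 * s - 1 - β)) * (1 - (r : ℂ) ^ β) * (neumannCorrection s 1 r : ℂ))
      (Ioo 0 1) := fun r hr => by
    simp only [neumannKernel_one_eq hr]
    push_cast
    ring
  rw [setIntegral_congr_fun measurableSet_Ioo hc, integral_add (i2.const_mul _) i1, e1,
    integral_const_mul, integral_regionalSymbol hs0 hs1 hβ hβ', regionalSymbolValue,
    mellinMultiplier, Gamma_one_add_two_mul hs0]
  have hG : Complex.Gamma (2 * s) ≠ 0 := Complex.Gamma_ne_zero_of_re_pos (by simpa)
  have hs : (s : ℂ) ≠ 0 := by exact_mod_cast hs0.ne'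
  have hsin := sin_pi_mul_ofReal_ne_zero hs0 hs1
  generalize Complex.sin (Real.pi * s) = B at *
  generalize Complex.Gamma (1 + β) = X
  generalize Complex.Gamma (2 * s - β) = Y
  generalize Complex.Gamma (2 * s) = A at *
  field_simp
  ring

theorem sin_eq_pi_div_Gamma_mul {z : ℂ} (hz : Complex.sin (Real.pi * z) ≠ 0) :
    Complex.Gamma (1 - z) * Complex.sin (Real.pi * z) ≠ 0 ∧
    (Complex.Gamma (1 - z) * Complex.sin (Real.pi * z))⁻¹ = Complex.Gamma z / Real.pi := by
  have hpi : (Real.pi : ℂ) ≠ 0 := by exact_mod_cast Real.pi_ne_zero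
  have h := Complex.Gamma_mul_Gamma_one_sub z
  rw [eq_div_iff hz] at h
  have hne : Complex.Gamma (1 - z) * Complex.sin (Real.pi * z) ≠ 0 := by
    intro h0
    rw [mul_assoc, h0, mul_zero] at h
    exact hpi h.symm
  refine ⟨hne, ?_⟩
  rw [inv_eq_iff_eq_inv, inv_div, eq_div_iff]
  · linear_combination h
  · intro h0
    rw [h0] at h
    simp at h
    exact hpi (by simpa using h.symm)

/-- Away from the removable singularities, the symbol `f` is a constant multiple of the multiplier. -/
theorem neumannSymbol_eq {s : ℝ} (hs0 : 0 < s) (hs1 : s < 1) {β : ℂ}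
    (hβ : Complex.sin (Real.pi * (β - 2 * s)) ≠ 0) :
    neumannSymbol s β =
      (Complex.sin (Real.pi * s) * Complex.Gamma (1 + 2 * s) / (Real.pi * fracConst s)) *
        mellinMultiplier s β := by
  have hpi : (Real.pi : ℂ) ≠ 0 := by exact_mod_cast Real.pi_ne_zero
  have hc : (fracConst s : ℂ) ≠ 0 := by exact_mod_cast (fracConst_pos hs0 hs1).ne'
  have h2 : Complex.sin (Real.pi * (2 * s - β)) = -Complex.sin (Real.pi * (β - 2 * s)) := by
    rw [← Complex.sin_neg]; ring_nf
  obtain ⟨h3, h4⟩ := sin_eq_pi_div_Gamma_mul (z := 2 * s - β) (by rw [h2]; exact neg_ne_zero.2 hβ)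
  rw [h2, show (1 - (2 * s - β) : ℂ) = β - 2 * s + 1 by ring] at h3 h4
  have h5 : Complex.sin (Real.pi * (β - s)) = -Complex.sin (Real.pi * (s - β)) := by
    rw [← Complex.sin_neg]; ring_nf
  rw [neumannSymbol, mellinMultiplier, h5, div_eq_mul_inv (_ * _) (_ * _),
    show (Complex.Gamma (β - 2 * s + 1) * Complex.sin (Real.pi * (β - 2 * s)))⁻¹ =
      -(Complex.Gamma (2 * s - β) / Real.pi) by
        rw [← h4, mul_neg, inv_neg, neg_neg], add_comm β 1]
  have hG1 := Gamma_one_add_two_mul_ne_zero hs0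
  generalize Complex.Gamma (1 + 2 * s) = A at *
  generalize Complex.Gamma (2 * s - β) = Y
  generalize Complex.Gamma (2 * s) = D
  generalize Complex.sin (Real.pi * (s - β)) = E
  field_simp
  ring

end Multiplier

/-! ### The principal value as an absolutely convergent integral -/

section Operator

/-- The difference `φ(x) - φ(xr)`, folded by `r ↦ 1 / r` onto `r < 1`. -/
noncomputable def foldedDifference (s : ℝ) (φ : ℝ → ℂ) (x r : ℝ) : ℂ :=
  φ x - φ (x * r) + ((r ^ (2 * s - 1) : ℝ) : ℂ) * (φ x - φ (x * r⁻¹))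

theorem integrableOn_mul_neumannKernel {s : ℝ} (hs0 : 0 < s) (hs1 : s < 1) {κ B : ℝ}
    (hκ : κ < 1) {g : ℝ → ℂ} (hg : Measurable g)
    (hb : ∀ r ∈ Ioo (0 : ℝ) 1, ‖g r‖ ≤ B * (r ^ (-κ) * (1 - r) ^ 2)) :
    IntegrableOn (fun r => g r * (neumannKernel s 1 r : ℂ)) (Ioo 0 1) := by
  obtain ⟨θ, hθ, hθ1, hκθ⟩ : ∃ θ : ℝ, 0 < θ ∧ θ ≤ 1 ∧ κ + θ < 1 :=
    ⟨min 1 ((1 - κ) / 2), lt_min one_pos (by linarith), min_le_left _ _, by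
      linarith [min_le_right 1 ((1 - κ) / 2)]⟩
  obtain ⟨C, hC, hK⟩ := exists_neumannKernel_le hs0 hs1 (θ := θ) hθ (by linarith)
  have hi := (integrableOn_betaIntegrand_real (p := 1 - (κ + θ)) (q := 2 - 2 * s) (by linarith)
    (by linarith)).const_mul (B * C)
  refine Integrable.mono' hi ?_ ?_
  · have := measurable_neumannKernel s
    exact Measurable.aestronglyMeasurable (by fun_prop)
  · refine (ae_restrict_iff' measurableSet_Ioo).2 (Eventually.of_forall fun r hr => ?_)
    have h1r : 0 < 1 - r := by linarith [hr.2]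
    have hr0 := hr.1
    rw [norm_mul, Complex.norm_real, Real.norm_of_nonneg (neumannKernel_nonneg hs0 hs1 r)]
    refine (mul_le_mul (hb r hr) (hK r hr) (neumannKernel_nonneg hs0 hs1 r)
      ((norm_nonneg _).trans (hb r hr))).trans (le_of_eq ?_)
    have e1 : r ^ (1 - (κ + θ) - 1) = r ^ (-κ) * r ^ (-θ) := by
      rw [← Real.rpow_add hr0]; ring_nf
    have e2 : (1 - r) ^ (2 - 2 * s - 1) = (1 - r) ^ 2 * (1 - r) ^ (-1 - 2 * s) := by
      rw [← Real.rpow_two, ← Real.rpow_add h1r]; ring_nf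
    rw [e1, e2]
    ring

/-- Away from r = 1 no cancellation is needed. This serves the two unfolded pieces of the excised
integral, which are not integrable up to 1 in general. -/
theorem integrableOn_mul_neumannKernel_of_lt {s : ℝ} (hs0 : 0 < s) (hs1 : s < 1) {κ B c : ℝ}
    (hc : c < 1) (hκ : κ < 1) (hB : 0 ≤ B) {g : ℝ → ℂ} (hg : Measurable g)
    (hb : ∀ r ∈ Ioo (0 : ℝ) 1, ‖g r‖ ≤ B * r ^ (-κ)) :
    IntegrableOn (fun r => g r * (neumannKernel s 1 r : ℂ)) (Ioo 0 c) := by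
  have hm : Measurable ((Ioo 0 c).indicator g) := hg.indicator measurableSet_Ioo
  have h := integrableOn_mul_neumannKernel hs0 hs1 (B := B * ((1 - c) ^ 2)⁻¹) hκ hm (by
    intro r hr
    have hr0 := hr.1
    have h1c : 0 < 1 - c := by linarith
    by_cases hrc : r ∈ Ioo 0 c
    · rw [indicator_of_mem hrc]
      refine (hb r hr).trans ?_
      have h1 : 1 ≤ ((1 - c) ^ 2)⁻¹ * (1 - r) ^ 2 := by
        rw [← div_eq_inv_mul, one_le_div (by positivity)]
        have := hrc.2
        gcongr
      have h2 : 0 ≤ B * r ^ (-κ) := by positivity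
      nlinarith
    · rw [indicator_of_notMem hrc, norm_zero]; positivity)
  refine (h.mono_set (Ioo_subset_Ioo le_rfl hc.le)).congr_fun (fun r hr => ?_) measurableSet_Ioo
  simp only [indicator_of_mem hr]

/-- The first-order Taylor terms at xr and at x/r leave d·x(1-r)(1-r^{2s-2}), which is already of
second order in 1-r. In the constant 9, one unit comes from the remainder at xr and 8 = 2·2² from
the remainder at x/r with its weight. -/
theorem norm_foldedDifference_le_near {s : ℝ} (hs0 : 0 < s) (hs1 : s < 1) {φ : ℝ → ℂ} {x C : ℝ}
    {d : ℂ} (hx : 0 < x) (hC : 0 ≤ C)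
    (hφ : ∀ y, 0 < y → ‖φ y - φ x - d * ((y - x : ℝ) : ℂ)‖ ≤ C * (y - x) ^ 2)
    {r : ℝ} (hr : r ∈ Ico (1 / 2 : ℝ) 1) :
    ‖foldedDifference s φ x r‖ ≤ (8 * (‖d‖ * x) + 9 * (C * x ^ 2)) * (1 - r) ^ 2 := by
  obtain ⟨hr2, hr1⟩ := hr
  have hr0 : 0 < r := by linarith
  have h1r : 0 < 1 - r := by linarith
  have a1 := hφ (x * r) (by positivity)
  have a2 := hφ (x * r⁻¹) (by positivity)
  have hinv : r⁻¹ ≤ 2 := by rw [inv_le_comm₀ hr0 two_pos]; linarith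
  have e2 : ((r ^ (2 * s - 2) : ℝ) : ℂ) * (r : ℂ) = ((r ^ (2 * s - 1) : ℝ) : ℂ) := by
    rw [← Complex.ofReal_mul, ← Real.rpow_add_one hr0.ne']; ring_nf
  have hr0' : (r : ℂ) ≠ 0 := by exact_mod_cast hr0.ne'
  have key : foldedDifference s φ x r = d * x * ((1 - r : ℝ) : ℂ) * (1 - ((r ^ (2 * s - 2) : ℝ) : ℂ))
      - (φ (x * r) - φ x - d * ((x * r - x : ℝ) : ℂ))
      - ((r ^ (2 * s - 1) : ℝ) : ℂ) * (φ (x * r⁻¹) - φ x - d * ((x * r⁻¹ - x : ℝ) : ℂ)) := by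
    rw [foldedDifference, ← e2]
    push_cast
    field_simp
    ring
  have b1 : ‖(1 - ((r ^ (2 * s - 2) : ℝ) : ℂ))‖ ≤ 8 * (1 - r) := by
    rw [← Complex.ofReal_one, ← Complex.ofReal_sub, Complex.norm_real, Real.norm_eq_abs, abs_sub_comm,
      abs_of_nonneg]
    · have : r ^ (2 * s - 2) ≤ r ^ (-2 : ℝ) :=
        Real.rpow_le_rpow_of_exponent_ge hr0 hr1.le (by linarith)
      rw [Real.rpow_neg hr0.le, Real.rpow_two, ← inv_pow] at this
      have h5 : 1 = r⁻¹ * r := by field_simp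
      nlinarith [mul_nonneg h1r.le (sub_nonneg.2 hinv)]
    · linarith [Real.one_le_rpow_of_pos_of_le_one_of_nonpos hr0 hr1.le (show 2 * s - 2 ≤ 0 by linarith)]
  have b2 : r ^ (2 * s - 1) * (x * r⁻¹ - x) ^ 2 ≤ 8 * (x ^ 2 * (1 - r) ^ 2) := by
    have h1 : r ^ (2 * s - 1) ≤ r ^ (-1 : ℝ) :=
      Real.rpow_le_rpow_of_exponent_ge hr0 hr1.le (by linarith)
    rw [Real.rpow_neg_one] at h1
    have h2 : r ^ (2 * s - 1) ≤ 2 := h1.trans hinv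
    have h3 : (x * r⁻¹ - x) ^ 2 = (r⁻¹) ^ 2 * (x ^ 2 * (1 - r) ^ 2) := by field_simp
    have h4 : (r⁻¹) ^ 2 ≤ 2 ^ 2 := by gcongr
    rw [h3, ← mul_assoc]
    have : r ^ (2 * s - 1) * (r⁻¹) ^ 2 ≤ 2 * 2 ^ 2 := by gcongr
    nlinarith [mul_nonneg (sq_nonneg x) (sq_nonneg (1 - r))]
  rw [key]
  refine (norm_sub_le _ _).trans ((add_le_add ((norm_sub_le _ _).trans (add_le_add le_rfl a1)) le_rfl).trans ?_)
  simp only [norm_mul, Complex.norm_real, Real.norm_of_nonneg hx.le, Real.norm_of_nonneg h1r.le]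
  rw [Real.norm_of_nonneg (Real.rpow_nonneg hr0.le _)]
  have c1 : ‖d‖ * x * (1 - r) * ‖(1 - ((r ^ (2 * s - 2) : ℝ) : ℂ))‖ ≤ ‖d‖ * x * (1 - r) * (8 * (1 - r)) := by
    gcongr
  have c2 : r ^ (2 * s - 1) * ‖φ (x * r⁻¹) - φ x - d * ((x * r⁻¹ - x : ℝ) : ℂ)‖ ≤
      r ^ (2 * s - 1) * (C * (x * r⁻¹ - x) ^ 2) := by gcongr
  have c3 : C * (r ^ (2 * s - 1) * (x * r⁻¹ - x) ^ 2) ≤ C * (8 * (x ^ 2 * (1 - r) ^ 2)) := by gcongr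
  have c4 : C * (x * r - x) ^ 2 = C * (x ^ 2 * (1 - r) ^ 2) := by ring
  nlinarith

theorem one_add_rpow_le {s r κ : ℝ} (hκ : 0 ≤ κ) (hκ' : 1 - 2 * s ≤ κ) (hr : r ∈ Ioo (0 : ℝ) 1) :
    1 ≤ r ^ (-κ) ∧ r ^ (2 * s - 1) ≤ r ^ (-κ) :=
  ⟨Real.one_le_rpow_of_pos_of_le_one_of_nonpos hr.1 hr.2.le (by linarith),
    Real.rpow_le_rpow_of_exponent_ge hr.1 hr.2.le (by linarith)⟩

theorem norm_foldedDifference_le {s : ℝ} (hs0 : 0 < s) (hs1 : s < 1) {φ : ℝ → ℂ} {x C M κ : ℝ}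
    {d : ℂ} (hx : 0 < x) (hC : 0 ≤ C) (hM : 0 ≤ M) (hκ : 0 ≤ κ) (hκ' : 1 - 2 * s ≤ κ)
    (hφ : ∀ y, 0 < y → ‖φ y - φ x - d * ((y - x : ℝ) : ℂ)‖ ≤ C * (y - x) ^ 2)
    (hbd : ∀ y, 0 < y → ‖φ y‖ ≤ M) {r : ℝ} (hr : r ∈ Ioo (0 : ℝ) 1) :
    ‖foldedDifference s φ x r‖ ≤
      (8 * (‖d‖ * x) + 9 * (C * x ^ 2) + 16 * M) * (r ^ (-κ) * (1 - r) ^ 2) := by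
  have hr0 := hr.1
  have h1r : 0 < 1 - r := by linarith [hr.2]
  obtain ⟨k1, k2⟩ := one_add_rpow_le hκ hκ' hr
  have hD : 0 ≤ 8 * (‖d‖ * x) + 9 * (C * x ^ 2) := by positivity
  rcases lt_or_ge r (1 / 2) with h | h
  · have h1 : ‖foldedDifference s φ x r‖ ≤ 4 * M * r ^ (-κ) := by
      unfold foldedDifference
      refine (norm_add_le _ _).trans ?_
      rw [norm_mul, Complex.norm_real, Real.norm_of_nonneg (Real.rpow_nonneg hr0.le _)]
      have n1 : ‖φ x - φ (x * r)‖ ≤ 2 * M := by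
        refine (norm_sub_le _ _).trans ?_
        linarith [hbd x hx, hbd (x * r) (by positivity)]
      have n2 : ‖φ x - φ (x * r⁻¹)‖ ≤ 2 * M := by
        refine (norm_sub_le _ _).trans ?_
        linarith [hbd x hx, hbd (x * r⁻¹) (by positivity)]
      have n3 : r ^ (2 * s - 1) * ‖φ x - φ (x * r⁻¹)‖ ≤ r ^ (-κ) * (2 * M) := by gcongr
      nlinarith
    have h2 : (1 / 4 : ℝ) ≤ (1 - r) ^ 2 := by nlinarith
    have h3 : 0 ≤ M * r ^ (-κ) := by positivity
    have h4 : 0 ≤ (8 * (‖d‖ * x) + 9 * (C * x ^ 2)) * (r ^ (-κ) * (1 - r) ^ 2) := by positivity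
    nlinarith
  · refine (norm_foldedDifference_le_near hs0 hs1 hx hC hφ ⟨h, hr.2⟩).trans ?_
    have h5 : (1 - r) ^ 2 ≤ r ^ (-κ) * (1 - r) ^ 2 := by nlinarith [sq_nonneg (1 - r)]
    have h6 : 0 ≤ 16 * M * (r ^ (-κ) * (1 - r) ^ 2) := by positivity
    nlinarith

theorem measurable_foldedDifference (s : ℝ) {φ : ℝ → ℂ} (hφ : Measurable φ) :
    Measurable fun p : ℝ × ℝ => foldedDifference s φ p.1 p.2 := by
  unfold foldedDifference
  fun_prop

theorem Ioi_diff_ball (x δ : ℝ) :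
    Ioi (0 : ℝ) \ Metric.ball x δ = Ioc 0 (x - δ) ∪ (Ioi 0 ∩ Ici (x + δ)) := by
  ext y
  simp only [Set.mem_sdiff, mem_Ioi, Metric.mem_ball, Real.dist_eq, not_lt, mem_union, mem_Ioc, mem_inter_iff,
    mem_Ici, le_abs]
  constructor
  · rintro ⟨h1, h2 | h2⟩
    · right; exact ⟨h1, by linarith⟩
    · left; exact ⟨h1, by linarith⟩
  · rintro (⟨h1, h2⟩ | ⟨h1, h2⟩)
    · exact ⟨h1, Or.inr (by linarith)⟩
    · exact ⟨h1, Or.inl (by linarith)⟩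

theorem integral_diff_ball_rescale {s x δ : ℝ} (hx : 0 < x) (φ : ℝ → ℂ) :
    ∫ y in Ioi (0 : ℝ) \ Metric.ball x δ, (φ x - φ y) * (neumannKernel s x y : ℂ) =
      ((x ^ (-(2 * s)) : ℝ) : ℂ) * ∫ r in Ioi (0 : ℝ) \ Metric.ball 1 (δ / x),
        (φ x - φ (x * r)) * (neumannKernel s 1 r : ℂ) := by
  have hmb : ∀ a b : ℝ, MeasurableSet (Metric.ball a b)ᶜ := fun a b => measurableSet_ball.compl
  rw [sdiff_eq, sdiff_eq, ← setIntegral_indicator (hmb _ _), ← setIntegral_indicator (hmb _ _)]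
  have h := integral_comp_mul_left_Ioi ((Metric.ball x δ)ᶜ.indicator
    fun y => (φ x - φ y) * (neumannKernel s x y : ℂ)) 0 hx
  rw [mul_zero, eq_inv_smul_iff₀ hx.ne', Complex.real_smul] at h
  rw [← h, ← integral_const_mul, ← integral_const_mul]
  refine setIntegral_congr_fun measurableSet_Ioi fun r hr => ?_
  have hr : 0 < r := hr
  have hmem : x * r ∈ (Metric.ball x δ)ᶜ ↔ r ∈ (Metric.ball 1 (δ / x))ᶜ := by
    simp only [mem_compl_iff, Metric.mem_ball, Real.dist_eq, not_lt]
    rw [show x * r - x = x * (r - 1) by ring, abs_mul, abs_of_pos hx, div_le_iff₀' hx]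
  by_cases hm : r ∈ (Metric.ball 1 (δ / x))ᶜ
  · simp only [indicator_of_mem hm, indicator_of_mem (hmem.2 hm)]
    have hk := neumannKernel_mul (s := s) hx one_pos hr
    rw [mul_one] at hk
    rw [hk, show -(2 * s) = 1 + -(1 + 2 * s) by ring, Real.rpow_add hx, Real.rpow_one]
    push_cast
    ring
  · simp only [indicator_of_notMem hm, indicator_of_notMem (fun h => hm (hmem.1 h)), mul_zero]

/-- After scaling, the excised set is |r-1| < η, which is not invariant under r ↦ 1/r. Its fold
leaves an extra interval [1-η, 1/(1+η)) of length at most η². There the difference is O(η) and the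
kernel O(η^{-1-2s}), so the error is O(η^{2-2s}) and disappears because s < 1. -/
theorem neumannOp_eq {s : ℝ} (hs0 : 0 < s) (hs1 : s < 1) {φ : ℝ → ℂ} {x C M : ℝ}
    {d : ℂ} (hx : 0 < x) (hC : 0 ≤ C) (hM : 0 ≤ M) (hm : Measurable φ)
    (hφ : ∀ y, 0 < y → ‖φ y - φ x - d * ((y - x : ℝ) : ℂ)‖ ≤ C * (y - x) ^ 2)
    (hbd : ∀ y, 0 < y → ‖φ y‖ ≤ M) :
    neumannOp s φ x = ((x ^ (-(2 * s)) : ℝ) : ℂ) *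
      ∫ r in Ioo (0 : ℝ) 1, foldedDifference s φ x r * (neumannKernel s 1 r : ℂ) := by
  obtain ⟨κ, hκ, hκ', hκs⟩ : ∃ κ : ℝ, 0 ≤ κ ∧ 1 - 2 * s ≤ κ ∧ κ < 1 :=
    ⟨max 0 (1 - 2 * s), le_max_left _ _, le_max_right _ _, by
      rcases max_choice 0 (1 - 2 * s) with h | h <;> rw [h] <;> linarith⟩
  have hmf : Measurable (foldedDifference s φ x) := by unfold foldedDifference; fun_prop
  have hint := integrableOn_mul_neumannKernel hs0 hs1 hκs hmf
    (fun r hr => norm_foldedDifference_le hs0 hs1 hx hC hM hκ hκ' hφ hbd hr)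
  set h : ℝ → ℂ := fun r => φ x - φ (x * r) with hh
  have hmh : Measurable h := by simp only [hh]; fun_prop
  have hb0 : ∀ r, 0 < r → ‖h r‖ ≤ 2 * M := fun r hr => by
    refine (norm_sub_le _ _).trans ?_
    linarith [hbd x hx, hbd (x * r) (by positivity)]
  have hi1 : ∀ c < 1, IntegrableOn (fun r => h r * (neumannKernel s 1 r : ℂ)) (Ioo 0 c) :=
    fun c hc => integrableOn_mul_neumannKernel_of_lt hs0 hs1 hc hκs (B := 2 * M) (by linarith) hmh
      (fun r hr => (hb0 r hr.1).trans (by nlinarith [(one_add_rpow_le hκ hκ' hr).1]))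
  have hi2 : ∀ c < 1, IntegrableOn (fun r => ((r ^ (2 * s - 1) : ℝ) : ℂ) * h r⁻¹ *
      (neumannKernel s 1 r : ℂ)) (Ioo 0 c) :=
    fun c hc => integrableOn_mul_neumannKernel_of_lt hs0 hs1 hc hκs (B := 2 * M) (by linarith)
      (by fun_prop) (fun r hr => by
        have hr0 := hr.1
        rw [norm_mul, Complex.norm_real, Real.norm_of_nonneg (Real.rpow_nonneg hr0.le _), mul_comm (2 * M)]
        exact mul_le_mul (one_add_rpow_le hκ hκ' hr).2 (hb0 _ (inv_pos.2 hr0)) (norm_nonneg _)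
          (by positivity))
  obtain ⟨CK, hCK, hK⟩ := exists_neumannKernel_le hs0 hs1 (θ := s / 2) (by linarith) (by linarith)
  -- the error made by excising an interval that is not symmetric under `r ↦ 1 / r`
  have herr : ∀ η ∈ Ioo (0 : ℝ) (1 / 2), ‖∫ r in Ico (1 - η) (1 + η)⁻¹, ((r ^ (2 * s - 1) : ℝ) : ℂ) * h r⁻¹ *
      (neumannKernel s 1 r : ℂ)‖ ≤ (2 * ((‖d‖ * x + C * x ^ 2) * 2) * (CK * 4 * 8)) * η ^ (2 - 2 * s) := by
    intro η hη
    have hη0 := hη.1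
    have hη1 := hη.2
    have hcle : 1 - η ≤ (1 + η)⁻¹ := by
      rw [← div_le_one (by positivity), div_inv_eq_mul]; nlinarith
    have hlen : (1 + η)⁻¹ - (1 - η) ≤ η ^ 2 := by
      have : (1 + η)⁻¹ - (1 - η) = η ^ 2 * (1 + η)⁻¹ := by field_simp; ring
      rw [this]
      have : (1 + η)⁻¹ ≤ 1 := inv_le_one_of_one_le₀ (by linarith)
      nlinarith [sq_nonneg η]
    have hbound : ∀ r ∈ Ico (1 - η) (1 + η)⁻¹, ‖((r ^ (2 * s - 1) : ℝ) : ℂ) * h r⁻¹ *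
        (neumannKernel s 1 r : ℂ)‖ ≤ (2 * ((‖d‖ * x + C * x ^ 2) * 2) * (CK * 4 * 8)) * η ^ (-(2 * s)) := by
      intro r hr
      have hr2 : 1 / 2 < r := by linarith [hr.1]
      have hr0 : 0 < r := by linarith
      have h1η : 1 - (1 + η)⁻¹ = η * (1 + η)⁻¹ := by field_simp; ring
      have hηi : 1 / 2 ≤ (1 + η)⁻¹ := by
        rw [one_div, inv_le_inv₀ (by norm_num) (by linarith)]; linarith
      have h1r : η / 2 ≤ 1 - r := by nlinarith [hr.2]
      have h1r' : 1 - r ≤ η := by linarith [hr.1]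
      have h1r0 : 0 < 1 - r := by linarith
      have hinv : r⁻¹ ≤ 2 := by rw [inv_le_comm₀ hr0 two_pos]; linarith
      have hinv1 : r⁻¹ - 1 = r⁻¹ * (1 - r) := by field_simp
      have hinv2 : r⁻¹ - 1 ≤ 2 * (1 - r) := by rw [hinv1]; gcongr
      have hinv3 : 0 ≤ r⁻¹ - 1 := by rw [hinv1]; positivity
      have n1 : r ^ (2 * s - 1) ≤ 2 := by
        have h1 : r ^ (2 * s - 1) ≤ r ^ (-1 : ℝ) :=
          Real.rpow_le_rpow_of_exponent_ge hr0 (by linarith) (by linarith)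
        rw [Real.rpow_neg_one] at h1
        exact h1.trans hinv
      have n2 : ‖h r⁻¹‖ ≤ (‖d‖ * x + C * x ^ 2) * 2 * (1 - r) := by
        have := hφ (x * r⁻¹) (by positivity)
        have e : h r⁻¹ = -(φ (x * r⁻¹) - φ x - d * ((x * r⁻¹ - x : ℝ) : ℂ)) - d * ((x * r⁻¹ - x : ℝ) : ℂ) := by
          simp only [hh]; ring
        rw [e]
        refine (norm_sub_le _ _).trans ?_
        rw [norm_neg, norm_mul, Complex.norm_real, show x * r⁻¹ - x = x * (r⁻¹ - 1) by ring,
          Real.norm_of_nonneg (by positivity)]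
        rw [show x * r⁻¹ - x = x * (r⁻¹ - 1) by ring] at this
        have q1 : (x * (r⁻¹ - 1)) ^ 2 ≤ x ^ 2 * (2 * (1 - r)) := by
          rw [mul_pow]
          have : (r⁻¹ - 1) ^ 2 ≤ 2 * (1 - r) := by nlinarith
          gcongr
        have q2 : ‖d‖ * (x * (r⁻¹ - 1)) ≤ ‖d‖ * (x * (2 * (1 - r))) := by gcongr
        have q3 := mul_le_mul_of_nonneg_left q1 hC
        nlinarith
      have n3 : neumannKernel s 1 r ≤ CK * (4 * ((1 - r) ^ (-1 - 2 * s))) := by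
        refine (hK r ⟨hr0, by linarith⟩).trans ?_
        have : r ^ (-(s / 2)) ≤ 4 := by
          have h1 : r ^ (-(s / 2)) ≤ r ^ (-1 : ℝ) :=
            Real.rpow_le_rpow_of_exponent_ge hr0 (by linarith) (by linarith)
          rw [Real.rpow_neg_one] at h1
          linarith
        gcongr
      have n4 : (1 - r) * (1 - r) ^ (-1 - 2 * s) ≤ 8 * η ^ (-(2 * s)) := by
        have : (1 - r) * (1 - r) ^ (-1 - 2 * s) = (1 - r) ^ (-(2 * s)) := by
          rw [← Real.rpow_one_add' h1r0.le (by linarith)]; ring_nf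
        rw [this]
        refine (Real.rpow_le_rpow_of_nonpos (by positivity) h1r (by linarith)).trans ?_
        rw [Real.div_rpow hη0.le (by norm_num), div_eq_mul_inv, ← Real.rpow_neg (by norm_num), neg_neg,
          mul_comm]
        gcongr
        calc (2 : ℝ) ^ (2 * s) ≤ 2 ^ (3 : ℝ) :=
              Real.rpow_le_rpow_of_exponent_le (by norm_num) (by linarith)
          _ = 8 := by norm_num
      rw [norm_mul, norm_mul, Complex.norm_real, Complex.norm_real,
        Real.norm_of_nonneg (Real.rpow_nonneg hr0.le _), Real.norm_of_nonneg (neumannKernel_nonneg hs0 hs1 r)]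
      have hK0 := neumannKernel_nonneg hs0 hs1 r
      calc _ ≤ 2 * ((‖d‖ * x + C * x ^ 2) * 2 * (1 - r)) * (CK * (4 * ((1 - r) ^ (-1 - 2 * s)))) := by
            gcongr
        _ = 2 * ((‖d‖ * x + C * x ^ 2) * 2) * (CK * 4) * ((1 - r) * (1 - r) ^ (-1 - 2 * s)) := by ring
        _ ≤ 2 * ((‖d‖ * x + C * x ^ 2) * 2) * (CK * 4) * (8 * η ^ (-(2 * s))) := by gcongr
        _ = _ := by ring
    have := norm_setIntegral_le_of_norm_le_const (μ := volume) (s := Ico (1 - η) (1 + η)⁻¹)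
      (by simp) hbound
    refine this.trans ?_
    rw [Measure.real, Real.volume_Ico, ENNReal.toReal_ofReal (by linarith)]
    have e : η ^ (2 - 2 * s) = η ^ (-(2 * s)) * η ^ 2 := by
      rw [← Real.rpow_two, ← Real.rpow_add hη0]; ring_nf
    rw [e, ← mul_assoc _ (η ^ (-(2 * s))) (η ^ 2)]
    exact mul_le_mul_of_nonneg_left hlen (by positivity)
  -- the excised integral in folded form
  have hsplit : ∀ η ∈ Ioo (0 : ℝ) (1 / 2), ∫ r in Ioi (0 : ℝ) \ Metric.ball 1 η,
      h r * (neumannKernel s 1 r : ℂ) =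
      (∫ r in Ioo 0 (1 - η), foldedDifference s φ x r * (neumannKernel s 1 r : ℂ)) +
      ∫ r in Ico (1 - η) (1 + η)⁻¹, ((r ^ (2 * s - 1) : ℝ) : ℂ) * h r⁻¹ * (neumannKernel s 1 r : ℂ) := by
    intro η hη
    have hη0 := hη.1
    have hη1 := hη.2
    have hcle : 1 - η ≤ (1 + η)⁻¹ := by
      rw [← div_le_one (by positivity), div_inv_eq_mul]; nlinarith
    have hc1 : (1 + η)⁻¹ < 1 := inv_lt_one_of_one_lt₀ (by linarith)
    have hc0 : 0 < (1 + η)⁻¹ := by positivity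
    have hI : Ioi (0 : ℝ) ∩ Ici (1 + η) = Ici (1 + η) :=
      inter_eq_self_of_subset_right (fun y hy => by
        have : 1 + η ≤ y := hy
        exact lt_of_lt_of_le (by linarith) this)
    have i3 : IntegrableOn (fun r => h r * (neumannKernel s 1 r : ℂ)) (Ioi (1 + η)) := by
      have := (integrableOn_fold_iff (s := s) (fun r hr => neumannKernel_one_inv hr) h hc0).2 (hi2 _ hc1)
      rwa [inv_inv] at this
    rw [Ioi_diff_ball 1 η, hI, setIntegral_union (by
        rw [disjoint_left]; intro y hy hy'
        have : 1 + η ≤ y := hy'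
        linarith [hy.2]) measurableSet_Ici
      ((integrableOn_Ioc_iff_integrableOn_Ioo).2 (hi1 _ (by linarith)))
      ((integrableOn_Ici_iff_integrableOn_Ioi).2 i3), integral_Ioc_eq_integral_Ioo,
      integral_Ici_eq_integral_Ioi]
    have hf := integral_fold (s := s) (fun r hr => neumannKernel_one_inv hr) h hc0
    rw [inv_inv] at hf
    have i4 := (hi2 _ hc1).mono_set (Ioo_subset_Ioo_right hcle)
    have i5 : IntegrableOn (fun r => ((r ^ (2 * s - 1) : ℝ) : ℂ) * h r⁻¹ *
      (neumannKernel s 1 r : ℂ)) (Ico (1 - η) (1 + η)⁻¹) :=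
      (hi2 _ hc1).mono_set (fun y hy => ⟨by linarith [hy.1], hy.2⟩)
    rw [hf, ← Ioo_union_Ico_eq_Ioo (show (0 : ℝ) < 1 - η by linarith) hcle, setIntegral_union (by
        rw [disjoint_left]; intro y hy hy'
        linarith [hy.2, hy'.1]) measurableSet_Ico i4 i5, ← add_assoc,
      ← integral_add (hi1 _ (by linarith)) i4]
    congr 1
    refine integral_congr_ae (Eventually.of_forall fun r => ?_)
    simp only [foldedDifference, hh]
    ring
  have hlim1 : Tendsto (fun η : ℝ => ∫ r in Ioo 0 (1 - η), foldedDifference s φ x r *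
      (neumannKernel s 1 r : ℂ)) (𝓝[>] 0)
      (𝓝 (∫ r in Ioo 0 1, foldedDifference s φ x r * (neumannKernel s 1 r : ℂ))) := by
    have hcov : AECover (volume.restrict (Ioo (0 : ℝ) 1)) (𝓝[>] (0 : ℝ)) fun η : ℝ => Ioo 0 (1 - η) := by
      refine aecover_Ioo_of_Ioo tendsto_const_nhds ?_
      have : Tendsto (fun η : ℝ => 1 - η) (𝓝[>] 0) (𝓝 (1 - 0)) :=
        ((continuous_const.sub continuous_id).tendsto (0 : ℝ)).mono_left nhdsWithin_le_nhds
      simpa using this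
    have := hcov.integral_tendsto_of_countably_generated hint
    refine this.congr' ?_
    filter_upwards [self_mem_nhdsWithin] with η hη
    have hη : 0 < η := hη
    rw [Measure.restrict_restrict measurableSet_Ioo, inter_eq_self_of_subset_left
      (Ioo_subset_Ioo_right (by linarith))]
  have hlim2 : Tendsto (fun η : ℝ => ∫ r in Ico (1 - η) (1 + η)⁻¹, ((r ^ (2 * s - 1) : ℝ) : ℂ) * h r⁻¹ *
      (neumannKernel s 1 r : ℂ)) (𝓝[>] 0) (𝓝 0) := by
    refine squeeze_zero_norm' (a := fun η =>
      (2 * ((‖d‖ * x + C * x ^ 2) * 2) * (CK * 4 * 8)) * η ^ (2 - 2 * s)) ?_ ?_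
    · filter_upwards [Ioo_mem_nhdsGT (show (0 : ℝ) < 1 / 2 by norm_num)] with η hη using herr η hη
    · have : Continuous fun η : ℝ => (2 * ((‖d‖ * x + C * x ^ 2) * 2) * (CK * 4 * 8)) * η ^ (2 - 2 * s) :=
        continuous_const.mul (Real.continuous_rpow_const (by linarith))
      have := (this.tendsto 0).mono_left (nhdsWithin_le_nhds (s := Ioi 0))
      simpa [Real.zero_rpow (show 2 - 2 * s ≠ 0 by linarith)] using this
  have hdiv : Tendsto (fun δ : ℝ => δ / x) (𝓝[>] 0) (𝓝[>] 0) := by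
    refine tendsto_nhdsWithin_iff.2 ⟨?_, ?_⟩
    · have := ((continuous_id.div_const x).tendsto (0 : ℝ)).mono_left (nhdsWithin_le_nhds (s := Ioi 0))
      simpa using this
    · filter_upwards [self_mem_nhdsWithin] with δ hδ using div_pos hδ hx
  refine Tendsto.limUnder_eq ?_
  have htot := ((hlim1.add hlim2).comp hdiv).const_mul ((x ^ (-(2 * s)) : ℝ) : ℂ)
  rw [add_zero] at htot
  refine htot.congr' ?_
  filter_upwards [hdiv (Ioo_mem_nhdsGT (show (0 : ℝ) < 1 / 2 by norm_num))] with δ hδ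
  rw [integral_diff_ball_rescale hx, hsplit _ hδ]
  rfl

end Operator

/-! ### The test function and its dilates -/

section TestFunction

/-- At the junction x = 1 the derivative exists because the function is continuous and the
derivative elsewhere extends continuously. -/
theorem hasDerivAt_posPart_pow (n : ℕ) (x : ℝ) :
    HasDerivAt (fun y : ℝ => max (1 - y) 0 ^ (n + 2)) (-(n + 2) * max (1 - x) 0 ^ (n + 1)) x := by
  have hcont : ∀ k : ℕ, Continuous fun y : ℝ => max (1 - y) 0 ^ k := fun k => by fun_prop
  have hne : ∀ y : ℝ, y ≠ 1 →
      HasDerivAt (fun y : ℝ => max (1 - y) 0 ^ (n + 2)) (-(n + 2) * max (1 - y) 0 ^ (n + 1)) y := by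
    intro y hy
    rcases lt_or_gt_of_ne hy with h | h
    · have h1 : HasDerivAt (fun y : ℝ => (1 - y) ^ (n + 2)) (-(n + 2) * (1 - y) ^ (n + 1)) y := by
        have := ((hasDerivAt_id y).const_sub 1).pow (n + 2)
        refine this.congr_deriv ?_
        simp
        ring
      rw [max_eq_left (by linarith)]
      refine h1.congr_of_eventuallyEq ?_
      filter_upwards [Iio_mem_nhds h] with z hz
      have hz : z < 1 := hz
      rw [max_eq_left (by linarith)]
    · rw [max_eq_right (by linarith), zero_pow (by omega), mul_zero]
      refine (hasDerivAt_const y (0 : ℝ)).congr_of_eventuallyEq ?_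
      filter_upwards [Ioi_mem_nhds h] with z hz
      have hz : 1 < z := hz
      rw [max_eq_right (by linarith), zero_pow (by omega)]
  by_cases hx : x = 1
  · subst hx
    exact hasDerivAt_of_hasDerivAt_of_ne (g := fun x => -(n + 2) * max (1 - x) 0 ^ (n + 1)) hne
      (hcont _).continuousAt (continuous_const.mul (hcont _)).continuousAt
  · exact hne x hx

/-- The test function `x ^ 4 * (1 - x)₊ ^ 3`, whose Mellin transform is the reciprocal of a
polynomial. -/
noncomputable def bump (x : ℝ) : ℝ := x ^ 4 * max (1 - x) 0 ^ 3

/-- The first derivative of `bump`. -/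
noncomputable def bumpDeriv (x : ℝ) : ℝ := 4 * x ^ 3 * max (1 - x) 0 ^ 3 - 3 * x ^ 4 * max (1 - x) 0 ^ 2

/-- The second derivative of `bump`. -/
noncomputable def bumpDeriv₂ (x : ℝ) : ℝ :=
  12 * x ^ 2 * max (1 - x) 0 ^ 3 - 24 * x ^ 3 * max (1 - x) 0 ^ 2 + 6 * x ^ 4 * max (1 - x) 0

theorem hasDerivAt_bump (x : ℝ) : HasDerivAt bump (bumpDeriv x) x := by
  refine ((hasDerivAt_pow 4 x).mul (hasDerivAt_posPart_pow 1 x)).congr_deriv ?_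
  rw [bumpDeriv]; push_cast; ring

theorem hasDerivAt_bumpDeriv (x : ℝ) : HasDerivAt bumpDeriv (bumpDeriv₂ x) x := by
  have h1 := ((hasDerivAt_pow 3 x).const_mul 4).mul (hasDerivAt_posPart_pow 1 x)
  have h2 := ((hasDerivAt_pow 4 x).const_mul 3).mul (hasDerivAt_posPart_pow 0 x)
  refine (h1.sub h2).congr_deriv ?_
  rw [bumpDeriv₂]; push_cast; ring

theorem continuous_bumpDeriv₂ : Continuous bumpDeriv₂ := by unfold bumpDeriv₂; fun_prop

theorem continuous_bump : Continuous bump := by unfold bump; fun_prop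

/-- 42 = 12 + 24 + 6 is the sum of the coefficients of the second derivative; the other two
functions have smaller sums. -/
theorem abs_bump_le {x : ℝ} (hx : 0 < x) :
    |bump x| ≤ 42 * x ^ 2 ∧ |bumpDeriv x| ≤ 42 * x ^ 2 ∧ |bumpDeriv₂ x| ≤ 42 * x ^ 2 := by
  rcases le_total x 1 with h | h
  · have hm : max (1 - x) 0 = 1 - x := max_eq_left (by linarith)
    have h0 : 0 ≤ 1 - x := by linarith
    have h1 : 1 - x ≤ 1 := by linarith
    have p : ∀ i j : ℕ, 0 ≤ x ^ (2 + i) * (1 - x) ^ j ∧ x ^ (2 + i) * (1 - x) ^ j ≤ x ^ 2 := by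
      intro i j
      refine ⟨by positivity, ?_⟩
      calc _ ≤ x ^ (2 + i) * 1 := by
            gcongr; exact pow_le_one₀ h0 h1
        _ ≤ x ^ 2 := by rw [mul_one]; exact pow_le_pow_of_le_one hx.le h (by omega)
    have p1 := p 2 3
    have p2 := p 1 3
    have p3 := p 2 2
    have p4 := p 0 3
    have p5 := p 1 2
    have p6 := p 2 1
    norm_num at p1 p2 p3 p4 p5 p6
    rw [bump, bumpDeriv, bumpDeriv₂, hm]
    refine ⟨abs_le.2 ⟨?_, ?_⟩, abs_le.2 ⟨?_, ?_⟩, abs_le.2 ⟨?_, ?_⟩⟩ <;> linarith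
  · have hm : max (1 - x) 0 = 0 := max_eq_right (by linarith)
    rw [bump, bumpDeriv, bumpDeriv₂, hm]
    norm_num
    positivity

theorem bump_eq_zero {x : ℝ} (hx : 1 ≤ x) : bump x = 0 ∧ bumpDeriv x = 0 ∧ bumpDeriv₂ x = 0 := by
  have hm : max (1 - x) 0 = 0 := max_eq_right (by linarith)
  rw [bump, bumpDeriv, bumpDeriv₂, hm]
  norm_num

theorem abs_bump_le_const {x : ℝ} (hx : 0 < x) :
    |bump x| ≤ 42 ∧ |bumpDeriv x| ≤ 42 ∧ |bumpDeriv₂ x| ≤ 42 := by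
  rcases le_total x 1 with h | h
  · obtain ⟨h1, h2, h3⟩ := abs_bump_le hx
    have : 42 * x ^ 2 ≤ 42 := by nlinarith
    exact ⟨h1.trans this, h2.trans this, h3.trans this⟩
  · obtain ⟨h1, h2, h3⟩ := bump_eq_zero h
    rw [h1, h2, h3]; norm_num

theorem abs_bump_taylor {x y : ℝ} (hx : 0 < x) (hy : 0 < y) :
    |bump y - bump x - bumpDeriv x * (y - x)| ≤ 42 * (y - x) ^ 2 := by
  have hpos : ∀ z ∈ uIcc x y, 0 < z := fun z hz => lt_of_lt_of_le (lt_min hx hy) hz.1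
  have h1 : ∀ z ∈ uIcc x y, ‖bumpDeriv z - bumpDeriv x‖ ≤ 42 * |y - x| := by
    intro z hz
    have := (convex_uIcc x y).norm_image_sub_le_of_norm_hasDerivWithin_le (C := 42)
      (fun w _ => (hasDerivAt_bumpDeriv w).hasDerivWithinAt)
      (fun w hw => (abs_bump_le_const (hpos w hw)).2.2) left_mem_uIcc hz
    refine this.trans ?_
    rw [Real.norm_eq_abs]
    exact mul_le_mul_of_nonneg_left (abs_sub_left_of_mem_uIcc hz) (by norm_num)
  have hd : ∀ z ∈ uIcc x y, HasDerivWithinAt (fun z => bump z - bumpDeriv x * z)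
      (bumpDeriv z - bumpDeriv x) (uIcc x y) z := by
    intro z _
    have := (hasDerivAt_bump z).sub ((hasDerivAt_id z).const_mul (bumpDeriv x))
    exact this.hasDerivWithinAt.congr_deriv (by simp)
  have := (convex_uIcc x y).norm_image_sub_le_of_norm_hasDerivWithin_le hd h1
    left_mem_uIcc right_mem_uIcc
  rw [Real.norm_eq_abs, Real.norm_eq_abs, mul_assoc, abs_mul_abs_self, ← sq] at this
  convert this using 2
  ring

/-- The dilated complex-valued test function. -/
noncomputable def dilatedBump (c x : ℝ) : ℂ := (bump (c * x) : ℂ)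

theorem hasDerivAt_dilatedBump (c x : ℝ) :
    HasDerivAt (dilatedBump c) ((c * bumpDeriv (c * x) : ℝ) : ℂ) x := by
  have h : HasDerivAt (fun y : ℝ => c * y) (c * 1) x := (hasDerivAt_id x).const_mul c
  refine ((hasDerivAt_bump (c * x)).comp x h).ofReal_comp.congr_deriv ?_
  push_cast; ring

theorem hasDerivAt_dilatedBump_deriv (c x : ℝ) :
    HasDerivAt (fun x => ((c * bumpDeriv (c * x) : ℝ) : ℂ)) ((c ^ 2 * bumpDeriv₂ (c * x) : ℝ) : ℂ) x := by
  have h : HasDerivAt (fun y : ℝ => c * y) (c * 1) x := (hasDerivAt_id x).const_mul c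
  refine (((hasDerivAt_bumpDeriv (c * x)).comp x h).const_mul c).ofReal_comp.congr_deriv ?_
  push_cast; ring

theorem continuous_dilatedBump (c : ℝ) : Continuous (dilatedBump c) := by
  have := continuous_bump
  unfold dilatedBump
  fun_prop

theorem iteratedDeriv_dilatedBump (c : ℝ) :
    iteratedDeriv 1 (dilatedBump c) = (fun x => ((c * bumpDeriv (c * x) : ℝ) : ℂ)) ∧
    iteratedDeriv 2 (dilatedBump c) = (fun x => ((c ^ 2 * bumpDeriv₂ (c * x) : ℝ) : ℂ)) := by
  have h1 : iteratedDeriv 1 (dilatedBump c) = (fun x => ((c * bumpDeriv (c * x) : ℝ) : ℂ)) := by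
    rw [iteratedDeriv_one]; exact funext fun x => (hasDerivAt_dilatedBump c x).deriv
  refine ⟨h1, ?_⟩
  rw [iteratedDeriv_succ, h1]
  exact funext fun x => (hasDerivAt_dilatedBump_deriv c x).deriv

theorem contDiff_dilatedBump (c : ℝ) : ContDiff ℝ 2 (dilatedBump c) := by
  have hd : deriv (dilatedBump c) = (fun x => ((c * bumpDeriv (c * x) : ℝ) : ℂ)) :=
    funext fun x => (hasDerivAt_dilatedBump c x).deriv
  rw [show (2 : WithTop ℕ∞) = 1 + 1 by norm_num, contDiff_succ_iff_deriv]
  refine ⟨fun x => (hasDerivAt_dilatedBump c x).differentiableAt, by simp, ?_⟩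
  rw [hd, contDiff_one_iff_deriv]
  refine ⟨fun x => (hasDerivAt_dilatedBump_deriv c x).differentiableAt, ?_⟩
  rw [funext fun x => (hasDerivAt_dilatedBump_deriv c x).deriv]
  have := continuous_bumpDeriv₂
  fun_prop

theorem memWeightedC_dilatedBump {s c : ℝ} (hs0 : 0 < s) (hc : 0 < c) :
    MemWeightedC 2 2 (1 + 2 * s) (dilatedBump c) := by
  refine ⟨(contDiff_dilatedBump c).contDiffOn, ?_⟩
  obtain ⟨e1, e2⟩ := iteratedDeriv_dilatedBump c
  set A := 42 * (1 + c + c ^ 2)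
  -- The summand c² serves the bound by x². The summand c^{-(1+2s)} serves the decay: on the support
  -- cx ≤ 1, hence (cx)^{-(1+2s)} ≥ 1.
  have key : ∀ (D : ℝ → ℝ) (a : ℝ), 0 ≤ a → a ≤ 1 + c + c ^ 2 → (∀ x, 0 < x → |D x| ≤ 42 * x ^ 2) →
      (∀ x, 1 ≤ x → D x = 0) → ∀ x, 0 < x →
      ‖((a * D (c * x) : ℝ) : ℂ)‖ ≤ (A * (c ^ 2 + c ^ (-(1 + 2 * s)))) * x ^ (2 : ℝ) ∧
      ‖((a * D (c * x) : ℝ) : ℂ)‖ ≤ (A * (c ^ 2 + c ^ (-(1 + 2 * s)))) * x ^ (-(1 + 2 * s)) := by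
    intro D a ha hA hD hD0 x hx
    have hcx : 0 < c * x := by positivity
    have hn : ‖((a * D (c * x) : ℝ) : ℂ)‖ ≤ A * (c * x) ^ 2 := by
      rw [Complex.norm_real, norm_mul, Real.norm_of_nonneg ha, Real.norm_eq_abs]
      calc a * |D (c * x)| ≤ (1 + c + c ^ 2) * (42 * (c * x) ^ 2) := by
            gcongr; exact hD _ hcx
        _ = _ := by simp only [A]; ring
    have hcs : 0 < c ^ (-(1 + 2 * s)) := by positivity
    have hA0 : 0 < A := by simp only [A]; positivity
    constructor
    · refine hn.trans ?_
      rw [Real.rpow_two]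
      have : 0 ≤ A * c ^ (-(1 + 2 * s)) * x ^ 2 := by positivity
      nlinarith
    · rcases le_total 1 (c * x) with h | h
      · rw [hD0 _ h]; simp; positivity
      · refine hn.trans ?_
        have h1 : (c * x) ^ 2 ≤ 1 := by nlinarith
        have h2 : 1 ≤ (c * x) ^ (-(1 + 2 * s)) :=
          Real.one_le_rpow_of_pos_of_le_one_of_nonpos hcx h (by linarith)
        rw [Real.mul_rpow hc.le hx.le] at h2
        have h3 : 0 ≤ A * c ^ 2 * x ^ (-(1 + 2 * s)) := by positivity
        nlinarith
  refine ⟨A * (c ^ 2 + c ^ (-(1 + 2 * s))), fun k hk => ?_⟩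
  have h : ∀ x, 0 < x →
      ‖iteratedDeriv k (dilatedBump c) x‖ ≤ (A * (c ^ 2 + c ^ (-(1 + 2 * s)))) * x ^ (2 : ℝ) ∧
      ‖iteratedDeriv k (dilatedBump c) x‖ ≤
        (A * (c ^ 2 + c ^ (-(1 + 2 * s)))) * x ^ (-(1 + 2 * s)) := by
    intro x hx
    have hc2 : 0 < c ^ 2 := by positivity
    interval_cases k
    · have := key bump 1 zero_le_one (by linarith) (fun x hx => (abs_bump_le hx).1)
        (fun x hx => (bump_eq_zero hx).1) x hx
      rw [one_mul] at this
      rw [iteratedDeriv_zero]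
      exact this
    · rw [e1]
      exact key bumpDeriv c hc.le (by linarith) (fun x hx => (abs_bump_le hx).2.1)
        (fun x hx => (bump_eq_zero hx).2.1) x hx
    · rw [e2]
      exact key bumpDeriv₂ (c ^ 2) hc2.le (by linarith) (fun x hx => (abs_bump_le hx).2.2)
        (fun x hx => (bump_eq_zero hx).2.2) x hx
  exact ⟨fun x hx => (h x hx.1).1, fun x hx => (h x (zero_lt_one.trans hx)).2⟩

theorem norm_dilatedBump_taylor {c x y : ℝ} (hc : 0 < c) (hx : 0 < x) (hy : 0 < y) :
    ‖dilatedBump c y - dilatedBump c x - ((c * bumpDeriv (c * x) : ℝ) : ℂ) * ((y - x : ℝ) : ℂ)‖ ≤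
      (42 * c ^ 2) * (y - x) ^ 2 := by
  have := abs_bump_taylor (x := c * x) (y := c * y) (by positivity) (by positivity)
  rw [dilatedBump, dilatedBump, ← Complex.ofReal_sub, ← Complex.ofReal_mul, ← Complex.ofReal_sub,
    Complex.norm_real, Real.norm_eq_abs]
  convert this using 1
  · congr 1; ring
  · ring

theorem norm_dilatedBump_le {c x : ℝ} (hc : 0 < c) (hx : 0 < x) : ‖dilatedBump c x‖ ≤ 42 := by
  rw [dilatedBump, Complex.norm_real]
  exact (abs_bump_le_const (by positivity)).1

end TestFunction

/-! ### Mellin transform of the image of the test function -/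

section MellinOfImage

/-- The integral of the folded difference of `bump` against the kernel. -/
noncomputable def foldedIntegral (s x : ℝ) : ℂ :=
  ∫ r in Ioo (0 : ℝ) 1, foldedDifference s (dilatedBump 1) x r * (neumannKernel s 1 r : ℂ)

/-- Folded differences commute with dilations, so the images of all dilates are described by one
function of cx. -/
theorem neumannOp_dilatedBump {s c x : ℝ} (hs0 : 0 < s) (hs1 : s < 1) (hc : 0 < c) (hx : 0 < x) :
    neumannOp s (dilatedBump c) x = ((x ^ (-(2 * s)) : ℝ) : ℂ) * foldedIntegral s (c * x) := by
  rw [neumannOp_eq hs0 hs1 hx (C := 42 * c ^ 2) (M := 42) (by positivity) (by norm_num)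
    (continuous_dilatedBump c).measurable (fun y hy => norm_dilatedBump_taylor hc hx hy)
    (fun y hy => norm_dilatedBump_le hc hy), foldedIntegral]
  congr 2
  ext r
  simp only [foldedDifference, dilatedBump]
  simp only [one_mul, mul_assoc]

theorem integral_cpow_mul_bump {w : ℂ} (hw : -5 < w.re) :
    IntegrableOn (fun x : ℝ => (x : ℂ) ^ w * dilatedBump 1 x) (Ioi 0) ∧
    ∫ x in Ioi (0 : ℝ), (x : ℂ) ^ w * dilatedBump 1 x =
      Complex.Gamma (w + 5) * 6 / Complex.Gamma (w + 9) := by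
  obtain ⟨h1, h2⟩ := integral_cpow_mul_one_sub_rpow (p := w + 4) (q := 3) (by simp; linarith)
    (by norm_num)
  have hc : EqOn (fun r : ℝ => (r : ℂ) ^ (w + 4) * ((1 - r) ^ (3 : ℝ) : ℝ))
      (fun x : ℝ => (x : ℂ) ^ w * dilatedBump 1 x) (Ioo 0 1) := by
    intro r hr
    have hr0 : (r : ℂ) ≠ 0 := by exact_mod_cast hr.1.ne'
    have e : (r : ℂ) ^ (w + 4) = (r : ℂ) ^ w * (r : ℂ) ^ 4 := by
      rw [Complex.cpow_add _ _ hr0]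
      norm_cast
    simp only
    rw [e, dilatedBump, bump, one_mul, max_eq_left (by linarith [hr.2])]
    norm_num
    ring
  have hz : ∀ x ∈ Ioi (0 : ℝ) \ Ioo 0 1, (x : ℂ) ^ w * dilatedBump 1 x = 0 := by
    intro x hx
    have : 1 ≤ x := by
      by_contra h
      exact hx.2 ⟨hx.1, not_le.1 h⟩
    rw [dilatedBump, one_mul, (bump_eq_zero this).1]; simp
  have h3 := h1.congr_fun hc measurableSet_Ioo
  refine ⟨h3.of_forall_sdiff_eq_zero measurableSet_Ioi hz, ?_⟩
  rw [setIntegral_eq_of_subset_of_forall_sdiff_eq_zero measurableSet_Ioi Ioo_subset_Ioi_self hz,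
    ← setIntegral_congr_fun measurableSet_Ioo hc, h2]
  have hG : Complex.Gamma ((3 : ℝ) + 1) = 6 := by
    have := Complex.Gamma_nat_eq_factorial 3
    push_cast at this ⊢
    rw [this]; norm_num [Nat.factorial]
  rw [hG]
  congr 1 <;> congr 1 <;> push_cast <;> ring_nf

theorem integral_cpow_mul_bump_comp {w : ℂ} (hw : -5 < w.re) {r : ℝ} (hr : 0 < r) :
    IntegrableOn (fun x : ℝ => (x : ℂ) ^ w * dilatedBump 1 (x * r)) (Ioi 0) ∧
    ∫ x in Ioi (0 : ℝ), (x : ℂ) ^ w * dilatedBump 1 (x * r) =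
      (r : ℂ) ^ (-w - 1) * (Complex.Gamma (w + 5) * 6 / Complex.Gamma (w + 9)) := by
  obtain ⟨h1, h2⟩ := integral_cpow_mul_bump hw
  have hr0 : (r : ℂ) ≠ 0 := by exact_mod_cast hr.ne'
  have hc : EqOn (fun x : ℝ => (x : ℂ) ^ w * dilatedBump 1 (x * r))
      (fun x : ℝ => (r : ℂ) ^ (-w) * (((r * x : ℝ) : ℂ) ^ w * dilatedBump 1 (r * x))) (Ioi 0) := by
    intro x hx
    have hx : 0 < x := hx
    simp only
    rw [Complex.ofReal_mul, Complex.mul_cpow_ofReal_nonneg hr.le hx.le, Complex.cpow_neg, mul_comm x r]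
    have : (r : ℂ) ^ w ≠ 0 := by simp [Complex.cpow_eq_zero_iff, hr0]
    field_simp
  have h3 : IntegrableOn (fun x : ℝ => ((r * x : ℝ) : ℂ) ^ w * dilatedBump 1 (r * x)) (Ioi 0) := by
    have := integrableOn_Ioi_comp_mul_left_iff (fun x : ℝ => (x : ℂ) ^ w * dilatedBump 1 x) 0 hr
    rw [mul_zero] at this
    exact this.2 h1
  refine ⟨IntegrableOn.congr_fun (h3.const_mul _) (fun x hx => (hc hx).symm) measurableSet_Ioi, ?_⟩
  rw [setIntegral_congr_fun measurableSet_Ioi hc, integral_const_mul]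
  have := integral_comp_mul_left_Ioi (fun x : ℝ => (x : ℂ) ^ w * dilatedBump 1 x) 0 hr
  rw [mul_zero] at this
  rw [this, h2, Complex.real_smul, Complex.cpow_sub _ _ hr0, Complex.cpow_one]
  push_cast
  ring

/-- The Mellin transform of the folded difference in the variable `x`. -/
theorem integral_cpow_mul_foldedDifference {s : ℝ} {β : ℂ} (hβ : 2 * s - 5 < β.re) {r : ℝ} (hr : 0 < r) :
    IntegrableOn (fun x : ℝ => (x : ℂ) ^ (β - 2 * s) * foldedDifference s (dilatedBump 1) x r)
      (Ioi 0) ∧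
    ∫ x in Ioi (0 : ℝ), (x : ℂ) ^ (β - 2 * s) * foldedDifference s (dilatedBump 1) x r =
      (1 - (r : ℂ) ^ (2 * s - 1 - β)) * (1 - (r : ℂ) ^ β) *
        (Complex.Gamma (β - 2 * s + 5) * 6 / Complex.Gamma (β - 2 * s + 9)) := by
  have hw : -5 < (β - 2 * s).re := by simp; linarith
  obtain ⟨i1, e1⟩ := integral_cpow_mul_bump hw
  obtain ⟨i2, e2⟩ := integral_cpow_mul_bump_comp hw hr
  obtain ⟨i3, e3⟩ := integral_cpow_mul_bump_comp hw (inv_pos.2 hr)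
  have e : ∀ x : ℝ, (x : ℂ) ^ (β - 2 * s) * foldedDifference s (dilatedBump 1) x r =
      ((x : ℂ) ^ (β - 2 * s) * dilatedBump 1 x - (x : ℂ) ^ (β - 2 * s) * dilatedBump 1 (x * r)) +
      ((r ^ (2 * s - 1) : ℝ) : ℂ) * ((x : ℂ) ^ (β - 2 * s) * dilatedBump 1 x -
        (x : ℂ) ^ (β - 2 * s) * dilatedBump 1 (x * r⁻¹)) := by
    intro x; rw [foldedDifference]; ring
  simp_rw [e]
  refine ⟨(i1.fun_sub i2).fun_add ((i1.fun_sub i3).const_mul _), ?_⟩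
  rw [integral_add (i1.fun_sub i2) ((i1.fun_sub i3).const_mul _), integral_const_mul,
    integral_sub i1 i2, integral_sub i1 i3, e1, e2, e3, one_sub_cpow_mul_eq hr,
    show (-(β - 2 * s) - 1 : ℂ) = 2 * s - 1 - β by ring]
  ring

/-- For x > 2 and r ≥ 1/2 the three points x, xr, x/r all lie outside the support. For x ≤ 2 the
constant is 1050 = 8·(42·2) + 9·42. -/
theorem norm_foldedDifference_bump_le {s x : ℝ} (hs0 : 0 < s) (hs1 : s < 1) (hx : 0 < x) {r : ℝ}
    (hr : r ∈ Ico (1 / 2 : ℝ) 1) :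
    ‖foldedDifference s (dilatedBump 1) x r‖ ≤ (Ioc (0 : ℝ) 2).indicator (fun x => 1050 * x ^ 2) x * (1 - r) ^ 2 := by
  have hr0 : 0 < r := by linarith [hr.1]
  by_cases h : x ∈ Ioc (0 : ℝ) 2
  · rw [indicator_of_mem h]
    have h1 := norm_foldedDifference_le_near hs0 hs1 hx (C := 42 * 1 ^ 2) (by norm_num)
      (fun y hy => norm_dilatedBump_taylor one_pos hx hy) hr
    refine h1.trans ?_
    have h2 : ‖((1 * bumpDeriv (1 * x) : ℝ) : ℂ)‖ ≤ 42 * x ^ 2 := by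
      rw [one_mul, one_mul, Complex.norm_real]; exact (abs_bump_le hx).2.1
    have h3 : ‖((1 * bumpDeriv (1 * x) : ℝ) : ℂ)‖ * x ≤ 42 * x ^ 2 * 2 := by
      have := h.2
      gcongr
    gcongr
    linarith
  · have hx2 : 2 < x := by
      by_contra h'
      exact h ⟨hx, not_lt.1 h'⟩
    have hinv : 1 < r⁻¹ := (one_lt_inv₀ hr0).2 hr.2
    have z : ∀ y, 1 ≤ y → dilatedBump 1 y = 0 := fun y hy => by
      rw [dilatedBump, one_mul, (bump_eq_zero hy).1]; simp
    rw [indicator_of_notMem h, foldedDifference, z x (by linarith), z (x * r) (by nlinarith [hr.1]),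
      z (x * r⁻¹) (by nlinarith)]
    simp

/-- The bound that justifies Fubini. For r < 1/2 the terms are estimated separately by scaling; for
r ≥ 1/2 the second-order cancellation and the support in x ≤ 2 are used. -/
theorem exists_integral_norm_foldedDifference_le {s : ℝ} (hs0 : 0 < s) (hs1 : s < 1) {ρ : ℝ}
    (hρ : -1 < ρ) (hρ' : ρ < 2 * s) :
    ∃ B κ : ℝ, κ < 1 ∧ ∀ r ∈ Ioo (0 : ℝ) 1,
      ∫ x in Ioi (0 : ℝ), x ^ (ρ - 2 * s) * ‖foldedDifference s (dilatedBump 1) x r‖ ≤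
        B * (r ^ (-κ) * (1 - r) ^ 2) := by
  -- The worst of the exponents of r produced for small r, namely 0, 2s-1, 2s-1-ρ and ρ; each
  -- exceeds -1 exactly because 0 < s and -1 < ρ < 2s.
  set κ := max (max 0 (1 - 2 * s)) (max (ρ + 1 - 2 * s) (-ρ)) with hκdef
  have k0 : 0 ≤ κ := (le_max_left _ _).trans (le_max_left _ _)
  have k1 : 1 - 2 * s ≤ κ := (le_max_right _ _).trans (le_max_left _ _)
  have k2 : ρ + 1 - 2 * s ≤ κ := (le_max_left _ _).trans (le_max_right _ _)
  have k3 : -ρ ≤ κ := (le_max_right _ _).trans (le_max_right _ _)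
  have hκ : κ < 1 := max_lt (max_lt one_pos (by linarith)) (max_lt (by linarith) (by linarith))
  have hw : -5 < ((ρ - 2 * s : ℝ) : ℂ).re := by simp; linarith
  set Φ : ℝ := ∫ x in Ioi (0 : ℝ), x ^ (ρ - 2 * s) * ‖dilatedBump 1 x‖ with hΦ
  have hcn : ∀ (f : ℝ → ℂ), EqOn (fun x : ℝ => ‖(x : ℂ) ^ ((ρ - 2 * s : ℝ) : ℂ) * f x‖)
      (fun x : ℝ => x ^ (ρ - 2 * s) * ‖f x‖) (Ioi 0) := by
    intro f x hx
    simp only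
    rw [norm_mul, Complex.norm_cpow_eq_rpow_re_of_pos hx, Complex.ofReal_re]
  have hI : ∀ r, 0 < r → IntegrableOn (fun x : ℝ => x ^ (ρ - 2 * s) * ‖dilatedBump 1 (x * r)‖) (Ioi 0) :=
    fun r hr => IntegrableOn.congr_fun (integral_cpow_mul_bump_comp hw hr).1.norm (hcn _) measurableSet_Ioi
  have hI1 : IntegrableOn (fun x : ℝ => x ^ (ρ - 2 * s) * ‖dilatedBump 1 x‖) (Ioi 0) :=
    IntegrableOn.congr_fun (integral_cpow_mul_bump hw).1.norm (hcn _) measurableSet_Ioi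
  have hE : ∀ r, 0 < r → ∫ x in Ioi (0 : ℝ), x ^ (ρ - 2 * s) * ‖dilatedBump 1 (x * r)‖ =
      r ^ (2 * s - ρ - 1) * Φ := by
    intro r hr
    have h := integral_comp_mul_left_Ioi (fun x : ℝ => x ^ (ρ - 2 * s) * ‖dilatedBump 1 x‖) 0 hr
    rw [mul_zero, ← hΦ, smul_eq_mul] at h
    have e : ∀ x ∈ Ioi (0 : ℝ), x ^ (ρ - 2 * s) * ‖dilatedBump 1 (x * r)‖ =
        r ^ (2 * s - ρ) * ((r * x) ^ (ρ - 2 * s) * ‖dilatedBump 1 (r * x)‖) := by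
      intro x hx
      have hx : 0 < x := hx
      rw [Real.mul_rpow hr.le hx.le, mul_comm x r, ← mul_assoc, ← mul_assoc, ← Real.rpow_add hr]
      simp
    rw [setIntegral_congr_fun measurableSet_Ioi e, integral_const_mul, h, Real.rpow_sub hr _ 1,
      Real.rpow_one]
    ring
  have hΦ0 : 0 ≤ Φ := setIntegral_nonneg measurableSet_Ioi fun x hx => by
    have hx : 0 < x := hx
    positivity
  have hJ : IntegrableOn (fun x : ℝ => x ^ (ρ - 2 * s + 2)) (Ioc 0 2) := by
    rw [← intervalIntegrable_iff_integrableOn_Ioc_of_le (by norm_num)]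
    exact intervalIntegral.intervalIntegrable_rpow' (by linarith)
  set J : ℝ := ∫ x in Ioc (0 : ℝ) 2, x ^ (ρ - 2 * s + 2)
  have hJ0 : 0 ≤ J := setIntegral_nonneg measurableSet_Ioc fun x hx => Real.rpow_nonneg hx.1.le _
  refine ⟨16 * Φ + 1050 * J, κ, hκ, fun r hr => ?_⟩
  have hr0 := hr.1
  have h1r : 0 < 1 - r := by linarith [hr.2]
  have hnn : 0 ≤ᵐ[volume.restrict (Ioi 0)]
      fun x : ℝ => x ^ (ρ - 2 * s) * ‖foldedDifference s (dilatedBump 1) x r‖ :=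
    (ae_restrict_iff' measurableSet_Ioi).2 (Eventually.of_forall fun x hx => by
      have hx : 0 < x := hx
      simp only [Pi.zero_apply]
      positivity)
  have hle : ∀ p, -κ ≤ p → r ^ p ≤ r ^ (-κ) :=
    fun p hp => Real.rpow_le_rpow_of_exponent_ge hr0 hr.2.le hp
  rcases lt_or_ge r (1 / 2) with h | h
  · have i1 := hI r hr0
    have i2 := hI r⁻¹ (inv_pos.2 hr0)
    have hb : ∫ x in Ioi (0 : ℝ), x ^ (ρ - 2 * s) * ‖foldedDifference s (dilatedBump 1) x r‖ ≤
        ∫ x in Ioi (0 : ℝ), ((x ^ (ρ - 2 * s) * ‖dilatedBump 1 x‖ +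
          x ^ (ρ - 2 * s) * ‖dilatedBump 1 (x * r)‖) + r ^ (2 * s - 1) *
          (x ^ (ρ - 2 * s) * ‖dilatedBump 1 x‖ + x ^ (ρ - 2 * s) * ‖dilatedBump 1 (x * r⁻¹)‖)) := by
      refine integral_mono_of_nonneg hnn ((hI1.fun_add i1).fun_add ((hI1.fun_add i2).const_mul _)) ?_
      refine (ae_restrict_iff' measurableSet_Ioi).2 (Eventually.of_forall fun x hx => ?_)
      have hx : 0 < x := hx
      have hf : ‖foldedDifference s (dilatedBump 1) x r‖ ≤ (‖dilatedBump 1 x‖ + ‖dilatedBump 1 (x * r)‖) +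
          r ^ (2 * s - 1) * (‖dilatedBump 1 x‖ + ‖dilatedBump 1 (x * r⁻¹)‖) := by
        rw [foldedDifference]
        refine (norm_add_le _ _).trans (add_le_add (norm_sub_le _ _) ?_)
        rw [norm_mul, Complex.norm_real, Real.norm_of_nonneg (Real.rpow_nonneg hr0.le _)]
        exact mul_le_mul_of_nonneg_left (norm_sub_le _ _) (Real.rpow_nonneg hr0.le _)
      refine (mul_le_mul_of_nonneg_left hf (Real.rpow_nonneg hx.le _)).trans (le_of_eq ?_)
      ring
    rw [integral_add (hI1.fun_add i1) ((hI1.fun_add i2).const_mul _), integral_const_mul,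
      integral_add hI1 i1, integral_add hI1 i2, hE r hr0, hE _ (inv_pos.2 hr0), Real.inv_rpow hr0.le,
      ← Real.rpow_neg hr0.le] at hb
    refine hb.trans ?_
    have e1 : r ^ (2 * s - 1) * r ^ (-(2 * s - ρ - 1)) = r ^ ρ := by
      rw [← Real.rpow_add hr0]; ring_nf
    have l0 : 1 ≤ r ^ (-κ) := by simpa using hle 0 (by linarith)
    have l1 := hle (2 * s - ρ - 1) (by linarith)
    have l2 := hle (2 * s - 1) (by linarith)
    have l3 := hle ρ (by linarith)
    have l4 : (1 / 4 : ℝ) ≤ (1 - r) ^ 2 := by nlinarith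
    calc Φ + r ^ (2 * s - ρ - 1) * Φ + r ^ (2 * s - 1) * (Φ + r ^ (-(2 * s - ρ - 1)) * Φ)
        = (1 + r ^ (2 * s - ρ - 1) + r ^ (2 * s - 1) + r ^ (2 * s - 1) * r ^ (-(2 * s - ρ - 1))) * Φ := by
          ring
      _ ≤ (r ^ (-κ) + r ^ (-κ) + r ^ (-κ) + r ^ (-κ)) * Φ := by rw [e1]; gcongr
      _ = 16 * Φ * (r ^ (-κ) * (1 / 4)) := by ring
      _ ≤ (16 * Φ + 1050 * J) * (r ^ (-κ) * (1 - r) ^ 2) := by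
          gcongr
          linarith
  · have hb : ∫ x in Ioi (0 : ℝ), x ^ (ρ - 2 * s) * ‖foldedDifference s (dilatedBump 1) x r‖ ≤
        ∫ x in Ioi (0 : ℝ), (Ioc (0 : ℝ) 2).indicator (fun x => (1050 * (1 - r) ^ 2) *
          x ^ (ρ - 2 * s + 2)) x := by
      refine integral_mono_of_nonneg hnn ?_ ?_
      · exact ((integrable_indicator_iff measurableSet_Ioc).2 (hJ.const_mul _)).integrableOn
      · refine (ae_restrict_iff' measurableSet_Ioi).2 (Eventually.of_forall fun x hx => ?_)
        have hx : 0 < x := hx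
        have := norm_foldedDifference_bump_le hs0 hs1 hx ⟨h, hr.2⟩
        refine (mul_le_mul_of_nonneg_left this (Real.rpow_nonneg hx.le _)).trans (le_of_eq ?_)
        by_cases hx2 : x ∈ Ioc (0 : ℝ) 2
        · rw [indicator_of_mem hx2, indicator_of_mem hx2, Real.rpow_add hx, Real.rpow_two]
          ring
        · rw [indicator_of_notMem hx2, indicator_of_notMem hx2]; ring
    rw [setIntegral_indicator measurableSet_Ioc, inter_eq_self_of_subset_right Ioc_subset_Ioi_self,
      integral_const_mul] at hb
    refine hb.trans ?_
    have l0 : 1 ≤ r ^ (-κ) := by simpa using hle 0 (by linarith)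
    calc 1050 * (1 - r) ^ 2 * J = 1050 * J * (1 * (1 - r) ^ 2) := by ring
      _ ≤ (16 * Φ + 1050 * J) * (r ^ (-κ) * (1 - r) ^ 2) := by
          gcongr
          linarith

/-- The Mellin transform of the image of the test function under the operator. -/
theorem integral_cpow_mul_foldedIntegral {s : ℝ} (hs0 : 0 < s) (hs1 : s < 1) {β : ℂ}
    (hβ : -1 < β.re) (hβ' : β.re < 2 * s) :
    IntegrableOn (fun x : ℝ => (x : ℂ) ^ (β - 2 * s) * foldedIntegral s x) (Ioi 0) ∧
    ∫ x in Ioi (0 : ℝ), (x : ℂ) ^ (β - 2 * s) * foldedIntegral s x =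
      mellinMultiplier s β * (Complex.Gamma (β - 2 * s + 5) * 6 / Complex.Gamma (β - 2 * s + 9)) := by
  set F : ℝ × ℝ → ℂ := fun p => (p.1 : ℂ) ^ (β - 2 * s) *
    (foldedDifference s (dilatedBump 1) p.1 p.2 * (neumannKernel s 1 p.2 : ℂ)) with hF
  have hmf := measurable_foldedDifference s (continuous_dilatedBump 1).measurable
  have hmk := measurable_neumannKernel s
  have hmF : Measurable F := by
    simp only [hF]
    fun_prop
  have hint : Integrable F ((volume.restrict (Ioi 0)).prod (volume.restrict (Ioo 0 1))) := by
    rw [integrable_prod_iff' hmF.aestronglyMeasurable]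
    constructor
    · refine (ae_restrict_iff' measurableSet_Ioo).2 (Eventually.of_forall fun r hr => ?_)
      have := (integral_cpow_mul_foldedDifference (s := s) (β := β) (by linarith) hr.1).1.mul_const
        (neumannKernel s 1 r : ℂ)
      simp only [hF, ← mul_assoc]
      exact this
    · obtain ⟨B, κ, hκ, hB⟩ := exists_integral_norm_foldedDifference_le hs0 hs1 hβ hβ'
      set N : ℝ → ℝ := fun r => ∫ x in Ioi (0 : ℝ),
        x ^ (β.re - 2 * s) * ‖foldedDifference s (dilatedBump 1) x r‖ with hN
      have hmN : Measurable N := by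
        have : StronglyMeasurable N := by
          refine StronglyMeasurable.integral_prod_left' (f := fun p : ℝ × ℝ =>
            p.1 ^ (β.re - 2 * s) * ‖foldedDifference s (dilatedBump 1) p.1 p.2‖) ?_
          apply Measurable.stronglyMeasurable
          fun_prop
        exact this.measurable
      have hN0 : ∀ r, 0 ≤ N r := fun r => setIntegral_nonneg measurableSet_Ioi fun x hx => by
        have hx : 0 < x := hx
        positivity
      have h := integrableOn_mul_neumannKernel hs0 hs1 (B := B) hκ (g := fun r => (N r : ℂ))
        (by fun_prop) (fun r hr => by
          rw [Complex.norm_real, Real.norm_of_nonneg (hN0 r)]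
          exact hB r hr)
      refine IntegrableOn.congr_fun h.norm (fun r hr => ?_) measurableSet_Ioo
      have hK := neumannKernel_nonneg hs0 hs1 r
      change ‖(N r : ℂ) * (neumannKernel s 1 r : ℂ)‖ = _
      rw [norm_mul, Complex.norm_real, Complex.norm_real, Real.norm_of_nonneg (hN0 r),
        Real.norm_of_nonneg hK, hN, ← integral_mul_const]
      refine setIntegral_congr_fun measurableSet_Ioi fun x hx => ?_
      simp only [hF, norm_mul]
      rw [Complex.norm_cpow_eq_rpow_re_of_pos hx, Complex.norm_real, Real.norm_of_nonneg hK]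
      simp [mul_assoc]
  have e : (fun x : ℝ => (x : ℂ) ^ (β - 2 * s) * foldedIntegral s x) =
      fun x : ℝ => ∫ r in Ioo (0 : ℝ) 1, F (x, r) := by
    ext x
    rw [foldedIntegral, ← integral_const_mul]
  rw [e]
  refine ⟨hint.integral_prod_left, ?_⟩
  rw [integral_integral_swap (f := fun x r => F (x, r)) hint,
    ← integral_neumannKernel_symbol hs0 hs1 hβ hβ', ← integral_mul_const]
  refine setIntegral_congr_fun measurableSet_Ioo fun r hr => ?_
  simp only [hF, ← mul_assoc]
  rw [integral_mul_const, (integral_cpow_mul_foldedDifference (s := s) (β := β) (by linarith) hr.1).2]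
  ring

end MellinOfImage

/-! ### The equation in logarithmic coordinates -/

section LogarithmicCoordinates

/-- The image of the test function under the operator, in logarithmic coordinates. -/
noncomputable def imageKernel (s t : ℝ) : ℂ :=
  ((Real.exp ((1 - 2 * s) * t) : ℝ) : ℂ) * foldedIntegral s (Real.exp t)

/-- The Laplace transform of `imageKernel`, in closed form. -/
noncomputable def imageTransform (s : ℝ) (β : ℂ) : ℂ :=
  mellinMultiplier s β * (Complex.Gamma (β - 2 * s + 5) * 6 / Complex.Gamma (β - 2 * s + 9))

theorem ofReal_exp_cpow (t : ℝ) (w : ℂ) : ((Real.exp t : ℝ) : ℂ) ^ w = Complex.exp (w * t) := by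
  rw [Complex.cpow_def_of_ne_zero (by simp), ← Complex.ofReal_log (Real.exp_pos t).le,
    Real.log_exp, mul_comm]

theorem laplace_imageKernel {s : ℝ} (hs0 : 0 < s) (hs1 : s < 1) {β : ℂ}
    (hβ : -1 < β.re) (hβ' : β.re < 2 * s) :
    Integrable (fun t : ℝ => imageKernel s t * Complex.exp (β * t)) ∧
    ∫ t : ℝ, imageKernel s t * Complex.exp (β * t) = imageTransform s β := by
  obtain ⟨h1, h2⟩ := integral_cpow_mul_foldedIntegral hs0 hs1 hβ hβ'
  have e : (fun t : ℝ => Real.exp t • (((Real.exp t : ℝ) : ℂ) ^ (β - 2 * s) *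
      foldedIntegral s (Real.exp t))) = fun t : ℝ => imageKernel s t * Complex.exp (β * t) := by
    ext t
    rw [ofReal_exp_cpow, imageKernel, Complex.real_smul, Complex.ofReal_exp, Complex.ofReal_exp,
      show Complex.exp (t : ℂ) * (Complex.exp ((β - 2 * s) * t) * foldedIntegral s (Real.exp t)) =
        (Complex.exp (t : ℂ) * Complex.exp ((β - 2 * s) * t)) * foldedIntegral s (Real.exp t) by ring,
      show Complex.exp (((1 - 2 * s) * t : ℝ) : ℂ) * foldedIntegral s (Real.exp t) * Complex.exp (β * t) =
        (Complex.exp (((1 - 2 * s) * t : ℝ) : ℂ) * Complex.exp (β * t)) * foldedIntegral s (Real.exp t)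
        by ring, ← Complex.exp_add, ← Complex.exp_add]
    congr 2
    push_cast; ring
  rw [← e]
  exact ⟨(integrableOn_Ioi_zero_iff_integrable_exp _).1 h1,
    (integral_Ioi_zero_eq_integral_exp _).symm.trans h2⟩

/-- Dilating the test function by e^{-r} is translation by r in t. The Jacobian eᵗ is part of
`imageKernel`, which leaves only a constant factor depending on r. -/
theorem integral_mul_imageKernel_eq_zero {s : ℝ} (hs0 : 0 < s) (hs1 : s < 1) {u : ℝ → ℂ}
    (hu : IsDistributionalSolution s u) (r : ℝ) :
    ∫ t : ℝ, u (Real.exp t) * imageKernel s (t - r) = 0 := by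
  have h := hu.2 (dilatedBump (Real.exp (-r))) (memWeightedC_dilatedBump hs0 (Real.exp_pos _))
  have hc : EqOn (fun x : ℝ => u x * neumannOp s (dilatedBump (Real.exp (-r))) x)
      (fun x : ℝ => u x * (((x ^ (-(2 * s)) : ℝ) : ℂ) * foldedIntegral s (Real.exp (-r) * x))) (Ioi 0) := by
    intro x hx
    simp only
    rw [neumannOp_dilatedBump hs0 hs1 (Real.exp_pos _) hx]
  rw [setIntegral_congr_fun measurableSet_Ioi hc, integral_Ioi_zero_eq_integral_exp] at h
  have e : (fun t : ℝ => u (Real.exp t) * imageKernel s (t - r)) = fun t : ℝ =>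
      (Real.exp (-((1 - 2 * s) * r)) : ℂ) * (Real.exp t • (u (Real.exp t) *
        (((Real.exp t ^ (-(2 * s)) : ℝ) : ℂ) * foldedIntegral s (Real.exp (-r) * Real.exp t)))) := by
    ext t
    have e1 : Real.exp ((1 - 2 * s) * (t - r)) =
        Real.exp (-((1 - 2 * s) * r)) * (Real.exp t * Real.exp t ^ (-(2 * s))) := by
      rw [← Real.exp_mul, ← Real.exp_add, ← Real.exp_add]; ring_nf
    rw [imageKernel, e1, ← Real.exp_add, neg_add_eq_sub, Complex.real_smul]
    push_cast
    ring
  rw [e, integral_const_mul, h, mul_zero]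

end LogarithmicCoordinates

open scoped ContDiff

/-! ### Transforms of test functions -/

section LaplaceTransform

/-- The bilateral Laplace transform, with the sign convention of the Mellin transform. -/
noncomputable def laplace (ψ : ℝ → ℂ) (β : ℂ) : ℂ := ∫ t : ℝ, ψ t * Complex.exp (β * t)

theorem integrable_mul_pow_mul_exp {ψ : ℝ → ℂ} (hc : Continuous ψ) (hs : HasCompactSupport ψ)
    (l : ℕ) (β : ℂ) : Integrable fun t : ℝ => ψ t * (t : ℂ) ^ l * Complex.exp (β * t) := by
  refine Continuous.integrable_of_hasCompactSupport (by fun_prop) ?_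
  exact (hs.mul_right).mul_right

theorem integrable_mul_exp {ψ : ℝ → ℂ} (hc : Continuous ψ) (hs : HasCompactSupport ψ)
    (β : ℂ) : Integrable fun t : ℝ => ψ t * Complex.exp (β * t) := by
  simpa using integrable_mul_pow_mul_exp hc hs 0 β

theorem hasDerivAt_integral_mul_pow_mul_exp {ψ : ℝ → ℂ} (hc : Continuous ψ)
    (hs : HasCompactSupport ψ) (l : ℕ) (β : ℂ) :
    HasDerivAt (fun β : ℂ => ∫ t : ℝ, ψ t * (t : ℂ) ^ l * Complex.exp (β * t))
      (∫ t : ℝ, ψ t * (t : ℂ) ^ (l + 1) * Complex.exp (β * t)) β := by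
  have hbound : Integrable fun t : ℝ => ‖ψ t‖ * |t| ^ (l + 1) * Real.exp ((‖β‖ + 1) * |t|) := by
    refine Continuous.integrable_of_hasCompactSupport (by fun_prop) ?_
    exact (hs.norm.mul_right).mul_right
  refine (hasDerivAt_integral_of_dominated_loc_of_deriv_le (Metric.ball_mem_nhds β one_pos)
    (bound := fun t : ℝ => ‖ψ t‖ * |t| ^ (l + 1) * Real.exp ((‖β‖ + 1) * |t|))
    (F := fun (β : ℂ) (t : ℝ) => ψ t * (t : ℂ) ^ l * Complex.exp (β * t))
    (F' := fun (β : ℂ) (t : ℝ) => ψ t * (t : ℂ) ^ (l + 1) * Complex.exp (β * t)) ?_ ?_ ?_ ?_ hbound ?_).2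
  · exact Eventually.of_forall fun z => (integrable_mul_pow_mul_exp hc hs l z).aestronglyMeasurable
  · exact integrable_mul_pow_mul_exp hc hs l β
  · exact (integrable_mul_pow_mul_exp hc hs (l + 1) β).aestronglyMeasurable
  · refine Eventually.of_forall fun t z hz => ?_
    rw [norm_mul, norm_mul, norm_pow, Complex.norm_real, Real.norm_eq_abs, Complex.norm_exp]
    refine mul_le_mul_of_nonneg_left (Real.exp_le_exp.2 ?_) (by positivity)
    refine (Complex.re_le_norm _).trans ?_
    rw [norm_mul, Complex.norm_real, Real.norm_eq_abs]
    refine mul_le_mul_of_nonneg_right ?_ (abs_nonneg t)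
    have h1 : ‖z - β‖ < 1 := by simpa [dist_eq_norm] using hz
    have := norm_sub_norm_le z β
    linarith
  · refine Eventually.of_forall fun t z _ => ?_
    have h := (((hasDerivAt_id z).mul_const (t : ℂ)).cexp).const_mul (ψ t * (t : ℂ) ^ l)
    refine h.congr_deriv ?_
    simp only [id]
    ring

theorem iteratedDeriv_laplace {ψ : ℝ → ℂ} (hc : Continuous ψ) (hs : HasCompactSupport ψ) (l : ℕ) :
    iteratedDeriv l (laplace ψ) = fun β => ∫ t : ℝ, ψ t * (t : ℂ) ^ l * Complex.exp (β * t) := by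
  induction l with
  | zero => ext β; simp [laplace]
  | succ l ih =>
    rw [iteratedDeriv_succ, ih]
    exact funext fun β => (hasDerivAt_integral_mul_pow_mul_exp hc hs l β).deriv

theorem analyticAt_laplace {ψ : ℝ → ℂ} (hc : Continuous ψ) (hs : HasCompactSupport ψ) (β : ℂ) :
    AnalyticAt ℂ (laplace ψ) β := by
  have hd : Differentiable ℂ (laplace ψ) := fun z => by
    rw [← iteratedDeriv_zero (f := laplace ψ), iteratedDeriv_laplace hc hs 0]
    exact (hasDerivAt_integral_mul_pow_mul_exp hc hs 0 z).differentiableAt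
  exact hd.analyticAt β

theorem laplace_deriv {ψ : ℝ → ℂ} (hψ : ContDiff ℝ 1 ψ) (hs : HasCompactSupport ψ) (β : ℂ) :
    laplace (deriv ψ) β = -β * laplace ψ β := by
  have hcd : Continuous (deriv ψ) := hψ.continuous_deriv le_rfl
  have hexp : ∀ t : ℝ, HasDerivAt (fun t : ℝ => Complex.exp (β * t)) (β * Complex.exp (β * t)) t := by
    intro t
    have h := ((hasDerivAt_id (t : ℂ)).const_mul β).cexp.comp_ofReal
    refine h.congr_deriv ?_
    simp; ring
  have hi := integrable_mul_exp hψ.continuous hs β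
  have h := integral_mul_deriv_eq_deriv_mul_of_integrable (u := ψ) (u' := deriv ψ)
    (v := fun t : ℝ => Complex.exp (β * t)) (v' := fun t : ℝ => β * Complex.exp (β * t))
    (fun t _ => (hψ.differentiable one_ne_zero t).hasDerivAt) (fun t _ => hexp t) (by
      refine (hi.const_mul β).congr (Eventually.of_forall fun t => ?_)
      simp only [Pi.mul_apply]; ring)
    (integrable_mul_exp hcd hs.deriv β) hi
  have h2 : ∫ t : ℝ, ψ t * (β * Complex.exp (β * t)) = β * ∫ t : ℝ, ψ t * Complex.exp (β * t) := by
    rw [← integral_const_mul]; congr 1; ext t; ring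
  simp only [laplace]
  linear_combination h - h2

/-- Each integration by parts trades a derivative of ψ for a factor β, and the weight e^{βt} is
uniformly bounded on the support while Re β is bounded. -/
theorem norm_pow_mul_laplace {ψ : ℝ → ℂ} (hψ : ContDiff ℝ ∞ ψ) (hs : HasCompactSupport ψ) (n : ℕ)
    (R : ℝ) : ∃ C, ∀ β : ℂ, |β.re| ≤ R → ‖β‖ ^ n * ‖laplace ψ β‖ ≤ C := by
  induction n generalizing ψ with
  | zero =>
    have hi : Integrable fun t : ℝ => ‖ψ t‖ * Real.exp (R * |t|) := by
      have := hψ.continuous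
      exact Continuous.integrable_of_hasCompactSupport (by fun_prop) hs.norm.mul_right
    refine ⟨∫ t : ℝ, ‖ψ t‖ * Real.exp (R * |t|), fun β hβ => ?_⟩
    rw [pow_zero, one_mul, laplace]
    refine norm_integral_le_of_norm_le hi (Eventually.of_forall fun t => ?_)
    rw [norm_mul, Complex.norm_exp]
    refine mul_le_mul_of_nonneg_left (Real.exp_le_exp.2 ?_) (norm_nonneg _)
    simp only [Complex.mul_re, Complex.ofReal_re, Complex.ofReal_im, mul_zero, sub_zero]
    refine (le_abs_self _).trans ?_
    rw [abs_mul]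
    exact mul_le_mul_of_nonneg_right hβ (abs_nonneg t)
  | succ n ih =>
    have hd : ContDiff ℝ ∞ (deriv ψ) := by
      have : ContDiff ℝ (∞ + 1) ψ := hψ
      exact (contDiff_succ_iff_deriv.1 this).2.2
    obtain ⟨C, hC⟩ := ih hd hs.deriv
    refine ⟨C, fun β hβ => ?_⟩
    have := hC β hβ
    rw [laplace_deriv (hψ.of_le (by exact_mod_cast le_top)) hs, norm_mul, norm_neg] at this
    rw [pow_succ]
    linarith

/-- On the line Re β = σ the transform is the Fourier transform of ψ(v)e^{σv}, with frequency
rescaled by -2π; Fourier inversion does the rest. -/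
theorem laplace_inversion {ψ : ℝ → ℂ} (hψ : ContDiff ℝ ∞ ψ) (hs : HasCompactSupport ψ) (σ t : ℝ) :
    Integrable (fun τ : ℝ => laplace ψ (σ + τ * Complex.I)) ∧
    (1 / (2 * Real.pi) : ℂ) * ∫ τ : ℝ, laplace ψ (σ + τ * Complex.I) *
      Complex.exp (-(σ + τ * Complex.I) * t) = ψ t := by
  have hint : Integrable (fun τ : ℝ => laplace ψ (σ + τ * Complex.I)) := by
    obtain ⟨C0, h0⟩ := norm_pow_mul_laplace hψ hs 0 |σ|
    obtain ⟨C2, h2⟩ := norm_pow_mul_laplace hψ hs 2 |σ|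
    have hcont : Continuous (laplace ψ) :=
      continuous_iff_continuousAt.2 fun β => (analyticAt_laplace hψ.continuous hs β).continuousAt
    refine Integrable.mono' (integrable_inv_one_add_sq.const_mul (C0 + C2))
      (Continuous.aestronglyMeasurable (by fun_prop)) (Eventually.of_forall fun τ => ?_)
    have k0 := h0 (σ + τ * Complex.I) (by simp)
    have k2 := h2 (σ + τ * Complex.I) (by simp)
    have him : τ ^ 2 ≤ ‖(σ + τ * Complex.I : ℂ)‖ ^ 2 := by
      have := Complex.abs_im_le_norm (σ + τ * Complex.I)
      simp at this
      rw [← sq_abs]; gcongr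
    rw [← div_eq_mul_inv, le_div_iff₀ (by positivity)]
    have := mul_le_mul_of_nonneg_right him (norm_nonneg (laplace ψ (σ + τ * Complex.I)))
    rw [pow_zero, one_mul] at k0
    linarith
  refine ⟨hint, ?_⟩
  set f : ℝ → ℂ := fun v => ψ v * Complex.exp (σ * v)
  have hf : Continuous f := by
    have := hψ.continuous
    fun_prop
  have hfi : Integrable f := integrable_mul_exp hψ.continuous hs σ
  have hF : ∀ w : ℝ, FourierTransform.fourier f w = laplace ψ (σ + ((-(2 * Real.pi)) * w : ℝ) * Complex.I) := by
    intro w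
    rw [Real.fourier_eq', laplace]
    congr 1
    ext v
    simp only [f, smul_eq_mul, RCLike.inner_apply, conj_trivial]
    rw [mul_comm, mul_assoc, ← Complex.exp_add]
    congr 2
    push_cast; ring
  have hFi : Integrable (FourierTransform.fourier f) := by
    have := hint.comp_mul_left' (R := -(2 * Real.pi)) (by simp [Real.pi_ne_zero])
    refine this.congr (Eventually.of_forall fun w => ?_)
    rw [hF]
  have hinv := congrFun (hf.fourierInv_fourier_eq hfi hFi) t
  rw [Real.fourierInv_eq'] at hinv
  have hsub := Measure.integral_comp_mul_left (fun τ : ℝ => laplace ψ (σ + τ * Complex.I) *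
    Complex.exp (-(τ * Complex.I) * t)) (-(2 * Real.pi))
  have e1 : (∫ w : ℝ, Complex.exp (((2 * Real.pi * inner ℝ w t : ℝ) : ℂ) * Complex.I) •
      FourierTransform.fourier f w) = ∫ w : ℝ, laplace ψ (σ + ((-(2 * Real.pi) * w : ℝ) : ℂ) * Complex.I) *
        Complex.exp (-(((-(2 * Real.pi) * w : ℝ) : ℂ) * Complex.I) * t) := by
    congr 1
    ext w
    rw [hF, smul_eq_mul, mul_comm]
    congr 2
    simp only [RCLike.inner_apply, conj_trivial]
    push_cast; ring
  rw [e1, hsub] at hinv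
  have e2 : (∫ τ : ℝ, laplace ψ (σ + τ * Complex.I) * Complex.exp (-(σ + τ * Complex.I) * t)) =
      Complex.exp (-(σ * t)) * ∫ τ : ℝ, laplace ψ (σ + τ * Complex.I) * Complex.exp (-(τ * Complex.I) * t) := by
    rw [← integral_const_mul]
    congr 1
    ext τ
    rw [mul_left_comm, ← Complex.exp_add]
    congr 2; ring
  have e3 : ((|(-(2 * Real.pi))⁻¹| : ℝ) : ℂ) = 1 / (2 * Real.pi) := by
    rw [abs_inv, abs_neg, abs_of_pos (by positivity)]
    push_cast; rw [one_div]
  rw [Complex.real_smul, e3] at hinv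
  rw [e2, mul_left_comm, hinv]
  simp only [f]
  rw [mul_left_comm, ← Complex.exp_add]
  simp

end LaplaceTransform

/-! ### Shifting vertical contours -/

section ContourShift

/-- The integral over a vertical line of an analytic function on a strip with quadratic decay does not
depend on the line. -/
theorem integral_vertical_eq {h : ℂ → ℂ} {a b C : ℝ} (hab : a ≤ b)
    (han : ∀ β : ℂ, a ≤ β.re → β.re ≤ b → AnalyticAt ℂ h β)
    (hb : ∀ β : ℂ, a ≤ β.re → β.re ≤ b → ‖h β‖ ≤ C * (1 + β.im ^ 2)⁻¹) :
    ∫ τ : ℝ, h (a + τ * Complex.I) = ∫ τ : ℝ, h (b + τ * Complex.I) := by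
  have hC : 0 ≤ C := by
    have := (norm_nonneg _).trans (hb a (by simp) (by simpa))
    simpa using this
  have hint : ∀ σ, a ≤ σ → σ ≤ b → Integrable fun τ : ℝ => h (σ + τ * Complex.I) := by
    intro σ h1 h2
    refine Integrable.mono' (integrable_inv_one_add_sq.const_mul C)
      (Continuous.aestronglyMeasurable ?_) (Eventually.of_forall fun τ => ?_)
    · refine continuous_iff_continuousAt.2 fun τ => ?_
      refine ContinuousAt.comp (f := fun τ : ℝ => (σ + τ * Complex.I : ℂ))
        (han _ (by simpa) (by simpa)).continuousAt (by fun_prop)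
    · have := hb (σ + τ * Complex.I) (by simpa) (by simpa)
      simpa using this
  have hlimit : ∀ σ, a ≤ σ → σ ≤ b → Tendsto (fun R : ℝ => ∫ τ in (-R)..R, h (σ + τ * Complex.I)) atTop
      (𝓝 (∫ τ : ℝ, h (σ + τ * Complex.I))) := fun σ h1 h2 =>
    intervalIntegral_tendsto_integral (hint σ h1 h2) tendsto_neg_atTop_atBot tendsto_id
  -- Stated for any height whose square is R², so that the top and the bottom side are treated at
  -- once.
  have hhor : ∀ s : ℝ → ℝ, (∀ R, (s R) ^ 2 = R ^ 2) →
      Tendsto (fun R : ℝ => ∫ x in a..b, h (x + (s R : ℝ) * Complex.I)) atTop (𝓝 0) := by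
    intro s hs
    refine squeeze_zero_norm (a := fun R : ℝ => C * (1 + R ^ 2)⁻¹ * |b - a|) (fun R => ?_) ?_
    · refine intervalIntegral.norm_integral_le_of_norm_le_const fun x hx => ?_
      rw [uIoc_of_le hab] at hx
      have := hb (x + (s R : ℝ) * Complex.I) (by simpa using hx.1.le) (by simpa using hx.2)
      simpa [hs R] using this
    · have h1 : Tendsto (fun R : ℝ => (1 + R ^ 2)⁻¹) atTop (𝓝 0) := by
        refine tendsto_inv_atTop_zero.comp ?_
        exact tendsto_atTop_add_const_left _ _ (tendsto_pow_atTop two_ne_zero)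
      have := (h1.const_mul C).mul_const |b - a|
      simpa using this
  have hrect : ∀ R : ℝ, (∫ x in a..b, h (x + ((-R : ℝ) : ℂ) * Complex.I)) -
      (∫ x in a..b, h (x + (R : ℂ) * Complex.I)) +
      Complex.I * (∫ τ in (-R)..R, h (b + τ * Complex.I)) -
      Complex.I * (∫ τ in (-R)..R, h (a + τ * Complex.I)) = 0 := by
    intro R
    have := Complex.integral_boundary_rect_eq_zero_of_differentiableOn h (⟨a, -R⟩ : ℂ) (⟨b, R⟩ : ℂ) (by
      intro β hβ
      rw [Complex.mem_reProdIm] at hβ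
      have h1 := hβ.1
      simp only [uIcc_of_le hab] at h1
      exact (han β h1.1 h1.2).differentiableAt.differentiableWithinAt)
    simpa [smul_eq_mul] using this
  have hl := (((hhor (fun R => -R) (fun R => by ring)).sub (hhor id (fun R => rfl))).add
    ((hlimit b hab le_rfl).const_mul Complex.I)).sub ((hlimit a le_rfl hab).const_mul Complex.I)
  have h0 := tendsto_nhds_unique (hl.congr fun R => hrect R) tendsto_const_nhds
  have h1 : Complex.I * ((∫ τ : ℝ, h (b + τ * Complex.I)) - ∫ τ : ℝ, h (a + τ * Complex.I)) = 0 := by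
    linear_combination h0
  have h2 := (mul_eq_zero.1 h1).resolve_left Complex.I_ne_zero
  exact (sub_eq_zero.1 h2).symm

end ContourShift

/-! ### Division of analytic functions -/

section Division

/-- Division of analytic functions on a set, when the orders of vanishing allow it. -/
theorem exists_analytic_quotient {F P : ℂ → ℂ} {S : Set ℂ} (hF : ∀ β ∈ S, AnalyticAt ℂ F β)
    (hP : ∀ β ∈ S, AnalyticAt ℂ P β) (hFtop : ∀ β ∈ S, analyticOrderAt F β ≠ ⊤)
    (hord : ∀ β ∈ S, analyticOrderAt F β ≤ analyticOrderAt P β) :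
    ∃ m : ℂ → ℂ, (∀ β ∈ S, AnalyticAt ℂ m β) ∧ ∀ β ∈ S, m β * F β = P β := by
  have hq : MeromorphicOn (fun β => P β / F β) S := fun β hβ =>
    ((hP β hβ).meromorphicAt).div (hF β hβ).meromorphicAt
  -- At the zeros of F the pointwise quotient has a default value; the normal form puts the analytic
  -- continuation there instead.
  refine ⟨toMeromorphicNFOn (fun β => P β / F β) S, ?_⟩
  have hnf := meromorphicNFOn_toMeromorphicNFOn (fun β => P β / F β) S
  have han : ∀ β ∈ S, AnalyticAt ℂ (toMeromorphicNFOn (fun β => P β / F β) S) β := by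
    intro β hβ
    rw [← (hnf hβ).meromorphicOrderAt_nonneg_iff_analyticAt, meromorphicOrderAt_toMeromorphicNFOn hq hβ]
    rw [fun_meromorphicOrderAt_div (hP β hβ).meromorphicAt (hF β hβ).meromorphicAt,
      (hP β hβ).meromorphicOrderAt_eq, (hF β hβ).meromorphicOrderAt_eq]
    have ho := hord β hβ
    obtain ⟨n, hn⟩ := ENat.ne_top_iff_exists.1 (hFtop β hβ)
    rw [← hn] at ho ⊢
    cases hk : analyticOrderAt P β with
    | top => simp
    | coe k =>
      rw [hk] at ho
      have hnk : n ≤ k := by exact_mod_cast ho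
      have h0 : (0 : WithTop ℤ) ≤ (((k : ℤ) - (n : ℤ) : ℤ) : WithTop ℤ) := by
        exact_mod_cast sub_nonneg.2 (Int.ofNat_le.2 hnk)
      exact h0
  refine ⟨han, fun β hβ => ?_⟩
  have h1 := hq.toMeromorphicNFOn_eq_self_on_nhdsNE hβ
  have h2 : ∀ᶠ z in 𝓝[≠] β, F z ≠ 0 := by
    rcases (hF β hβ).eventually_eq_zero_or_eventually_ne_zero with h | h
    · exact absurd (analyticOrderAt_eq_top.2 h) (hFtop β hβ)
    · exact h
  have h3 : (fun z => toMeromorphicNFOn (fun β => P β / F β) S z * F z) =ᶠ[𝓝[≠] β] P := by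
    filter_upwards [h1, h2] with z hz hz'
    rw [hz, div_mul_cancel₀ _ hz']
  exact ((((han β hβ).mul (hF β hβ)).continuousAt).eventuallyEq_nhds_iff_eventuallyEq_nhdsNE
    (hP β hβ).continuousAt).1 h3 |>.eq_of_nhds

end Division

/-! ### The convolution equation -/

section ConvolutionEquation

theorem integrable_exp_neg_mul_abs {δ : ℝ} (hδ : 0 < δ) :
    Integrable fun t : ℝ => Real.exp (-δ * |t|) := by
  rw [← integrableOn_univ, ← Iic_union_Ioi (a := (0 : ℝ))]
  refine IntegrableOn.union ?_ ?_
  · refine (integrableOn_exp_mul_Iic hδ 0).congr_fun (fun t ht => ?_) measurableSet_Iic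
    simp only [abs_of_nonpos (mem_Iic.1 ht)]
    ring_nf
  · refine (integrableOn_exp_mul_Ioi (neg_lt_zero.2 hδ) 0).congr_fun (fun t ht => ?_)
      measurableSet_Ioi
    simp only [abs_of_pos (mem_Ioi.1 ht)]

/-- The bound with b controls t ≥ 0 and the bound with a controls t ≤ 0, leaving exponential decay
at rate min(γ-a, b-γ). -/
theorem integrable_exp_mul_of_norm_le {k : ℝ → ℂ} {a b γ C : ℝ} (hm : AEStronglyMeasurable k)
    (hC : 0 ≤ C) (haγ : a < γ) (hγb : γ < b) (ha : ∀ t, ‖k t‖ ≤ C * Real.exp (-(a * t)))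
    (hb : ∀ t, ‖k t‖ ≤ C * Real.exp (-(b * t))) :
    Integrable fun t : ℝ => (Real.exp (γ * t) : ℂ) * k t := by
  set δ := min (γ - a) (b - γ) with hδdef
  have hδ : 0 < δ := lt_min (by linarith) (by linarith)
  have hi : Integrable fun t : ℝ => C * Real.exp (-δ * |t|) :=
    (integrable_exp_neg_mul_abs hδ).const_mul C
  refine hi.mono' ?_ (Eventually.of_forall fun t => ?_)
  · exact (Continuous.aestronglyMeasurable (by fun_prop)).mul hm
  rw [norm_mul, Complex.norm_real, Real.norm_of_nonneg (Real.exp_pos _).le]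
  have key : ∀ c, ‖k t‖ ≤ C * Real.exp (-(c * t)) → γ * t - c * t ≤ -δ * |t| →
      Real.exp (γ * t) * ‖k t‖ ≤ C * Real.exp (-δ * |t|) := by
    intro c hc hle
    calc Real.exp (γ * t) * ‖k t‖ ≤ Real.exp (γ * t) * (C * Real.exp (-(c * t))) := by gcongr
      _ = C * Real.exp (γ * t - c * t) := by rw [sub_eq_add_neg, Real.exp_add]; ring
      _ ≤ _ := by gcongr
  rcases le_total 0 t with h | h
  · refine key b (hb t) ?_
    rw [abs_of_nonneg h]
    nlinarith [min_le_right (γ - a) (b - γ)]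
  · refine key a (ha t) ?_
    rw [abs_of_nonpos h]
    nlinarith [min_le_left (γ - a) (b - γ)]

/-- A function of moderate growth that is annihilated by all translates of a kernel is annihilated
by every test function whose transform is divisible by the transform of the kernel. -/
theorem integral_mul_eq_zero_of_convolution_eq_zero {U G ψ : ℝ → ℂ} {m F : ℂ → ℂ} {a b γ C Cm : ℝ}
    (ha : a < 0) (h0γ : 0 ≤ γ) (hγb : γ < b) (hUm : AEStronglyMeasurable U)
    (hU : ∀ t, ‖U t‖ ≤ C * (1 + Real.exp (γ * t)))
    (hG : ∀ β : ℂ, a ≤ β.re → β.re ≤ b → Integrable (fun t : ℝ => G t * Complex.exp (β * t)) ∧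
      ∫ t : ℝ, G t * Complex.exp (β * t) = F β)
    (hUG : ∀ r, ∫ t : ℝ, U t * G (t - r) = 0)
    (hψ : ContDiff ℝ ∞ ψ) (hs : HasCompactSupport ψ)
    (hm : ∀ β : ℂ, a ≤ β.re → β.re ≤ b → AnalyticAt ℂ m β)
    (hmF : ∀ β : ℂ, a ≤ β.re → β.re ≤ b → m β * F β = laplace ψ β)
    (hmb : ∀ β : ℂ, a ≤ β.re → β.re ≤ b → ‖m β‖ ≤ Cm * (1 + β.im ^ 2)⁻¹) :
    ∫ t : ℝ, U t * ψ t = 0 := by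
  have hab : a < b := by linarith
  have hCm : 0 ≤ Cm := by
    have := (norm_nonneg _).trans (hmb a (by simp) (by simpa using hab.le))
    simpa using this
  have hcont : ∀ σ, a ≤ σ → σ ≤ b → Continuous fun τ : ℝ => m (σ + τ * Complex.I) := by
    intro σ h1 h2
    refine continuous_iff_continuousAt.2 fun τ => ?_
    exact ContinuousAt.comp (f := fun τ : ℝ => (σ + τ * Complex.I : ℂ))
      (hm _ (by simpa) (by simpa)).continuousAt (by fun_prop)
  have hmint : ∀ σ, a ≤ σ → σ ≤ b → Integrable fun τ : ℝ => m (σ + τ * Complex.I) := by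
    intro σ h1 h2
    refine Integrable.mono' (integrable_inv_one_add_sq.const_mul Cm)
      (hcont σ h1 h2).aestronglyMeasurable (Eventually.of_forall fun τ => ?_)
    have := hmb (σ + τ * Complex.I) (by simpa) (by simpa)
    simpa using this
  -- the inverse transform of the quotient
  set k : ℝ → ℂ := fun t => (1 / (2 * Real.pi) : ℂ) *
    ∫ τ : ℝ, m (a + τ * Complex.I) * Complex.exp (-(a + τ * Complex.I) * t) with hk
  -- The contour may be moved from one edge of the strip to the other, so k satisfies the
  -- exponential bounds of both edges.
  have hkσ : ∀ t, k t = (1 / (2 * Real.pi) : ℂ) *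
      ∫ τ : ℝ, m (b + τ * Complex.I) * Complex.exp (-(b + τ * Complex.I) * t) := by
    intro t
    simp only [hk]
    congr 1
    have hexp : ∀ β : ℂ, a ≤ β.re → β.re ≤ b →
        ‖Complex.exp (-β * t)‖ ≤ Real.exp (max |a| |b| * |t|) := by
      intro β h1 h2
      rw [Complex.norm_exp]
      refine Real.exp_le_exp.2 ((le_abs_self _).trans ?_)
      simp only [Complex.mul_re, Complex.neg_re, Complex.ofReal_re, Complex.ofReal_im, mul_zero,
        sub_zero]
      rw [abs_mul, abs_neg]
      exact mul_le_mul_of_nonneg_right (abs_le_max_abs_abs h1 h2) (abs_nonneg t)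
    refine integral_vertical_eq (h := fun β => m β * Complex.exp (-β * t)) (a := a) (b := b)
      (C := Cm * Real.exp (max |a| |b| * |t|)) hab.le (fun β h1 h2 => ?_) (fun β h1 h2 => ?_)
    · exact (hm β h1 h2).mul (by fun_prop)
    · rw [norm_mul]
      refine (mul_le_mul (hmb β h1 h2) (hexp β h1 h2) (norm_nonneg _)
        ((norm_nonneg _).trans (hmb β h1 h2))).trans (le_of_eq ?_)
      ring
  set J := (2 * Real.pi)⁻¹ * ∫ τ : ℝ, Cm * (1 + τ ^ 2)⁻¹ with hJ
  have hJ0 : 0 ≤ J := by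
    have : 0 ≤ ∫ τ : ℝ, Cm * (1 + τ ^ 2)⁻¹ := integral_nonneg fun τ => by
      simp only [Pi.zero_apply]; positivity
    positivity
  have hkb : ∀ σ, a ≤ σ → σ ≤ b → ∀ t : ℝ, ‖(1 / (2 * Real.pi) : ℂ) *
      ∫ τ : ℝ, m (σ + τ * Complex.I) * Complex.exp (-(σ + τ * Complex.I) * t)‖ ≤
      J * Real.exp (-(σ * t)) := by
    intro σ h1 h2 t
    have e1 : ‖(1 / (2 * Real.pi) : ℂ)‖ = (2 * Real.pi)⁻¹ := by
      rw [one_div, norm_inv]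
      have : ((2 * Real.pi : ℝ) : ℂ) = 2 * Real.pi := by push_cast; rfl
      rw [← this, Complex.norm_real, Real.norm_of_nonneg (by positivity)]
    rw [norm_mul, e1, hJ, mul_assoc, ← integral_mul_const]
    refine mul_le_mul_of_nonneg_left ?_ (by positivity)
    refine norm_integral_le_of_norm_le ((integrable_inv_one_add_sq.const_mul Cm).mul_const _)
      (Eventually.of_forall fun τ => ?_)
    have := hmb (σ + τ * Complex.I) (by simpa) (by simpa)
    rw [norm_mul, Complex.norm_exp]
    simp at this ⊢
    exact mul_le_mul_of_nonneg_right this (Real.exp_pos _).le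
  have hka : ∀ t, ‖k t‖ ≤ J * Real.exp (-(a * t)) := fun t => hkb a le_rfl hab.le t
  have hkb' : ∀ t, ‖k t‖ ≤ J * Real.exp (-(b * t)) := fun t => by
    rw [hkσ]; exact hkb b hab.le le_rfl t
  have hkm : AEStronglyMeasurable k := by
    have hc := hcont a le_rfl hab.le
    have : StronglyMeasurable fun t : ℝ =>
        ∫ τ : ℝ, m (a + τ * Complex.I) * Complex.exp (-(a + τ * Complex.I) * t) := by
      refine StronglyMeasurable.integral_prod_right (f := fun t τ : ℝ =>
        m (a + τ * Complex.I) * Complex.exp (-(a + τ * Complex.I) * t)) ?_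
      apply Continuous.stronglyMeasurable
      simp only [Function.uncurry_def]
      exact (hc.comp continuous_snd).mul (by fun_prop)
    exact (this.const_mul _).aestronglyMeasurable
  have hGi : ∀ γ' : ℝ, a ≤ γ' → γ' ≤ b → Integrable fun t : ℝ => (Real.exp (γ' * t) : ℂ) * G t := by
    intro γ' h1 h2
    refine (hG γ' (by simpa) (by simpa)).1.congr (Eventually.of_forall fun t => ?_)
    simp only
    push_cast; ring
  have hki : ∀ γ' : ℝ, a < γ' → γ' < b → Integrable fun t : ℝ => (Real.exp (γ' * t) : ℂ) * k t :=
    fun γ' h1 h2 => integrable_exp_mul_of_norm_le hkm hJ0 h1 h2 hka hkb'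
  -- The weight e^{γ't} factors along t = r + (t-r), so this is the convolution integrand of two
  -- weighted integrable functions.
  have hprod : ∀ γ' : ℝ, a < γ' → γ' < b → Integrable (fun p : ℝ × ℝ =>
      (Real.exp (γ' * p.1) : ℂ) * (k p.2 * G (p.1 - p.2))) (volume.prod volume) := by
    intro γ' h1 h2
    have := (hki γ' h1 h2).convolution_integrand (ContinuousLinearMap.mul ℂ ℂ) (hGi γ' h1.le h2.le)
    refine this.congr (Eventually.of_forall fun p => ?_)
    simp only [ContinuousLinearMap.mul_apply']
    rw [show (Real.exp (γ' * p.2) : ℂ) * k p.2 * ((Real.exp (γ' * (p.1 - p.2)) : ℂ) * G (p.1 - p.2)) =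
      ((Real.exp (γ' * p.2) : ℂ) * (Real.exp (γ' * (p.1 - p.2)) : ℂ)) * (k p.2 * G (p.1 - p.2)) by ring,
      ← Complex.ofReal_mul, ← Real.exp_add]
    ring_nf
  -- the test function is the convolution of `k` with the kernel
  have hconv : ∀ t, ∫ r : ℝ, k r * G (t - r) = ψ t := by
    intro t
    set H : ℝ × ℝ → ℂ := fun p => (m (a + p.1 * Complex.I) * Complex.exp (-(a + p.1 * Complex.I) * p.2)) *
      G (t - p.2) with hH
    have hGt : Integrable fun r : ℝ => (Real.exp (a * (t - r)) : ℂ) * G (t - r) :=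
      (hGi a le_rfl hab.le).comp_sub_left t
    have hHi : Integrable H (volume.prod volume) := by
      have h1 := ((hmint a le_rfl hab.le).mul_prod hGt).const_mul (Complex.exp (-(a * t)))
      refine (h1.bdd_mul (c := 1) (f := fun p : ℝ × ℝ => Complex.exp (-(p.1 * Complex.I) * p.2))
        (Continuous.aestronglyMeasurable (by fun_prop)) (Eventually.of_forall fun p => ?_)).congr
        (Eventually.of_forall fun p => ?_)
      · rw [Complex.norm_exp]; simp
      · simp only [hH]
        rw [show Complex.exp (-(p.1 * Complex.I) * p.2) * (Complex.exp (-(a * t)) *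
          (m (a + p.1 * Complex.I) * ((Real.exp (a * (t - p.2)) : ℂ) * G (t - p.2)))) =
          m (a + p.1 * Complex.I) * (Complex.exp (-(p.1 * Complex.I) * p.2) * (Complex.exp (-(a * t)) *
          (Real.exp (a * (t - p.2)) : ℂ))) * G (t - p.2) by ring, Complex.ofReal_exp, ← Complex.exp_add,
          ← Complex.exp_add]
        congr 3
        push_cast; ring
    have e1 : (fun r : ℝ => k r * G (t - r)) = fun r : ℝ => (1 / (2 * Real.pi) : ℂ) *
        ∫ τ : ℝ, H (τ, r) := by
      ext r
      simp only [hk, hH]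
      rw [integral_mul_const]
      ring
    rw [e1, integral_const_mul, ← integral_integral_swap (f := fun τ r => H (τ, r)) hHi,
      ← (laplace_inversion hψ hs a t).2]
    congr 2
    ext τ
    rw [← hmF _ (by simp) (by simpa using hab.le), ← (hG _ (by simp) (by simpa using hab.le)).2]
    simp only [hH]
    rw [mul_assoc (m _), mul_comm (∫ t : ℝ, _) (Complex.exp _), ← integral_const_mul,
      ← integral_sub_left_eq_self (fun r : ℝ => Complex.exp (-(a + τ * Complex.I) * t) *
        (G r * Complex.exp ((a + τ * Complex.I) * r))) volume t, ← integral_const_mul]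
    congr 1
    ext r
    rw [mul_assoc]
    congr 1
    rw [mul_left_comm, ← Complex.exp_add, mul_comm]
    congr 2
    push_cast; ring
  -- U is dominated by the weights e^{0·t} and e^{γt}. Both exponents lie in the open interval (a,
  -- b), which is why the strip has to reach to the left of the imaginary axis.
  have hfinal : Integrable (fun p : ℝ × ℝ => U p.1 * (k p.2 * G (p.1 - p.2))) (volume.prod volume) := by
    have h1 := hprod 0 ha (by linarith)
    have h2 := hprod γ (by linarith) hγb
    have h3 : AEStronglyMeasurable (fun p : ℝ × ℝ => k p.2 * G (p.1 - p.2)) (volume.prod volume) := by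
      refine h1.aestronglyMeasurable.congr (Eventually.of_forall fun p => ?_)
      simp
    refine ((h1.norm.add h2.norm).const_mul C).mono' (hUm.comp_fst.mul h3)
      (Eventually.of_forall fun p => ?_)
    simp only [Pi.add_apply]
    rw [norm_mul, norm_mul (Real.exp _ : ℂ), norm_mul (Real.exp _ : ℂ), Complex.norm_real,
      Complex.norm_real, Real.norm_of_nonneg (Real.exp_pos _).le,
      Real.norm_of_nonneg (Real.exp_pos _).le, zero_mul, Real.exp_zero, one_mul]
    refine (mul_le_mul_of_nonneg_right (hU p.1) (norm_nonneg _)).trans (le_of_eq ?_)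
    ring
  have e2 : (fun t : ℝ => U t * ψ t) = fun t => ∫ r : ℝ, U t * (k r * G (t - r)) := by
    ext t
    rw [integral_const_mul, hconv]
  rw [e2, integral_integral_swap (f := fun t r => U t * (k r * G (t - r))) hfinal]
  have e3 : ∀ r : ℝ, ∫ t : ℝ, U t * (k r * G (t - r)) = 0 := by
    intro r
    have : (fun t : ℝ => U t * (k r * G (t - r))) = fun t => k r * (U t * G (t - r)) := by
      ext t; ring
    rw [this, integral_const_mul, hUG, mul_zero]
  simp [e3]

end ConvolutionEquation

/-! ### Lower bounds for the multiplier -/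

section GammaBounds

theorem norm_sin_sq (z : ℂ) : ‖Complex.sin z‖ ^ 2 = Real.sin z.re ^ 2 + Real.sinh z.im ^ 2 := by
  have e : Complex.sin z = ((Real.sin z.re * Real.cosh z.im : ℝ) : ℂ) +
      ((Real.cos z.re * Real.sinh z.im : ℝ) : ℂ) * Complex.I := by
    rw [Complex.sin_eq]; push_cast; rfl
  rw [← Complex.normSq_eq_norm_sq, e, Complex.normSq_add_mul_I]
  have h1 := Real.sin_sq_add_cos_sq z.re
  have h2 := Real.cosh_sq z.im
  rw [mul_pow, mul_pow, h2]
  linear_combination Real.sinh z.im ^ 2 * h1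

theorem abs_sinh_le_norm_sin (z : ℂ) : |Real.sinh z.im| ≤ ‖Complex.sin z‖ := by
  rw [← abs_norm, ← sq_le_sq, norm_sin_sq]
  linarith [sq_nonneg (Real.sin z.re)]

theorem norm_sin_le_cosh (z : ℂ) : ‖Complex.sin z‖ ≤ Real.cosh z.im := by
  refine (sq_le_sq₀ (norm_nonneg _) (Real.cosh_pos _).le).1 ?_
  rw [norm_sin_sq, Real.cosh_sq]
  linarith [Real.sin_sq_le_one z.re]

theorem cosh_le_two_mul_abs_sinh {x : ℝ} (hx : 1 ≤ |x|) : Real.cosh x ≤ 2 * |Real.sinh x| := by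
  rw [← Real.cosh_abs, Real.abs_sinh]
  have h1 : 2 ≤ Real.exp |x| := by linarith [Real.add_one_le_exp |x|]
  have h2 : Real.exp (-|x|) ≤ 2⁻¹ := by
    rw [Real.exp_neg]; exact inv_anti₀ two_pos h1
  rw [Real.cosh_eq, Real.sinh_eq]
  linarith

theorem norm_Gamma_le {z : ℂ} (hz : 0 < z.re) : ‖Complex.Gamma z‖ ≤ Real.Gamma z.re := by
  rw [Complex.Gamma_eq_integral hz, Real.Gamma_eq_integral hz, Complex.GammaIntegral]
  refine norm_integral_le_of_norm_le (Real.GammaIntegral_convergent hz) ?_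
  refine (ae_restrict_iff' measurableSet_Ioi).2 (Eventually.of_forall fun x hx => ?_)
  rw [norm_mul, Complex.norm_cpow_eq_rpow_re_of_pos hx, Complex.norm_real,
    Real.norm_of_nonneg (Real.exp_pos _).le]
  simp

theorem exists_norm_betaIntegral_le {x q : ℝ} (hx : 0 < x) (hq : 0 < q) :
    ∃ B : ℝ, ∀ p : ℂ, x ≤ p.re → ‖Complex.betaIntegral p q‖ ≤ B := by
  refine ⟨∫ r in Ioo (0 : ℝ) 1, r ^ (x - 1) * (1 - r) ^ (q - 1), fun p hp => ?_⟩
  rw [betaIntegral_eq_integral_Ioo]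
  refine norm_integral_le_of_norm_le (integrableOn_betaIntegrand_real hx hq) ?_
  refine (ae_restrict_iff' measurableSet_Ioo).2 (Eventually.of_forall fun r hr => ?_)
  have e : (1 - (r : ℂ)) = ((1 - r : ℝ) : ℂ) := by push_cast; rfl
  have h1 : 0 < 1 - r := by linarith [hr.2]
  rw [norm_mul, Complex.norm_cpow_eq_rpow_re_of_pos hr.1, e, Complex.norm_cpow_eq_rpow_re_of_pos h1]
  simp only [Complex.sub_re, Complex.ofReal_re, Complex.one_re]
  gcongr ?_ * _
  exact Real.rpow_le_rpow_of_exponent_ge hr.1 hr.2.le (by linarith)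

/-- From Γ(p)Γ(q) = Γ(p+q)B(p,q): the Beta factor is bounded uniformly on Re p ≥ x, which replaces
asymptotics of Stirling type. -/
theorem exists_le_norm_Gamma_add {x q : ℝ} (hx : 0 < x) (hq : 0 < q) :
    ∃ c : ℝ, 0 < c ∧ ∀ p : ℂ, x ≤ p.re → c * ‖Complex.Gamma p‖ ≤ ‖Complex.Gamma (p + q)‖ := by
  obtain ⟨B, hB⟩ := exists_norm_betaIntegral_le hx hq
  have hB1 : ∀ p : ℂ, x ≤ p.re → ‖Complex.betaIntegral p q‖ ≤ |B| + 1 := fun p hp =>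
    (hB p hp).trans (by linarith [le_abs_self B])
  have hG := Real.Gamma_pos_of_pos hq
  refine ⟨Real.Gamma q / (|B| + 1), by positivity, fun p hp => ?_⟩
  have h := congrArg norm (Complex.Gamma_mul_Gamma_eq_betaIntegral (s := p) (t := q) (by linarith)
    (by simpa))
  rw [norm_mul, norm_mul, Complex.Gamma_ofReal, Complex.norm_real, Real.norm_of_nonneg hG.le] at h
  rw [div_mul_eq_mul_div, div_le_iff₀ (by positivity), mul_comm, h]
  exact mul_le_mul_of_nonneg_left (hB1 p hp) (norm_nonneg _)

/-- Lower bound for a quotient of Gamma functions in a strip, away from the real axis. -/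
theorem exists_le_norm_Gamma_mul_sin {s : ℝ} (hs0 : 0 < s) (hs1 : s < 1) :
    ∃ c : ℝ, 0 < c ∧ ∀ β : ℂ, -1 < β.re → β.re < 2 * s → 1 ≤ |β.im| →
      c ≤ ‖Complex.Gamma (1 + β) * Complex.Gamma (2 * s - β) * Complex.sin (Real.pi * (s - β))‖ := by
  obtain ⟨c, hc, hΓ⟩ := exists_le_norm_Gamma_add (x := 2 - 2 * s) (q := 2 * s) (by linarith)
    (by linarith)
  refine ⟨Real.pi * 2⁻¹ * (c * 25⁻¹), by positivity, fun β h1 h2 h3 => ?_⟩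
  -- Chosen so that Γ(2s-β)Γ(w) = π/sin(π(2s-β)). The claim becomes a lower bound for |Γ(1+β)/Γ(w)|,
  -- two arguments that differ by 2s.
  set w : ℂ := 1 + β - 2 * s with hw
  have hwre : w.re = 1 + β.re - 2 * s := by simp [hw]
  have hwim : w.im = β.im := by simp [hw]
  have hne : ∀ z : ℂ, z.im = β.im → z ≠ 0 := by
    rintro z hz rfl
    rw [Complex.zero_im] at hz
    rw [← hz] at h3
    norm_num at h3
  have hsin : ∀ r : ℝ, (Real.pi * (r - β) : ℂ).im = -(Real.pi * β.im) := by intro r; simp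
  have hpi : 1 ≤ |(-(Real.pi * β.im))| := by
    rw [abs_neg, abs_mul, abs_of_pos Real.pi_pos]
    nlinarith [Real.pi_gt_three]
  have hS1 := abs_sinh_le_norm_sin (Real.pi * (s - β))
  have hS2 := norm_sin_le_cosh (Real.pi * ((2 * s : ℝ) - β))
  have hS3 := abs_sinh_le_norm_sin (Real.pi * ((2 * s : ℝ) - β))
  rw [hsin] at hS1 hS2 hS3
  have hch := cosh_le_two_mul_abs_sinh hpi
  have hcp := Real.cosh_pos (-(Real.pi * β.im))
  have hS2pos : 0 < ‖Complex.sin (Real.pi * ((2 * s : ℝ) - β))‖ := by linarith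
  -- reflection
  have hrefl := Complex.Gamma_mul_Gamma_one_sub (2 * s - β)
  rw [show 1 - (2 * s - β : ℂ) = w by rw [hw]; ring] at hrefl
  have hwΓ : Complex.Gamma w ≠ 0 := Complex.Gamma_ne_zero fun m hm => by
    have := hne w hwim
    have h := congrArg Complex.im hm
    rw [hwim] at h
    simp only [Complex.neg_im, Complex.natCast_im, neg_zero] at h
    rw [h] at h3
    norm_num at h3
  have e1 : Complex.Gamma (w + 2) = (w + 1) * (w * Complex.Gamma w) := by
    rw [show w + 2 = (w + 1) + 1 by ring, Complex.Gamma_add_one _ (hne _ (by simp [hwim])),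
      Complex.Gamma_add_one _ (hne _ hwim)]
  have e2 : Complex.Gamma (w + 2 + (2 * s : ℝ)) = (2 + β) * ((1 + β) * Complex.Gamma (1 + β)) := by
    rw [show w + 2 + (2 * s : ℝ) = ((1 + β) + 1) + 1 by rw [hw]; push_cast; ring,
      Complex.Gamma_add_one _ (hne _ (by simp)), Complex.Gamma_add_one _ (hne _ (by simp))]
    ring
  -- Only Re w > -2s is known, so the comparison is made after a shift by 2, where Re(w+2) ≥ 2-2s >
  -- 0 and w+2+2s = β+3.
  have h4 := hΓ (w + 2) (by simp [hwre]; linarith)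
  rw [e1, e2, norm_mul, norm_mul, norm_mul, norm_mul] at h4
  have hb : ∀ z : ℂ, z.im = β.im → |β.im| ≤ ‖z‖ := fun z hz => hz ▸ Complex.abs_im_le_norm z
  have hb1 := hb w hwim
  have hb2 := hb (w + 1) (by simp [hwim])
  have hu : ∀ a : ℝ, |a + β.re| ≤ 4 → ‖(a + β : ℂ)‖ ≤ 4 + |β.im| := by
    intro a ha
    refine (Complex.norm_le_abs_re_add_abs_im _).trans ?_
    simp only [Complex.add_re, Complex.ofReal_re, Complex.add_im, Complex.ofReal_im, zero_add]
    linarith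
  have hu1 := hu 1 (abs_le.2 ⟨by linarith, by linarith⟩)
  have hu2 := hu 2 (abs_le.2 ⟨by linarith, by linarith⟩)
  push_cast at hu1 hu2
  have hgw : 0 < ‖Complex.Gamma w‖ := norm_pos_iff.2 hwΓ
  -- The shift is undone: |w| and |w+1| are at least |Im β|, while |1+β| and |2+β| are at most 4+|Im
  -- β| ≤ 5|Im β|, whence 25.
  have h5 : c * ‖Complex.Gamma w‖ ≤ 25 * ‖Complex.Gamma (1 + β)‖ := by
    have hτ : 0 < |β.im| := by linarith
    have l1 : c * (|β.im| * (|β.im| * ‖Complex.Gamma w‖)) ≤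
        (5 * |β.im|) * ((5 * |β.im|) * ‖Complex.Gamma (1 + β)‖) := by
      calc c * (|β.im| * (|β.im| * ‖Complex.Gamma w‖)) ≤ c * (‖w + 1‖ * (‖w‖ * ‖Complex.Gamma w‖)) := by
            gcongr
        _ ≤ _ := h4
        _ ≤ _ := by gcongr <;> linarith
    have : (|β.im| * |β.im|) * (c * ‖Complex.Gamma w‖) ≤
      (|β.im| * |β.im|) * (25 * ‖Complex.Gamma (1 + β)‖) := by linarith
    exact le_of_mul_le_mul_left this (by positivity)
  have h6 : ‖Complex.Gamma (2 * s - β)‖ * ‖Complex.Gamma w‖ *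
      ‖Complex.sin (Real.pi * ((2 * s : ℝ) - β))‖ = Real.pi := by
    rw [← norm_mul, hrefl, norm_div, Complex.norm_real, Real.norm_of_nonneg Real.pi_pos.le]
    push_cast at hS2pos ⊢
    exact div_mul_cancel₀ _ hS2pos.ne'
  rw [norm_mul, norm_mul]
  calc Real.pi * 2⁻¹ * (c * 25⁻¹) = ‖Complex.Gamma (2 * s - β)‖ * ‖Complex.Gamma w‖ *
        ‖Complex.sin (Real.pi * ((2 * s : ℝ) - β))‖ * 2⁻¹ * (c * 25⁻¹) := by rw [h6]
    _ = ‖Complex.Gamma (2 * s - β)‖ * (c * ‖Complex.Gamma w‖ * 25⁻¹) *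
        (‖Complex.sin (Real.pi * ((2 * s : ℝ) - β))‖ * 2⁻¹) := by ring
    _ ≤ ‖Complex.Gamma (2 * s - β)‖ * ‖Complex.Gamma (1 + β)‖ *
        ‖Complex.sin (Real.pi * (s - β))‖ := by gcongr <;> linarith
    _ = _ := by ring

/-- The multiplier is bounded away from zero in vertical strips, away from the real axis. -/
theorem exists_le_norm_mellinMultiplier {s : ℝ} (hs0 : 0 < s) (hs1 : s < 1) {a b : ℝ} (ha : -1 < a)
    (hb : b < 2 * s) :
    ∃ T c : ℝ, 1 ≤ T ∧ 0 < c ∧ ∀ β : ℂ, a ≤ β.re → β.re ≤ b → T ≤ |β.im| →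
      c ≤ ‖mellinMultiplier s β‖ := by
  obtain ⟨c, hc, h⟩ := exists_le_norm_Gamma_mul_sin hs0 hs1
  obtain ⟨M, hM0, hM⟩ : ∃ M : ℝ, 0 ≤ M ∧ ∀ β : ℂ, a ≤ β.re → β.re ≤ b →
      ‖Complex.Gamma (1 + β) * Complex.Gamma (2 * s - β)‖ ≤ M := by
    have hcont : ContinuousOn (fun σ : ℝ => Real.Gamma (1 + σ) * Real.Gamma (2 * s - σ)) (Icc a b) := by
      refine ContinuousOn.mul ?_ ?_ <;> intro σ hσ
      · refine (ContinuousAt.comp (f := fun σ : ℝ => 1 + σ) (g := Real.Gamma)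
          (Real.differentiableAt_Gamma fun m => ?_).continuousAt (by fun_prop)).continuousWithinAt
        have : (0 : ℝ) ≤ m := m.cast_nonneg
        linarith [hσ.1]
      · refine (ContinuousAt.comp (f := fun σ : ℝ => 2 * s - σ) (g := Real.Gamma)
          (Real.differentiableAt_Gamma fun m => ?_).continuousAt (by fun_prop)).continuousWithinAt
        have : (0 : ℝ) ≤ m := m.cast_nonneg
        linarith [hσ.2]
    obtain ⟨M, hM⟩ := isCompact_Icc.exists_bound_of_continuousOn hcont
    refine ⟨|M|, abs_nonneg _, fun β h1 h2 => ?_⟩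
    rw [norm_mul]
    have g1 := norm_Gamma_le (z := 1 + β) (by simp; linarith)
    have g2 := norm_Gamma_le (z := 2 * s - β) (by simp; linarith)
    simp only [Complex.add_re, Complex.one_re, Complex.sub_re, Complex.mul_re, Complex.re_ofNat,
      Complex.ofReal_re, Complex.im_ofNat, Complex.ofReal_im, mul_zero, sub_zero] at g1 g2
    exact (mul_le_mul g1 g2 (norm_nonneg _) ((norm_nonneg _).trans g1)).trans
      ((le_abs_self _).trans ((hM _ ⟨h1, h2⟩).trans (le_abs_self _)))
  have hsin : 0 < Real.sin (Real.pi * s) :=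
    Real.sin_pos_of_pos_of_lt_pi (by positivity) (by nlinarith [Real.pi_pos])
  have hG := Real.Gamma_pos_of_pos (show 0 < 2 * s by linarith)
  have hG1 := Real.Gamma_pos_of_pos (show 0 < 1 + 2 * s by linarith)
  have hf := fracConst_pos hs0 hs1
  -- This height makes the Gamma term at most half of 1/sin(πs) once the growing sine has been
  -- factored out of the bracket.
  refine ⟨max 1 (2 * Real.sin (Real.pi * s) * M / (Real.Gamma (2 * s) * Real.pi)),
    fracConst s * (c / Real.Gamma (1 + 2 * s)) * (2 * Real.sin (Real.pi * s))⁻¹, le_max_left _ _,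
    by positivity, fun β h1 h2 h3 => ?_⟩
  have h4 := h β (by linarith) (by linarith) ((le_max_left _ _).trans h3)
  have h5 := (le_max_right _ _).trans h3
  have hS : Real.pi * |β.im| ≤ ‖Complex.sin (Real.pi * (s - β))‖ := by
    refine le_trans ?_ (abs_sinh_le_norm_sin _)
    have : (Real.pi * (s - β) : ℂ).im = -(Real.pi * β.im) := by simp
    rw [this, Real.abs_sinh, abs_neg, abs_mul, abs_of_pos Real.pi_pos]
    exact Real.self_le_sinh_iff.2 (by positivity)
  set P := Complex.Gamma (1 + β) * Complex.Gamma (2 * s - β) with hP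
  set S := Complex.sin (Real.pi * (s - β)) with hSdef
  have hτ : 1 ≤ |β.im| := (le_max_left _ _).trans h3
  have hSpos : 0 < ‖S‖ := lt_of_lt_of_le (by positivity) hS
  have hS0 : S ≠ 0 := norm_pos_iff.1 hSpos
  have e : mellinMultiplier s β = fracConst s * ((P * S) / (Real.Gamma (1 + 2 * s) : ℂ)) *
      ((Real.sin (Real.pi * s) : ℂ)⁻¹ - P / ((Real.Gamma (2 * s) : ℂ) * S)) := by
    rw [mellinMultiplier, ← hSdef, mul_comm (Complex.Gamma (2 * s - β)), ← hP]
    have g1 : Complex.Gamma (1 + 2 * s) = (Real.Gamma (1 + 2 * s) : ℂ) := by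
      rw [← Complex.Gamma_ofReal]; push_cast; rfl
    have g2 : Complex.Gamma (2 * s) = (Real.Gamma (2 * s) : ℂ) := by
      rw [← Complex.Gamma_ofReal]; push_cast; rfl
    have g3 : Complex.sin (Real.pi * s) = (Real.sin (Real.pi * s) : ℂ) := by push_cast; rfl
    rw [g1, g2, g3]
    have n1 : (Real.Gamma (1 + 2 * s) : ℂ) ≠ 0 := by exact_mod_cast hG1.ne'
    have n2 : (Real.Gamma (2 * s) : ℂ) ≠ 0 := by exact_mod_cast hG.ne'
    have n3 : (Real.sin (Real.pi * s) : ℂ) ≠ 0 := by exact_mod_cast hsin.ne'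
    field_simp
  have nrm : ∀ x : ℝ, 0 < x → ‖(x : ℂ)‖ = x := fun x hx => by
    rw [Complex.norm_real, Real.norm_of_nonneg hx.le]
  have hsmall : ‖P / ((Real.Gamma (2 * s) : ℂ) * S)‖ ≤ (2 * Real.sin (Real.pi * s))⁻¹ := by
    rw [norm_div, norm_mul (Real.Gamma (2 * s) : ℂ), nrm _ hG, div_le_iff₀ (by positivity), inv_mul_eq_div, le_div_iff₀
      (by positivity)]
    rw [div_le_iff₀ (by positivity)] at h5
    have := hM β h1 h2
    nlinarith [mul_le_mul_of_nonneg_left hS hG.le]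
  rw [e, norm_mul, norm_mul, norm_div, nrm _ hf, nrm _ hG1]
  have hl : (2 * Real.sin (Real.pi * s))⁻¹ ≤
      ‖(Real.sin (Real.pi * s) : ℂ)⁻¹ - P / ((Real.Gamma (2 * s) : ℂ) * S)‖ := by
    have := norm_sub_norm_le (Real.sin (Real.pi * s) : ℂ)⁻¹ (P / ((Real.Gamma (2 * s) : ℂ) * S))
    rw [norm_inv, nrm _ hsin] at this
    have e2 : (Real.sin (Real.pi * s))⁻¹ = 2 * (2 * Real.sin (Real.pi * s))⁻¹ := by
      rw [mul_inv]; ring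
    linarith
  gcongr

/-- On the imaginary axis the multiplier vanishes at most at the origin. -/
theorem mellinMultiplier_ne_zero_of_re_eq_zero {s : ℝ} (hs0 : 0 < s) (hs1 : s < 1) {β : ℂ}
    (hre : β.re = 0) (hβ : β ≠ 0) : mellinMultiplier s β ≠ 0 := by
  have him : β.im ≠ 0 := fun h => hβ (Complex.ext hre h)
  have hsin : 0 < Real.sin (Real.pi * s) :=
    Real.sin_pos_of_pos_of_lt_pi (by positivity) (by nlinarith [Real.pi_pos])
  have hG := Real.Gamma_pos_of_pos (show 0 < 2 * s by linarith)
  have hf := fracConst_pos hs0 hs1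
  have g1 := norm_Gamma_le (z := 1 + β) (by simp [hre])
  have g2 := norm_Gamma_le (z := 2 * s - β) (by simp [hre]; linarith)
  simp only [Complex.add_re, Complex.one_re, Complex.sub_re, Complex.mul_re, Complex.re_ofNat,
    Complex.ofReal_re, Complex.im_ofNat, Complex.ofReal_im, mul_zero, sub_zero, hre, add_zero,
    Real.Gamma_one] at g1 g2
  have hΓ1 : Complex.Gamma (1 + β) ≠ 0 := Complex.Gamma_ne_zero_of_re_pos (by simp [hre])
  have hΓ2 : Complex.Gamma (2 * s - β) ≠ 0 :=
    Complex.Gamma_ne_zero_of_re_pos (by simp [hre]; linarith)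
  rw [mellinMultiplier]
  refine mul_ne_zero (mul_ne_zero (by exact_mod_cast hf.ne') (div_ne_zero (mul_ne_zero hΓ1 hΓ2)
    (Gamma_one_add_two_mul_ne_zero hs0))) fun h => ?_
  have h' := congrArg norm (sub_eq_zero.1 h)
  have e3 : ‖Complex.sin (Real.pi * s)‖ = Real.sin (Real.pi * s) := by
    rw [show Complex.sin (Real.pi * s) = (Real.sin (Real.pi * s) : ℂ) by push_cast; rfl,
      Complex.norm_real, Real.norm_of_nonneg hsin.le]
  have e4 : ‖Complex.Gamma (2 * s)‖ = Real.Gamma (2 * s) := by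
    rw [show Complex.Gamma (2 * s) = (Real.Gamma (2 * s) : ℂ) by
      rw [← Complex.Gamma_ofReal]; push_cast; rfl, Complex.norm_real, Real.norm_of_nonneg hG.le]
  rw [norm_div, norm_div, norm_mul, e3, e4] at h'
  -- On the imaginary axis |Γ(1+β)| ≤ Γ(1) = 1 and |Γ(2s-β)| ≤ Γ(2s), while |sin π(s-β)|² = sin²(πs)
  -- + sinh²(π Im β) is strictly larger than sin²(πs): the two terms of the bracket cannot balance.
  have hr : ‖Complex.Gamma (2 * s - β)‖ * ‖Complex.Gamma (1 + β)‖ / Real.Gamma (2 * s) ≤ 1 := by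
    rw [div_le_one hG]
    nlinarith [norm_nonneg (Complex.Gamma (2 * s - β)), norm_nonneg (Complex.Gamma (1 + β))]
  have hl : 1 < ‖Complex.sin (Real.pi * (s - β))‖ / Real.sin (Real.pi * s) := by
    rw [one_lt_div hsin]
    refine lt_of_pow_lt_pow_left₀ 2 (norm_nonneg _) ?_
    rw [norm_sin_sq]
    have r1 : (Real.pi * (s - β) : ℂ).re = Real.pi * s := by simp [hre]
    have r2 : (Real.pi * (s - β) : ℂ).im = -(Real.pi * β.im) := by simp
    rw [r1, r2, lt_add_iff_pos_right]
    have : Real.sinh (-(Real.pi * β.im)) ≠ 0 := by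
      rw [Ne, Real.sinh_eq_zero]; simpa using him
    positivity
  linarith

end GammaBounds

/-! ### Zeros of the transform of the image kernel -/

section ImageTransform

theorem analyticAt_Gamma {z : ℂ} (hz : 0 < z.re) : AnalyticAt ℂ Complex.Gamma z := by
  have hd : DifferentiableOn ℂ Complex.Gamma {z | 0 < z.re} := fun w hw =>
    (Complex.differentiableAt_Gamma w fun m hm => by
      have h0 : (0 : ℝ) < w.re := hw
      have := m.cast_nonneg (α := ℝ)
      rw [hm] at h0
      simp only [Complex.neg_re, Complex.natCast_re] at h0
      linarith).differentiableWithinAt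
  exact hd.analyticAt ((isOpen_lt continuous_const Complex.continuous_re).mem_nhds hz)

theorem analyticAt_mellinMultiplier {s : ℝ} {β : ℂ} (h1 : -1 < β.re) (h2 : β.re < 2 * s) :
    AnalyticAt ℂ (mellinMultiplier s) β := by
  have hΓ1 : AnalyticAt ℂ (fun β : ℂ => Complex.Gamma (1 + β)) β :=
    (analyticAt_Gamma (by simp; linarith)).comp (f := fun β : ℂ => 1 + β) (by fun_prop)
  have hΓ2 : AnalyticAt ℂ (fun β : ℂ => Complex.Gamma (2 * s - β)) β :=
    (analyticAt_Gamma (by simp; linarith)).comp (f := fun β : ℂ => 2 * s - β) (by fun_prop)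
  have hS : AnalyticAt ℂ (fun β : ℂ => Complex.sin (Real.pi * (s - β))) β :=
    (Complex.analyticAt_sin (x := Real.pi * (s - β))).comp
      (f := fun β : ℂ => Real.pi * (s - β)) (by fun_prop)
  unfold mellinMultiplier
  exact (analyticAt_const.mul ((hΓ1.mul hΓ2).mul analyticAt_const)).mul
    ((hS.mul analyticAt_const).sub ((hΓ2.mul hΓ1).mul analyticAt_const))

/-- The transform of the test function is the reciprocal of a polynomial of degree 4 without zeros
in this half-plane. It adds no zeros to the multiplier and costs exactly a factor |β|⁴ in lower
bounds. -/
theorem imageTransform_eq {s : ℝ} (hs1 : s < 1) {β : ℂ} (h1 : -1 < β.re) :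
    imageTransform s β = (6 / ((β - 2 * s + 8) * ((β - 2 * s + 7) * ((β - 2 * s + 6) *
      (β - 2 * s + 5))))) * mellinMultiplier s β := by
  have hre : ∀ r : ℝ, 5 ≤ r → 0 < (β - 2 * s + r).re := fun r hr => by
    simp; linarith
  have hne : ∀ r : ℝ, 5 ≤ r → (β - 2 * s + r) ≠ 0 := fun r hr h => by
    have := hre r hr
    rw [h] at this; simp at this
  have n5 := hne 5 (by norm_num)
  have n6 := hne 6 (by norm_num)
  have n7 := hne 7 (by norm_num)
  have n8 := hne 8 (by norm_num)
  have hΓ := Complex.Gamma_ne_zero_of_re_pos (hre 5 le_rfl)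
  push_cast at n5 n6 n7 n8 hΓ
  rw [imageTransform, show β - 2 * s + 9 = (β - 2 * s + 8) + 1 by ring, Complex.Gamma_add_one _ n8,
    show β - 2 * s + 8 = (β - 2 * s + 7) + 1 by ring, Complex.Gamma_add_one _ n7,
    show β - 2 * s + 7 = (β - 2 * s + 6) + 1 by ring, Complex.Gamma_add_one _ n6,
    show β - 2 * s + 6 = (β - 2 * s + 5) + 1 by ring, Complex.Gamma_add_one _ n5]
  rw [show β - 2 * s + 6 = (β - 2 * s + 5) + 1 by ring] at n6
  rw [show β - 2 * s + 7 = (β - 2 * s + 5) + 1 + 1 by ring] at n7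
  rw [show β - 2 * s + 8 = (β - 2 * s + 5) + 1 + 1 + 1 by ring] at n8
  field_simp

theorem analyticAt_imageTransform {s : ℝ} (hs1 : s < 1) {β : ℂ} (h1 : -1 < β.re)
    (h2 : β.re < 2 * s) : AnalyticAt ℂ (imageTransform s) β := by
  have hΓ : ∀ r : ℝ, 5 ≤ r → AnalyticAt ℂ (fun β : ℂ => Complex.Gamma (β - 2 * s + r)) β :=
    fun r hr => (analyticAt_Gamma (by simp; linarith)).comp (f := fun β : ℂ => β - 2 * s + r)
      (by fun_prop)
  have h5 := hΓ 5 le_rfl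
  have h9 := hΓ 9 (by norm_num)
  have h90 : Complex.Gamma (β - 2 * s + (9 : ℝ)) ≠ 0 :=
    Complex.Gamma_ne_zero_of_re_pos (by simp; linarith)
  push_cast at h5 h9 h90
  exact (analyticAt_mellinMultiplier h1 h2).mul ((h5.mul analyticAt_const).div h9 h90)

theorem imageTransform_eq_zero_iff {s : ℝ} (hs1 : s < 1) {β : ℂ} (h1 : -1 < β.re) :
    imageTransform s β = 0 ↔ mellinMultiplier s β = 0 := by
  have hΓ : ∀ r : ℝ, 5 ≤ r → Complex.Gamma (β - 2 * s + r) ≠ 0 := fun r hr =>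
    Complex.Gamma_ne_zero_of_re_pos (by simp; linarith)
  have h5 := hΓ 5 le_rfl
  have h9 := hΓ 9 (by norm_num)
  push_cast at h5 h9
  simp [imageTransform, h5, h9]

/-- In the strip `{-1 < Re β < 2s}` the symbol and the transform of the image kernel have the same
orders. -/
theorem meromorphicOrderAt_neumannSymbol {s : ℝ} (hs0 : 0 < s) (hs1 : s < 1) {β : ℂ}
    (h1 : -1 < β.re) :
    meromorphicOrderAt (neumannSymbol s) β = meromorphicOrderAt (imageTransform s) β := by
  have hΓ : ∀ r : ℝ, 5 ≤ r → AnalyticAt ℂ (fun β : ℂ => Complex.Gamma (β - 2 * s + r)) β :=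
    fun r hr => (analyticAt_Gamma (by simp; linarith)).comp (f := fun β : ℂ => β - 2 * s + r)
      (by fun_prop)
  have hΓ0 : ∀ r : ℝ, 5 ≤ r → Complex.Gamma (β - 2 * s + r) ≠ 0 := fun r hr =>
    Complex.Gamma_ne_zero_of_re_pos (by simp; linarith)
  have a5 := hΓ 5 le_rfl
  have a9 := hΓ 9 (by norm_num)
  have h5 := hΓ0 5 le_rfl
  have h9 := hΓ0 9 (by norm_num)
  push_cast at a5 a9 h5 h9
  have e1 : imageTransform s = (fun β : ℂ => Complex.Gamma (β - 2 * s + 5) * 6 /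
      Complex.Gamma (β - 2 * s + 9)) * mellinMultiplier s := by
    ext z; simp only [Pi.mul_apply, imageTransform]; ring
  have aq : AnalyticAt ℂ (fun β : ℂ => Complex.Gamma (β - 2 * s + 5) * 6 /
      Complex.Gamma (β - 2 * s + 9)) β := (a5.mul analyticAt_const).div a9 h9
  rw [e1, meromorphicOrderAt_mul_of_ne_zero aq
    (div_ne_zero (mul_ne_zero h5 (by norm_num)) h9)]
  have hc : Complex.sin (Real.pi * s) * Complex.Gamma (1 + 2 * s) / (Real.pi * fracConst s) ≠ 0 := by
    refine div_ne_zero (mul_ne_zero (sin_pi_mul_ofReal_ne_zero hs0 hs1)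
      (Gamma_one_add_two_mul_ne_zero hs0)) (mul_ne_zero ?_ ?_)
    · exact_mod_cast Real.pi_ne_zero
    · exact_mod_cast (fracConst_pos hs0 hs1).ne'
  rw [← meromorphicOrderAt_mul_of_ne_zero (f := mellinMultiplier s)
    (analyticAt_const (v := Complex.sin (Real.pi * s) * Complex.Gamma (1 + 2 * s) /
      (Real.pi * fracConst s))) hc]
  refine meromorphicOrderAt_congr ?_
  have hsin : ∀ᶠ z in 𝓝[≠] β, Complex.sin (Real.pi * (z - 2 * s)) ≠ 0 := by
    have han : AnalyticOnNhd ℂ (fun z : ℂ => Complex.sin (Real.pi * (z - 2 * s))) univ := fun z _ =>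
      (Complex.analyticAt_sin (x := Real.pi * (z - 2 * s))).comp
        (f := fun z : ℂ => Real.pi * (z - 2 * s)) (by fun_prop)
    rcases (han β trivial).eventually_eq_zero_or_eventually_ne_zero with h | h
    · have h0 := han.eqOn_zero_of_preconnected_of_eventuallyEq_zero isPreconnected_univ trivial h
      have := h0 (mem_univ (2 * s + 1 / 2 : ℂ))
      simp only [Pi.zero_apply] at this
      rw [show (Real.pi : ℂ) * (2 * s + 1 / 2 - 2 * s) = Real.pi / 2 by ring,
        Complex.sin_pi_div_two] at this
      exact absurd this one_ne_zero
    · exact h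
  filter_upwards [hsin] with z hz
  rw [neumannSymbol_eq hs0 hs1 hz]
  rfl

theorem exists_le_norm_imageTransform {s : ℝ} (hs0 : 0 < s) (hs1 : s < 1) {a b : ℝ} (ha : -1 < a)
    (hb : b < 2 * s) :
    ∃ T c : ℝ, 1 ≤ T ∧ 0 < c ∧ ∀ β : ℂ, a ≤ β.re → β.re ≤ b → T ≤ |β.im| →
      c ≤ ‖β‖ ^ 4 * ‖imageTransform s β‖ := by
  obtain ⟨T, c, hT, hc, h⟩ := exists_le_norm_mellinMultiplier hs0 hs1 ha hb
  refine ⟨T, 6 / 9 ^ 4 * c, hT, by positivity, fun β h1 h2 h3 => ?_⟩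
  have hβ : 1 ≤ ‖β‖ := hT.trans (h3.trans (Complex.abs_im_le_norm β))
  rw [imageTransform_eq hs1 (by linarith), norm_mul, norm_div, norm_mul, norm_mul, norm_mul]
  -- |β + (r-2s)| ≤ |β| + 8 ≤ 9|β|, because |β| ≥ 1 at this height.
  have hre : ∀ r : ℝ, 5 ≤ r → r ≤ 8 → 0 < ‖(β - 2 * s + r)‖ ∧ ‖(β - 2 * s + r)‖ ≤ 9 * ‖β‖ := by
    intro r hr hr'
    refine ⟨norm_pos_iff.2 fun h => ?_, ?_⟩
    · have h := congrArg Complex.re h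
      simp at h
      linarith
    · calc ‖(β - 2 * s + r)‖ = ‖β + ((r - 2 * s : ℝ) : ℂ)‖ := by congr 1; push_cast; ring
        _ ≤ ‖β‖ + |r - 2 * s| := by
          refine (norm_add_le _ _).trans ?_
          rw [Complex.norm_real, Real.norm_eq_abs]
        _ ≤ 9 * ‖β‖ := by
          rw [abs_of_nonneg (by linarith)]; linarith
  obtain ⟨p5, q5⟩ := hre 5 (by norm_num) (by norm_num)
  obtain ⟨p6, q6⟩ := hre 6 (by norm_num) (by norm_num)
  obtain ⟨p7, q7⟩ := hre 7 (by norm_num) (by norm_num)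
  obtain ⟨p8, q8⟩ := hre 8 (by norm_num) (by norm_num)
  push_cast at p5 q5 p6 q6 p7 q7 p8 q8
  have hm := h β h1 h2 h3
  have hprod : ‖β - 2 * s + 8‖ * (‖β - 2 * s + 7‖ * (‖β - 2 * s + 6‖ * ‖β - 2 * s + 5‖)) ≤
      9 ^ 4 * ‖β‖ ^ 4 := by
    calc _ ≤ (9 * ‖β‖) * ((9 * ‖β‖) * ((9 * ‖β‖) * (9 * ‖β‖))) := by gcongr
      _ = _ := by ring
  have h6 : ‖(6 : ℂ)‖ = 6 := by norm_num
  rw [h6]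
  have : 6 / 9 ^ 4 ≤ ‖β‖ ^ 4 * (6 / (‖β - 2 * s + 8‖ * (‖β - 2 * s + 7‖ * (‖β - 2 * s + 6‖ *
      ‖β - 2 * s + 5‖)))) := by
    rw [← mul_div_assoc, div_le_div_iff₀ (by norm_num) (by positivity)]
    nlinarith
  calc 6 / 9 ^ 4 * c ≤ _ := mul_le_mul this hm hc.le (by positivity)
    _ = _ := by ring

/-- A zero of infinite order would force vanishing on the whole connected strip, against the lower
bound high on the imaginary axis. -/
theorem analyticOrderAt_imageTransform_ne_top {s : ℝ} (hs0 : 0 < s) (hs1 : s < 1) {β : ℂ}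
    (h1 : -1 < β.re) (h2 : β.re < 2 * s) : analyticOrderAt (imageTransform s) β ≠ ⊤ := by
  intro h
  rw [analyticOrderAt_eq_top] at h
  have hconv : Convex ℝ {z : ℂ | -1 < z.re ∧ z.re < 2 * s} :=
    (convex_halfSpace_re_gt (-1)).inter (convex_halfSpace_re_lt (2 * s))
  have han : AnalyticOnNhd ℂ (imageTransform s) {z : ℂ | -1 < z.re ∧ z.re < 2 * s} := fun z hz =>
    analyticAt_imageTransform hs1 hz.1 hz.2
  have h0 := han.eqOn_zero_of_preconnected_of_eventuallyEq_zero hconv.isPreconnected ⟨h1, h2⟩ h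
  obtain ⟨T, c, hT, hc, hl⟩ := exists_le_norm_imageTransform hs0 hs1 (a := 0) (b := 0) (by norm_num)
    (by linarith)
  have hz := h0 (show ((0 : ℝ) + T * Complex.I : ℂ) ∈ {z : ℂ | -1 < z.re ∧ z.re < 2 * s} by
    constructor <;> simp; exact hs0)
  have hl := hl ((0 : ℝ) + T * Complex.I) (by simp) (by simp) (by simpa using le_abs_self T)
  rw [hz] at hl
  simp at hl
  linarith

/-- The lower bound confines the zeros to a compact rectangle, where infinitely many would
accumulate at a zero of infinite order. -/
theorem finite_zeros_imageTransform {s : ℝ} (hs0 : 0 < s) (hs1 : s < 1) {a b : ℝ} (ha : -1 < a)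
    (hb : b < 2 * s) : {β : ℂ | a ≤ β.re ∧ β.re ≤ b ∧ imageTransform s β = 0}.Finite := by
  obtain ⟨T, c, hT, hc, hl⟩ := exists_le_norm_imageTransform hs0 hs1 ha hb
  by_contra hinf
  have hsub : {β : ℂ | a ≤ β.re ∧ β.re ≤ b ∧ imageTransform s β = 0} ⊆ Icc a b ×ℂ Icc (-T) T := by
    rintro β ⟨h1, h2, h3⟩
    refine ⟨⟨h1, h2⟩, abs_le.1 ?_⟩
    by_contra! h
    have := hl β h1 h2 h.le
    rw [h3, norm_zero, mul_zero] at this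
    linarith
  obtain ⟨z, hz, hacc⟩ := Set.Infinite.exists_accPt_of_subset_isCompact hinf
    (isCompact_Icc.reProdIm isCompact_Icc) hsub
  have hre : a ≤ z.re ∧ z.re ≤ b := hz.1
  have hfreq := accPt_iff_frequently_nhdsNE.1 hacc
  rcases (analyticAt_imageTransform (β := z) hs1 (by linarith)
    (by linarith)).eventually_eq_zero_or_eventually_ne_zero with h | h
  · exact analyticOrderAt_imageTransform_ne_top hs0 hs1 (β := z) (by linarith) (by linarith)
      (analyticOrderAt_eq_top.2 h)
  · exact hfreq (h.mono fun w hw hw' => hw hw'.2.2)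

/-- To the left of the imaginary axis, and close to it, there are no zeros, and on the imaginary axis
the origin is the only candidate. -/
theorem exists_zeros_imageTransform_re_nonneg {s : ℝ} (hs0 : 0 < s) (hs1 : s < 1) :
    ∃ a : ℝ, -1 < a ∧ a < 0 ∧ ∀ β : ℂ, a ≤ β.re → β.re < 2 * s → imageTransform s β = 0 →
      β = 0 ∨ 0 < β.re := by
  have hfin := finite_zeros_imageTransform hs0 hs1 (a := -1 / 2) (b := 0) (by norm_num) (by linarith)
  have hfin' : ({β : ℂ | -1 / 2 ≤ β.re ∧ β.re ≤ 0 ∧ imageTransform s β = 0} ∩ {β | β.re < 0}).Finite :=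
    hfin.subset inter_subset_left
  -- Finitely many zeros lie to the left of the axis, so a can be placed between all of them and 0.
  have hev : ∀ᶠ a : ℝ in 𝓝[<] 0, ∀ β ∈ {β : ℂ | -1 / 2 ≤ β.re ∧ β.re ≤ 0 ∧ imageTransform s β = 0} ∩
      {β | β.re < 0}, β.re < a := by
    rw [hfin'.eventually_all]
    intro β hβ
    exact (eventually_gt_nhds hβ.2).filter_mono nhdsWithin_le_nhds
  have hev2 : ∀ᶠ a : ℝ in 𝓝[<] 0, -1 / 2 < a :=
    (eventually_gt_nhds (by norm_num)).filter_mono nhdsWithin_le_nhds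
  obtain ⟨a, ha1, ha2, ha3⟩ := (hev.and (hev2.and self_mem_nhdsWithin)).exists
  refine ⟨a, by linarith, ha3, fun β h1 h2 h3 => ?_⟩
  rcases lt_trichotomy β.re 0 with h | h | h
  · exact absurd (ha1 β ⟨⟨by linarith, h.le, h3⟩, h⟩) (not_lt.2 h1)
  · left
    by_contra hβ
    exact mellinMultiplier_ne_zero_of_re_eq_zero hs0 hs1 h hβ
      ((imageTransform_eq_zero_iff hs1 (by linarith)).1 h3)
  · exact Or.inr h

/-- Identifies the multiplicity of the meromorphic symbol with the analytic order of the function by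
which transforms are divided. -/
theorem natCast_symbolMult {s : ℝ} (hs0 : 0 < s) (hs1 : s < 1) {β : ℂ} (h1 : -1 < β.re)
    (h2 : β.re < 2 * s) : (symbolMult s β : ℕ∞) = analyticOrderAt (imageTransform s) β := by
  obtain ⟨n, hn⟩ := ENat.ne_top_iff_exists.1 (analyticOrderAt_imageTransform_ne_top hs0 hs1 h1 h2)
  rw [symbolMult, meromorphicOrderAt_neumannSymbol hs0 hs1 h1,
    (analyticAt_imageTransform hs1 h1 h2).meromorphicOrderAt_eq, ← hn]
  rfl

theorem isSymbolZero_of_imageTransform_eq_zero {s : ℝ} (hs0 : 0 < s) (hs1 : s < 1) {β : ℂ}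
    (h1 : -1 < β.re) (h2 : β.re < 2 * s) (h : imageTransform s β = 0) : IsSymbolZero s β := by
  have han := analyticAt_imageTransform hs1 h1 h2
  obtain ⟨n, hn⟩ := ENat.ne_top_iff_exists.1 (analyticOrderAt_imageTransform_ne_top hs0 hs1 h1 h2)
  have hn0 : n ≠ 0 := by
    rintro rfl
    exact han.analyticOrderAt_ne_zero.2 h hn.symm
  rw [IsSymbolZero, meromorphicOrderAt_neumannSymbol hs0 hs1 h1, han.meromorphicOrderAt_eq, ← hn]
  have : (0 : WithTop ℤ) < ((n : ℤ) : WithTop ℤ) := by exact_mod_cast Nat.pos_of_ne_zero hn0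
  exact this

end ImageTransform

/-! ### Distributions vanishing on a common kernel -/

section FiniteSpan

/-- The space of complex-valued smooth compactly supported functions on the line. -/
def testFunctions : Submodule ℂ (ℝ → ℂ) where
  carrier := {ψ | ContDiff ℝ ∞ ψ ∧ HasCompactSupport ψ}
  add_mem' hf hg := ⟨hf.1.add hg.1, hf.2.add hg.2⟩
  zero_mem' := ⟨contDiff_const, HasCompactSupport.zero⟩
  smul_mem' c _ hf := ⟨hf.1.const_smul c, hf.2.smul_left (f := fun _ => c)⟩

theorem integrable_mul_testFunction {U ψ : ℝ → ℂ} (hU : LocallyIntegrable U)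
    (hψ : ψ ∈ testFunctions) : Integrable fun t => U t * ψ t := by
  refine (hU.integrable_smul_left_of_hasCompactSupport hψ.1.continuous hψ.2).congr
    (Eventually.of_forall fun t => ?_)
  simp only [smul_eq_mul, mul_comm]

/-- Integration against a locally integrable function, as a functional on test functions. -/
noncomputable def integralFunctional {U : ℝ → ℂ} (hU : LocallyIntegrable U) :
    testFunctions →ₗ[ℂ] ℂ where
  toFun ψ := ∫ t, U t * (ψ : ℝ → ℂ) t
  map_add' ψ χ := by
    rw [← integral_add (integrable_mul_testFunction hU ψ.2) (integrable_mul_testFunction hU χ.2)]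
    congr 1; ext t
    simp [mul_add]
  map_smul' c ψ := by
    rw [RingHom.id_apply, smul_eq_mul, ← integral_const_mul]
    congr 1; ext t
    simp [mul_left_comm]

/-- A distribution that vanishes on the common kernel of finitely many continuous functions is a
linear combination of them. -/
theorem ae_eq_sum_of_integral_eq_zero {κ : Type*} {U : ℝ → ℂ} (hU : LocallyIntegrable U)
    (S : Finset κ) {g : κ → ℝ → ℂ} (hg : ∀ k, Continuous (g k))
    (h : ∀ ψ : ℝ → ℂ, ContDiff ℝ ∞ ψ → HasCompactSupport ψ →
      (∀ k ∈ S, ∫ t, g k t * ψ t = 0) → ∫ t, U t * ψ t = 0) :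
    ∃ c : κ → ℂ, ∀ᵐ t, U t = ∑ k ∈ S, c k * g k t := by
  classical
  have hgl : ∀ k, LocallyIntegrable (g k) := fun k => (hg k).locallyIntegrable
  have hspan : integralFunctional hU ∈
      Submodule.span ℂ (range fun k : S => integralFunctional (hgl k)) := by
    -- Pure linear algebra: a functional that vanishes on the common kernel of finitely many
    -- functionals lies in their span, so no topology on test functions is needed.
    refine mem_span_of_iInf_ker_le_ker fun ψ hψ => ?_
    rw [Submodule.mem_iInf] at hψ
    exact h ψ ψ.2.1 ψ.2.2 fun k hk => hψ ⟨k, hk⟩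
  obtain ⟨c, hc⟩ := (Submodule.mem_span_range_iff_exists_fun ℂ).1 hspan
  refine ⟨fun k => if hk : k ∈ S then c ⟨k, hk⟩ else 0, ?_⟩
  set V : ℝ → ℂ := fun t => ∑ k ∈ S, (if hk : k ∈ S then c ⟨k, hk⟩ else 0) * g k t with hV
  have hVc : Continuous V := continuous_finsetSum _ fun k _ => continuous_const.mul (hg k)
  have hV' : ∀ t, V t = ∑ k : S, c k * g k t := fun t => by
    simp only [hV]
    rw [← Finset.sum_coe_sort S]
    exact Finset.sum_congr rfl fun k _ => by simp
  have hzero := ae_eq_zero_of_integral_contDiff_smul_eq_zero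
    (f := fun t => U t - V t) (hU.sub hVc.locallyIntegrable) fun χ hχ hχs => by
      have hψ : (fun t => (χ t : ℂ)) ∈ testFunctions :=
        ⟨Complex.ofRealCLM.contDiff.comp hχ, hχs.comp_left (g := fun x : ℝ => (x : ℂ)) (by simp)⟩
      have e := congrArg (fun F => F ⟨_, hψ⟩) hc
      simp only [LinearMap.coe_sum, Finset.sum_apply, LinearMap.smul_apply, smul_eq_mul] at e
      have e1 : integralFunctional hU ⟨_, hψ⟩ = ∫ t, U t * (χ t : ℂ) := rfl
      have e2 : ∀ k : S, integralFunctional (hgl k) ⟨_, hψ⟩ = ∫ t, g k t * (χ t : ℂ) := fun _ => rfl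
      rw [e1] at e
      simp only [e2] at e
      have e3 : (fun t => χ t • (U t - V t)) = fun t => U t * (χ t : ℂ) - V t * (χ t : ℂ) := by
        ext t; rw [Complex.real_smul]; ring
      rw [e3, integral_sub (integrable_mul_testFunction hU hψ)
        (integrable_mul_testFunction hVc.locallyIntegrable hψ), ← e, sub_eq_zero]
      simp only [hV', Finset.sum_mul, mul_assoc]
      rw [integral_finsetSum Finset.univ fun (k : S) _ =>
        (integrable_mul_testFunction (hgl k) hψ).const_mul (c k)]
      simp only [integral_const_mul]
  filter_upwards [hzero] with t ht
  exact sub_eq_zero.1 ht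

end FiniteSpan

/-! ### Decay of the quotient -/

section Quotient

/-- The quotient of the transform of a test function by the transform of the image kernel decays, as
soon as it is analytic. -/
theorem exists_norm_quotient_le {s : ℝ} (hs0 : 0 < s) (hs1 : s < 1) {a b : ℝ} (ha : -1 < a)
    (hb : b < 2 * s) {ψ : ℝ → ℂ} (hψ : ContDiff ℝ ∞ ψ) (hψs : HasCompactSupport ψ) {m : ℂ → ℂ}
    (hm : ∀ β : ℂ, a ≤ β.re → β.re ≤ b → AnalyticAt ℂ m β)
    (hmF : ∀ β : ℂ, a ≤ β.re → β.re ≤ b → m β * imageTransform s β = laplace ψ β) :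
    ∃ C, ∀ β : ℂ, a ≤ β.re → β.re ≤ b → ‖m β‖ ≤ C * (1 + β.im ^ 2)⁻¹ := by
  obtain ⟨T, c, hT, hc, hl⟩ := exists_le_norm_imageTransform hs0 hs1 ha hb
  -- 6 = 4 + 2: four powers pay for the lower bound of `imageTransform`, two remain as the required
  -- decay.
  obtain ⟨D, hD⟩ := norm_pow_mul_laplace hψ hψs 6 (max |a| |b|)
  have hcont : ContinuousOn m (Icc a b ×ℂ Icc (-T) T) := fun β hβ =>
    (hm β hβ.1.1 hβ.1.2).continuousAt.continuousWithinAt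
  obtain ⟨M, hM⟩ := (isCompact_Icc.reProdIm isCompact_Icc).exists_bound_of_continuousOn hcont
  refine ⟨max (2 * D / c) (M * (1 + T ^ 2)), fun β h1 h2 => ?_⟩
  rw [← div_eq_mul_inv, le_div_iff₀ (by positivity)]
  rcases le_total T |β.im| with h | h
  · refine le_trans ?_ (le_max_left _ _)
    have h3 := hl β h1 h2 h
    have h4 := hD β (abs_le_max_abs_abs h1 h2)
    rw [← hmF β h1 h2, norm_mul] at h4
    have h5 : β.im ^ 2 ≤ ‖β‖ ^ 2 := by
      rw [← sq_abs]; gcongr; exact Complex.abs_im_le_norm β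
    have h6 : 1 ≤ β.im ^ 2 := by
      rw [← sq_abs]; nlinarith
    rw [le_div_iff₀ hc]
    have h7 : ‖m β‖ * ‖β‖ ^ 2 * c ≤ D := by
      calc ‖m β‖ * ‖β‖ ^ 2 * c ≤ ‖m β‖ * ‖β‖ ^ 2 * (‖β‖ ^ 4 * ‖imageTransform s β‖) := by gcongr
        _ = ‖β‖ ^ 6 * (‖m β‖ * ‖imageTransform s β‖) := by ring
        _ ≤ D := h4
    have h8 : ‖m β‖ * (1 + β.im ^ 2) * c ≤ ‖m β‖ * (2 * ‖β‖ ^ 2) * c := by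
      gcongr; linarith
    linarith
  · refine le_trans ?_ (le_max_right _ _)
    have h3 := hM β ⟨⟨h1, h2⟩, abs_le.1 h⟩
    have h5 : β.im ^ 2 ≤ T ^ 2 := by
      rw [← sq_abs]; gcongr
    exact mul_le_mul h3 (by linarith) (by positivity) ((norm_nonneg _).trans h3)

end Quotient

/-! ### Solutions as exponential polynomials -/

section ExponentialPolynomial

/-- In logarithmic coordinates, solutions of moderate growth are exponential polynomials. -/
theorem ae_eq_sum_exp_of_isDistributionalSolution {s γ C : ℝ} (hs0 : 0 < s) (hs1 : s < 1)
    (hγ0 : 0 ≤ γ) (hγ : γ < 2 * s) {u : ℝ → ℂ} (hu : IsDistributionalSolution s u)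
    (hUm : AEStronglyMeasurable fun t => u (Real.exp t))
    (hU : ∀ t, ‖u (Real.exp t)‖ ≤ C * (1 + Real.exp (γ * t))) :
    ∃ (Z : Finset ℂ) (a : ℂ → ℕ → ℂ),
      (∀ β ∈ Z, β = 0 ∨ IsSymbolZero s β ∧ 0 < β.re ∧ β.re < 2 * s) ∧
      ∀ᵐ t : ℝ, u (Real.exp t) = ∑ β ∈ Z, ∑ l ∈ Finset.range (symbolMult s β),
        a β l * ((t : ℂ) ^ l * Complex.exp (β * t)) := by
  obtain ⟨a, ha, ha0, hzero⟩ := exists_zeros_imageTransform_re_nonneg hs0 hs1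
  obtain ⟨b, hγb, hb⟩ := exists_between hγ
  have hfin := finite_zeros_imageTransform hs0 hs1 ha hb
  have hloc : LocallyIntegrable fun t => u (Real.exp t) := by
    have hbd : LocallyIntegrable fun t : ℝ => C * (1 + Real.exp (γ * t)) :=
      Continuous.locallyIntegrable (by fun_prop)
    exact hbd.mono hUm (Eventually.of_forall fun t => (hU t).trans (le_abs_self _))
  obtain ⟨c, hc⟩ := ae_eq_sum_of_integral_eq_zero hloc
    (hfin.toFinset.sigma fun β => Finset.range (symbolMult s β))
    (g := fun k t => (t : ℂ) ^ k.2 * Complex.exp (k.1 * t)) (fun k => by fun_prop)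
    fun ψ hψ hψs horth => by
      obtain ⟨m, hm, hmF⟩ := exists_analytic_quotient (F := imageTransform s) (P := laplace ψ)
        (S := {β | a ≤ β.re ∧ β.re ≤ b})
        (fun β hβ => analyticAt_imageTransform hs1 (by linarith [hβ.1]) (by linarith [hβ.2]))
        (fun β _ => analyticAt_laplace hψ.continuous hψs β)
        (fun β hβ => analyticOrderAt_imageTransform_ne_top hs0 hs1 (by linarith [hβ.1])
          (by linarith [hβ.2]))
        (fun β hβ => by
          -- The l-th derivative of ψ̂ at β is ∫ ψ tˡ e^{βt}, so orthogonality to tˡ e^{βt} for all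
          -- l below the multiplicity is exactly the divisibility required. At a β that is not a
          -- zero there is no such l.
          rw [← natCast_symbolMult hs0 hs1 (by linarith [hβ.1]) (by linarith [hβ.2]),
            natCast_le_analyticOrderAt_iff_iteratedDeriv_eq_zero
              (analyticAt_laplace hψ.continuous hψs β)]
          intro l hl
          have hβ0 : imageTransform s β = 0 := by
            by_contra hne
            have := (analyticAt_imageTransform (β := β) hs1 (by linarith [hβ.1])
              (by linarith [hβ.2])).analyticOrderAt_eq_zero.2 hne
            rw [← natCast_symbolMult hs0 hs1 (by linarith [hβ.1]) (by linarith [hβ.2])] at this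
            have h0 : symbolMult s β = 0 := by exact_mod_cast this
            omega
          rw [iteratedDeriv_laplace hψ.continuous hψs]
          have := horth ⟨β, l⟩ (by simp [hβ0, hβ.1, hβ.2, hl])
          refine (integral_congr_ae (Eventually.of_forall fun t => ?_)).trans this
          simp only
          ring)
      obtain ⟨Cm, hCm⟩ := exists_norm_quotient_le hs0 hs1 ha hb hψ hψs (m := m)
        (fun β h1 h2 => hm β ⟨h1, h2⟩) (fun β h1 h2 => hmF β ⟨h1, h2⟩)
      exact integral_mul_eq_zero_of_convolution_eq_zero ha0 hγ0 hγb hUm hU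
        (fun β h1 h2 => laplace_imageKernel hs0 hs1 (by linarith) (by linarith))
        (integral_mul_imageKernel_eq_zero hs0 hs1 hu) hψ hψs
        (fun β h1 h2 => hm β ⟨h1, h2⟩) (fun β h1 h2 => hmF β ⟨h1, h2⟩) hCm
  refine ⟨hfin.toFinset, fun β l => c ⟨β, l⟩, fun β hβ => ?_, ?_⟩
  · obtain ⟨h1, h2, h3⟩ := hfin.mem_toFinset.1 hβ
    refine (hzero β h1 (by linarith) h3).imp_right fun h => ⟨?_, h, by linarith⟩
    exact isSymbolZero_of_imageTransform_eq_zero hs0 hs1 (by linarith) (by linarith) h3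
  · filter_upwards [hc] with t ht
    rw [ht, Finset.sum_sigma]

/-- A polynomial that is bounded by a constant almost everywhere near `-∞` is constant. -/
theorem Polynomial.degree_le_zero_of_ae_norm_le {p : Polynomial ℂ} {M T : ℝ}
    (h : ∀ᵐ t : ℝ, t ≤ T → ‖p.eval (t : ℂ)‖ ≤ M) : p.degree ≤ 0 := by
  by_contra! hdeg
  have hlim : Tendsto (fun t : ℝ => ‖p.eval (t : ℂ)‖) atBot atTop :=
    p.tendsto_norm_atTop hdeg (by simpa using tendsto_abs_atBot_atTop)
  obtain ⟨B, hB⟩ := eventually_atBot.1 ((hlim.eventually_gt_atTop M).and (eventually_le_atBot T))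
  have h0 : volume (Iic B) = 0 := measure_mono_null (fun t ht => by
    have := hB t ht
    simpa using ⟨this.2, this.1⟩) h
  simp at h0

end ExponentialPolynomial

/-! ### Passing between x and log x -/

section Transfer

/-- The exceptional set in t is contained in the image under log of the one in x, and differentiable
maps of the line preserve null sets. -/
theorem ae_comp_exp {q : ℝ → Prop} (h : ∀ᵐ x ∂(volume.restrict (Ioi (0 : ℝ))), q x) :
    ∀ᵐ t : ℝ, q (Real.exp t) := by
  rw [ae_restrict_iff' measurableSet_Ioi] at h
  have hd : DifferentiableOn ℝ Real.log {x | ¬(x ∈ Ioi (0 : ℝ) → q x)} := fun x hx => by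
    have hx0 : 0 < x := (Classical.not_imp.1 hx).1
    exact (Real.differentiableAt_log hx0.ne').differentiableWithinAt
  refine measure_mono_null (fun t ht => ?_)
    (addHaar_image_eq_zero_of_differentiableOn_of_addHaar_eq_zero volume hd h)
  exact ⟨Real.exp t, fun hq => ht (hq (Real.exp_pos t)), Real.log_exp t⟩

theorem ae_restrict_Ioi_of_ae_comp_exp {q : ℝ → Prop} (h : ∀ᵐ t : ℝ, q (Real.exp t)) :
    ∀ᵐ x ∂(volume.restrict (Ioi (0 : ℝ))), q x := by
  rw [ae_restrict_iff' measurableSet_Ioi]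
  refine measure_mono_null (fun x hx => ?_)
    (addHaar_image_eq_zero_of_differentiableOn_of_addHaar_eq_zero volume
      Real.differentiable_exp.differentiableOn h)
  obtain ⟨hx0, hx1⟩ := Classical.not_imp.1 hx
  refine ⟨Real.log x, ?_, Real.exp_log hx0⟩
  simpa [Real.exp_log hx0] using hx1

theorem aestronglyMeasurable_comp_exp {u : ℝ → ℂ}
    (hu : AEStronglyMeasurable u (volume.restrict (Ioi (0 : ℝ)))) :
    AEStronglyMeasurable fun t => u (Real.exp t) := by
  obtain ⟨v, hv, huv⟩ := hu
  exact ⟨fun t => v (Real.exp t), hv.comp_measurable Real.measurable_exp,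
    ae_comp_exp (q := fun x => u x = v x) huv⟩

theorem tendsto_pow_mul_cexp_atBot {β : ℂ} (hβ : 0 < β.re) (l : ℕ) :
    Tendsto (fun t : ℝ => (t : ℂ) ^ l * Complex.exp (β * t)) atBot (𝓝 0) := by
  rw [tendsto_zero_iff_norm_tendsto_zero]
  have h := ((isLittleO_pow_exp_pos_mul_atTop l hβ).tendsto_div_nhds_zero.norm).comp
    tendsto_neg_atBot_atTop
  rw [norm_zero] at h
  refine h.congr fun t => ?_
  simp only [Function.comp_apply, norm_div, norm_mul, norm_pow, Complex.norm_exp, norm_neg,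
    Complex.norm_real, Real.norm_of_nonneg (Real.exp_pos _).le]
  rw [div_eq_mul_inv, ← Real.exp_neg]
  simp

end Transfer

/-! ### The classification theorem -/

theorem theorem1p2 (s ε C : ℝ) (hs0 : 0 < s) (hs1 : s < 1) (hε0 : 0 < ε) (hε1 : ε < 2 * s)
    (u : ℝ → ℂ) (hu : IsDistributionalSolution s u)
    (hgrowth : ∀ x : ℝ, 0 < x → ‖u x‖ ≤ C * (1 + x ^ (2 * s - ε))) :
    ∃ (A : ℂ) (Z : Finset ℂ) (a : ℂ → ℕ → ℂ),
      (∀ β ∈ Z, IsSymbolZero s β ∧ 0 < β.re ∧ β.re < 2 * s) ∧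
      ∀ᵐ x ∂(volume.restrict (Ioi (0 : ℝ))),
        u x = A + ∑ β ∈ Z, ∑ l ∈ Finset.range (symbolMult s β),
          a β l * (x : ℂ) ^ β * (Real.log x : ℂ) ^ l := by
  have hU : ∀ t, ‖u (Real.exp t)‖ ≤ C * (1 + Real.exp ((2 * s - ε) * t)) := fun t => by
    have h := hgrowth (Real.exp t) (Real.exp_pos t)
    rwa [← Real.exp_mul, mul_comm t] at h
  obtain ⟨Z, a, hZ, hsum⟩ := ae_eq_sum_exp_of_isDistributionalSolution hs0 hs1 (γ := 2 * s - ε)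
    (by linarith) (by linarith) hu (aestronglyMeasurable_comp_exp hu.1) hU
  set R : ℝ → ℂ := fun t => ∑ β ∈ Z.erase 0, ∑ l ∈ Finset.range (symbolMult s β),
    a β l * ((t : ℂ) ^ l * Complex.exp (β * t)) with hR
  -- The contribution of β = 0 is a polynomial in t = log x; all other exponents have positive real
  -- part.
  set p : Polynomial ℂ := if (0 : ℂ) ∈ Z then ∑ l ∈ Finset.range (symbolMult s 0),
    Polynomial.C (a 0 l) * Polynomial.X ^ l else 0 with hp
  have hUp : ∀ᵐ t : ℝ, u (Real.exp t) = p.eval (t : ℂ) + R t := by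
    filter_upwards [hsum] with t ht
    rw [ht]
    by_cases h0 : (0 : ℂ) ∈ Z
    · rw [← Finset.add_sum_erase _ _ h0, hp, if_pos h0]
      simp [hR, Polynomial.eval_finsetSum]
    · rw [hp, if_neg h0, hR, Finset.erase_eq_of_notMem h0]
      simp
  have hZ' : ∀ β ∈ Z.erase 0, IsSymbolZero s β ∧ 0 < β.re ∧ β.re < 2 * s := fun β hβ =>
    (hZ β (Finset.mem_of_mem_erase hβ)).resolve_left (Finset.ne_of_mem_erase hβ)
  have hlim : Tendsto R atBot (𝓝 0) := by
    have : Tendsto R atBot (𝓝 (∑ β ∈ Z.erase 0, ∑ l ∈ Finset.range (symbolMult s β), a β l * 0)) :=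
      tendsto_finsetSum _ fun β hβ => tendsto_finsetSum _ fun l _ =>
        (tendsto_pow_mul_cexp_atBot (hZ' β hβ).2.1 l).const_mul _
    simpa using this
  obtain ⟨T, hT⟩ := eventually_atBot.1 (((tendsto_zero_iff_norm_tendsto_zero.1 hlim).eventually_lt_const
    one_pos).and (eventually_le_atBot 0))
  -- As t → -∞ the growth bound stays below 2|C| and R tends to 0, so p is bounded almost everywhere
  -- on a half-line, hence constant.
  have hdeg : p.degree ≤ 0 := by
    refine Polynomial.degree_le_zero_of_ae_norm_le (M := |C| * 2 + 1) (T := T) ?_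
    filter_upwards [hUp] with t ht htT
    have e : p.eval (t : ℂ) = u (Real.exp t) - R t := by rw [ht]; ring
    obtain ⟨h1, h2⟩ := hT t htT
    have h3 : Real.exp ((2 * s - ε) * t) ≤ 1 := Real.exp_le_one_iff.2
      (mul_nonpos_of_nonneg_of_nonpos (by linarith) h2)
    have h4 : C * (1 + Real.exp ((2 * s - ε) * t)) ≤ |C| * 2 :=
      (mul_le_mul_of_nonneg_right (le_abs_self C) (by positivity)).trans
        (mul_le_mul_of_nonneg_left (by linarith) (abs_nonneg C))
    rw [e]
    exact (norm_sub_le _ _).trans (by linarith [hU t])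
  refine ⟨p.coeff 0, Z.erase 0, a, hZ', ae_restrict_Ioi_of_ae_comp_exp ?_⟩
  filter_upwards [hUp] with t ht
  rw [ht, Polynomial.eq_C_of_degree_le_zero hdeg, Polynomial.eval_C, Polynomial.coeff_C_zero, hR]
  congr 1
  refine Finset.sum_congr rfl fun β _ => Finset.sum_congr rfl fun l _ => ?_
  rw [ofReal_exp_cpow, Real.log_exp]
  ring
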